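/- Let $(\mathcal A,\mathfrak H,D)$ be a spectral triple: $\mathcal A$ is a unital involutive complex algebra with a unital $*$-representation by bounded operators on the complex Hilbert space $\mathfrak H$, $D$ is a self-adjoint operator with compact resolvent, and for every $a\in\mathcal A$ the operator $a$ preserves $\operatorname{Dom} D$ and $[D,a]$ is bounded. Let $p\ge 0$ be an integer. For an operator $T$ with discrete spectrum, $|T|^{-z}$ denotes the complex power on $(\ker T)^\perp$, extended by $0$ on $\ker T$. Assume the following. (1) ($p$-summability) $|D|^{-q}$ is of trace class for every real $q>p$. (2) (Discrete dimension spectrum) With $\delta=[|D|,\cdot\,]$, all $a$ and $[D,a]$, $a\in\mathcal A$, lie in the domain of every power of $\delta$, and there is a closed discrete set $\mathrm{Sd}\subset\mathbb C$ such that for every $b$ in the algebra generated by the operators $\delta^n(a)$, $\delta^n([D,a])$ ($a\in\mathcal A$, $n\ge 0$) the function $\zeta_b(z)=\operatorname{Tr}(b|D|^{-z})$, $\Re z>p$, extends holomorphically to $\mathbb C\setminus \mathrm{Sd}$. For $h=h^*\in\mathcal A$ and $s\in\mathbb R$ put $D_{sh}=e^{sh/2}De^{sh/2}$, with domain $\{x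 : e^{sh/2}x\in\operatorname{Dom}D\}$. Consider the following assumption on $h$. $(E_h)$ For every $f\in\mathcal A$ (in particular for $f=1$) and every $s\in[-1,1]$ there is an asymptotic expansion $$\operatorname{Tr}\big(f e^{-tD_{sh}^2}\big)\ \sim_{t\searrow0}\ \sum_{j=0}^\infty \mathrm a_j(f,D_{sh}^2)\,t^{\frac{j-p}{2}},$$ and it can be differentiated term by term with respect to $s\in[-1,1]$: each $\mathrm a_j(f,D_{sh}^2)$ is a differentiable function of $s\in[-1,1]$, and for every $s\in[-1,1]$ $$\frac{d}{ds}\operatorname{Tr}\big(f e^{-tD_{sh}^2}\big)\ \sim_{t\searrow0}\ \sum_{j=0}^\infty \frac{d}{ds}\mathrm a_j(f,D_{sh}^2)\,t^{\frac{j-p}{2}}.$$ Then the value at the origin of the zeta function is invariant under the conformal deformations $D\mapsto D_{sh}$. Precisely: if $h=h^*\in\mathcal A$ satisfies $(E_h)$, then for $T=D$ and for $T=D_{sh}$ with any $s\in[-1,1]$, the operator $|T|^{-z}$ is of trace class for $\Re z>p$, the function $\zeta_{|T|}(z)=\operatorname{Tr}(|T|^{-z})$ has a meromorphic continuation to $\mathbb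 C$ that is regular at $0$, and $$\zeta_{|D_{sh}|}(0)=\zeta_{|D|}(0)\qquad\text{for all } s\in[-1,1].$$ If $(E_h)$ holds for every $h=h^*\in\mathcal A$, the same is true, with $\zeta_{|D_{sh}|}(0)=\zeta_{|D|}(0)$, for all $h=h^*\in\mathcal A$ and all $s\in\mathbb R$. -/

import Mathlib

noncomputable section

namespace ConformalIndex

open Filter Topology

variable {H : Type*} [NormedAddCommGroup H] [InnerProductSpace ℂ H] [CompleteSpace H]

/-! ### Trace class operators and the trace -/

/-- A bounded operator `T` is of trace class if `∑ ⟪eᵢ, |T| eᵢ⟫ < ∞`, where `|T| = (T* T)^(1/2)`.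
The sum of the diagonal entries of a positive operator does not depend on the Hilbert basis. -/
def IsTraceClass (T : H →L[ℂ] H) : Prop :=
  ∃ (w : Set H) (b : HilbertBasis w ℂ H),
    Summable fun i => (inner ℂ (b i) (CFC.abs T (b i))).re

/-- The trace `Tr T = ∑ ⟪eᵢ, T eᵢ⟫`, with respect to some Hilbert basis; for a trace class
operator it does not depend on the basis. -/
def trace (T : H →L[ℂ] H) : ℂ :=
  ∑' i, inner ℂ ((exists_hilbertBasis ℂ H).choose_spec.choose i)
    (T ((exists_hilbertBasis ℂ H).choose_spec.choose i))

/-! ### Unbounded operators with compact resolvent and their functional calculus -/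

/-- `(D - i)⁻¹` exists as a bounded operator defined everywhere, and it is compact. -/
def HasCompactResolvent (D : H →ₗ.[ℂ] H) : Prop :=
  ∃ R : H →L[ℂ] H, IsCompactOperator R ∧
    (∀ x, ∃ hx : R x ∈ D.domain, D ⟨R x, hx⟩ - Complex.I • R x = x) ∧
    ∀ x : D.domain, R (D x - Complex.I • (x : H)) = x

/-- The eigenspace `{x ∈ Dom D | D x = r x}`. -/
def eigenspace (D : H →ₗ.[ℂ] H) (r : ℝ) : Submodule ℂ H :=
  (LinearMap.ker (D.toFun - (r : ℂ) • D.domain.subtype)).map D.domain.subtype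

/-- The orthogonal projection onto the eigenspace of `r`. (For a closed operator `D` the eigenspace
is closed already.) -/
def spectralProj (D : H →ₗ.[ℂ] H) (r : ℝ) : H →L[ℂ] H :=
  (eigenspace D r).topologicalClosure.starProjection

/-- The functional calculus `g(D) = ∑ g(r) P_r` of a self-adjoint operator `D` with compact
resolvent, for functions `g` that vanish at infinity on the spectrum of `D` (which consists of
isolated eigenvalues of finite multiplicity): the sum converges unconditionally in the operator
norm. -/
def funcCalc (D : H →ₗ.[ℂ] H) (g : ℝ → ℂ) : H →L[ℂ] H :=
  ∑' r : ℝ, g r • spectralProj D r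

/-- The heat operator `e^{-t D²}`, for `t > 0`. -/
def heat (D : H →ₗ.[ℂ] H) (t : ℝ) : H →L[ℂ] H :=
  funcCalc D fun r => ((Real.exp (-(t * r ^ 2)) : ℝ) : ℂ)

/-- The complex power `|D|^{-z}`, for `Re z > 0`; it is zero on the kernel of `D`. -/
def absPow (D : H →ₗ.[ℂ] H) (z : ℂ) : H →L[ℂ] H :=
  funcCalc D fun r => if r = 0 then 0 else ((|r| : ℝ) : ℂ) ^ (-z)

/-- The vector `|D| x = ∑ |r| P_r x`, for `x` in `Dom |D| = Dom D`. -/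
def absApply (D : H →ₗ.[ℂ] H) (x : H) : H :=
  ∑' r : ℝ, ((|r| : ℝ) : ℂ) • spectralProj D r x

/-- The bounded operator `T` is the commutator `[D, a]`: `a` preserves `Dom D`,
and `D a x - a D x = T x` for all `x` in `Dom D`. -/
def IsCommutator (D : H →ₗ.[ℂ] H) (a T : H →L[ℂ] H) : Prop :=
  ∀ x : D.domain, ∃ hx : a x ∈ D.domain, D ⟨a x, hx⟩ - a (D x) = T x

/-- The bounded operator `S` is `δ(T) = [|D|, T]`: `T` preserves `Dom |D| = Dom D`, and
`|D| T x - T |D| x = S x` for all `x` in `Dom D`. -/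
def IsDelta (D : H →ₗ.[ℂ] H) (T S : H →L[ℂ] H) : Prop :=
  ∀ x ∈ D.domain, T x ∈ D.domain ∧ absApply D (T x) - T (absApply D x) = S x

/-! ### Spectral triples -/

/-- A spectral triple `(A, H, D)`: a unital involutive algebra `A` represented by bounded operators
on the Hilbert space `H`, and a (densely defined) self-adjoint operator `D` with compact resolvent
whose commutators with the elements of `A` are bounded. -/
structure SpectralTriple (A H : Type*) [Ring A] [StarRing A] [Algebra ℂ A] [StarModule ℂ A]
    [NormedAddCommGroup H] [InnerProductSpace ℂ H] [CompleteSpace H] where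
  /-- the representation of the algebra -/
  rep : A →⋆ₐ[ℂ] (H →L[ℂ] H)
  /-- the Dirac operator -/
  D : H →ₗ.[ℂ] H
  selfAdjoint : IsSelfAdjoint D
  compactResolvent : HasCompactResolvent D
  boundedCommutator : ∀ a : A, ∃ T : H →L[ℂ] H, IsCommutator D (rep a) T

variable {A : Type*} [Ring A] [StarRing A] [Algebra ℂ A] [StarModule ℂ A]

/-- Summability in dimension `p`: `|D|^{-q}` is of trace class for every `q > p`, so that
`Tr |D|^{-z}` is defined for `Re z > p`. -/
def SpectralTriple.IsSummable (X : SpectralTriple A H) (p : ℕ) : Prop :=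
  ∀ q : ℝ, (p : ℝ) < q → IsTraceClass (absPow X.D (q : ℂ))

/-- The elements `δⁿ(a)` and `δⁿ([D, a])`, with `a` in the algebra and `n ≥ 0`. -/
inductive SpectralTriple.Gen (X : SpectralTriple A H) : (H →L[ℂ] H) → Prop
  | of (a : A) : X.Gen (X.rep a)
  | comm (a : A) (T : H →L[ℂ] H) : IsCommutator X.D (X.rep a) T → X.Gen T
  | delta (T S : H →L[ℂ] H) : X.Gen T → IsDelta X.D T S → X.Gen S

/-- Regularity: all `a` and `[D, a]` belong to the domain of `δⁿ` for all `n`. -/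
def SpectralTriple.IsRegular (X : SpectralTriple A H) : Prop :=
  ∀ T : H →L[ℂ] H, X.Gen T → ∃ S : H →L[ℂ] H, IsDelta X.D T S

/-- Discrete dimension spectrum: the triple is regular and there is a closed discrete set `Sd ⊆ ℂ`
such that for every `b` in the algebra generated by the `δⁿ(a)` and `δⁿ([D, a])` the function
`ζ_b(z) = Tr (b |D|^{-z})`, `Re z > p`, extends holomorphically to the complement of `Sd`. -/
def SpectralTriple.HasDiscreteDimensionSpectrum (X : SpectralTriple A H) (p : ℕ) : Prop :=
  X.IsRegular ∧ ∃ Sd : Set ℂ, IsClosed Sd ∧ IsDiscrete Sd ∧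
    ∀ b ∈ Algebra.adjoin ℂ {T : H →L[ℂ] H | X.Gen T}, ∃ Z : ℂ → ℂ,
      DifferentiableOn ℂ Z Sdᶜ ∧ ∀ z : ℂ, (p : ℝ) < z.re → Z z = trace (b * absPow X.D z)

/-! ### Conformal deformations -/

/-- The operator `k D k`, with domain `{x | k x ∈ Dom D}`. -/
def sandwich (D : H →ₗ.[ℂ] H) (k : H →L[ℂ] H) : H →ₗ.[ℂ] H where
  domain := D.domain.comap k.toLinearMap
  toFun :=
    { toFun := fun x => k (D ⟨k x, x.2⟩)
      map_add' := fun x y => by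
        rw [← map_add, ← LinearPMap.map_add]
        congr 2
        ext
        simp
      map_smul' := fun c x => by
        rw [RingHom.id_apply, ← map_smul, ← LinearPMap.map_smul]
        congr 2
        ext
        simp }

/-- The conformally deformed operator `D_{sh} = e^{sh/2} D e^{sh/2}`. -/
def SpectralTriple.deform (X : SpectralTriple A H) (h : A) (s : ℝ) : H →ₗ.[ℂ] H :=
  sandwich X.D (NormedSpace.exp ((s / 2 : ℂ) • X.rep h))

/-- The heat trace `Tr (f e^{-t D_{sh}²})`. -/
def SpectralTriple.heatTrace (X : SpectralTriple A H) (h f : A) (s t : ℝ) : ℂ :=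
  trace (X.rep f * heat (X.deform h s) t)

/-- The asymptotic expansion `F(t) ∼ ∑_{j ≥ 0} a_j t^{(j - p)/2}` as `t ↘ 0`. -/
def HasExpansion (p : ℕ) (F : ℝ → ℂ) (a : ℕ → ℂ) : Prop :=
  ∀ N : ℕ, (fun t : ℝ => F t - ∑ j ∈ Finset.range (N + 1),
      a j * ((t ^ (((j : ℝ) - p) / 2) : ℝ) : ℂ))
    =o[𝓝[>] (0 : ℝ)] fun t : ℝ => t ^ (((N : ℝ) - p) / 2)

/-- For every `f` in the algebra (in particular for `f = 1`) the heat trace `Tr (f e^{-t D_{sh}²})`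
has for each `s ∈ [-1, 1]` an asymptotic expansion
`∑ a_j(f, D_{sh}²) t^{(j - p)/2}` as `t ↘ 0`, and the expansion can be differentiated term by term
in `s`: the coefficients are differentiable functions of `s ∈ [-1, 1]` and their derivatives are the
coefficients of the expansion of the derivative of the heat trace. -/
def SpectralTriple.HasHeatExpansions (X : SpectralTriple A H) (p : ℕ) (h : A) : Prop :=
  ∀ f : A, ∃ a : ℕ → ℝ → ℂ,
    (∀ s ∈ Set.Icc (-1 : ℝ) 1, HasExpansion p (fun t => X.heatTrace h f s t) fun j => a j s) ∧
    (∀ j, DifferentiableOn ℝ (a j) (Set.Icc (-1) 1)) ∧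
    ∀ s ∈ Set.Icc (-1 : ℝ) 1,
      HasExpansion p (fun t => derivWithin (fun u => X.heatTrace h f u t) (Set.Icc (-1) 1) s)
        fun j => derivWithin (a j) (Set.Icc (-1) 1) s

/-- The zeta function `ζ_{|D|}(z) = Tr |D|^{-z}`, `Re z > p`, is defined, it has a meromorphic
continuation to the complex plane which is regular at the origin, and `ζ_{|D|}(0) = v`. -/
def HasZetaAtZero (D : H →ₗ.[ℂ] H) (p : ℕ) (v : ℂ) : Prop :=
  ∃ Z : ℂ → ℂ, Meromorphic Z ∧
    (∀ z : ℂ, (p : ℝ) < z.re → IsTraceClass (absPow D z) ∧ Z z = trace (absPow D z)) ∧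
    AnalyticAt ℂ Z 0 ∧ Z 0 = v

end ConformalIndex

end

noncomputable section

namespace ConformalIndex

open Filter Topology Asymptotics

universe u

variable {H : Type u} [NormedAddCommGroup H] [InnerProductSpace ℂ H] [CompleteSpace H]

/-! ### The spectral theorem for operators with compact resolvent -/

/-! Write D_s for the deformed operator. The Mellin transform turns the heat expansion of D_s into a
meromorphic continuation of its zeta function, with ζ(0) = a_p(1, D_s²) − dim ker D_s
(`IsHeatDiag.hasZetaAtZero`). The kernel dimension does not depend on s, because e^{sh/2} maps ker
D_s onto ker D. It remains to see that a_p is constant.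

Formally, d/ds Tr e^{-tD_s²} = −2t Tr(h D_s² e^{-tD_s²}) = 2t d/dt Tr(h e^{-tD_s²}). The left side
expands with coefficients a_j'(s), and Tr(h e^{-tD_s²}) has an expansion in powers of t^{1/2} with
no logarithm. A constant term c on the left would integrate to (c/2) log t, so c = a_p'(s) = 0
(`HasExpansion.constant_term_eq_zero`). Integrating, rather than differentiating an expansion in t,
is what makes this legitimate.

The analytic core is the variation formula (`HasHeatDiags.hasDerivWithinAt_heatRe_one`). It is
obtained from convexity, without Duhamel's formula. Let Q = VPV with V self-adjoint and invertible,
V' = V⁻¹, and P e_i = l_i e_i. Then Q V' e_i = l_i V e_i, so the tangent line of φ(y) = e^{-ty} at y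
= l_i² bounds ⟨V'e_i, e^{-tQ²} V'e_i⟩ from below by an expression in ‖V e_i‖, ‖V'e_i‖ and l_i alone.
Summing over i gives an inequality between heat traces of Q and P (`IsConj.heatRe_le`). For V =
e^{(u-s)h/2} it is a one-sided first-order estimate; exchanging P and Q gives the other side. The
two agree to first order once Tr(h e^{-tD_s²}) and Tr(h D_s² e^{-tD_s²}) are continuous in s. The
same convexity inequality yields the uniform bounds, this continuity (through the Hilbert-Schmidt
distance of e^{-tQ²/2} and e^{-tP²/2}) and, with φ(y) = (1+y)^{-a}, the summability of the
eigenvalues of D_s.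

All of this takes place in eigenbases, which exist because each D_s again has a compact resolvent
(`exists_isDiag_sandwich`). -/

/-- The Hilbert basis `b` diagonalizes `D`, with real eigenvalues `l i` that tend to infinity in
absolute value. -/
def IsDiag {ι : Type*} (D : H →ₗ.[ℂ] H) (b : HilbertBasis ι ℂ H) (l : ι → ℝ) : Prop :=
  Tendsto (fun i => |l i|) cofinite atTop ∧
    ∀ x y, (x, y) ∈ D.graph ↔ ∀ i, inner ℂ (b i) y = l i * inner ℂ (b i) x

-- Orthonormal vectors are at mutual distance √2, so an infinite family of them cannot lie in the
-- compact closure of the image of a ball.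
omit [CompleteSpace H] in
lemma finite_of_orthonormal_of_isCompactOperator {ι : Type*} {v : ι → H} (hv : Orthonormal ℂ v)
    {R : H →L[ℂ] H} (hR : IsCompactOperator R) {w : ι → H} {C : ℝ} (hw : ∀ i, ‖w i‖ ≤ C)
    (h : ∀ i, v i = R (w i)) : Finite ι := by
  by_contra hfin
  rw [not_finite_iff_infinite] at hfin
  obtain ⟨f⟩ : Nonempty (ℕ ↪ ι) := ⟨Infinite.natEmbedding ι⟩
  have hK := hR.isCompact_closure_image_closedBall C
  have hmem : ∀ n, v (f n) ∈ closure (R '' Metric.closedBall 0 C) := fun n =>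
    subset_closure ⟨w (f n), by simpa using hw (f n), (h _).symm⟩
  obtain ⟨a, -, g, hg, hlim⟩ := hK.tendsto_subseq hmem
  have hc := hlim.cauchySeq
  rw [Metric.cauchySeq_iff] at hc
  obtain ⟨N, hN⟩ := hc 1 one_pos
  have h1 := hN N le_rfl (N + 1) (Nat.le_succ N)
  have hne : f (g N) ≠ f (g (N + 1)) := fun e =>
    (hg (Nat.lt_succ_self N)).ne (f.injective e)
  have h2 : ‖v (f (g N)) - v (f (g (N + 1)))‖ ^ 2 = 2 := by
    rw [@norm_sub_sq ℂ, hv.1, hv.1, hv.2 hne]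
    norm_num
  rw [dist_eq_norm] at h1
  simp only [Function.comp_apply] at h1
  nlinarith [norm_nonneg (v (f (g N)) - v (f (g (N + 1))))]

lemma exists_eigenbasis {N : H →L[ℂ] H} (hN : IsCompactOperator N)
    (hs : (N : H →ₗ[ℂ] H).IsSymmetric) :
    ∃ (ι : Type u) (b : HilbertBasis ι ℂ H) (ν : ι → ℝ), ∀ i, N (b i) = (ν i : ℂ) • b i := by
  have hcl : ∀ μ : ℂ, CompleteSpace (Module.End.eigenspace (N : H →ₗ[ℂ] H) μ) := by
    intro μ
    have : IsClosed (Module.End.eigenspace (N : H →ₗ[ℂ] H) μ : Set H) := by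
      have h1 : (Module.End.eigenspace (N : H →ₗ[ℂ] H) μ : Set H) = {x | N x = μ • x} := by
        ext x; simp
      rw [h1]
      exact isClosed_eq N.continuous (continuous_const_smul μ)
    exact this.completeSpace_coe
  have hb : ∀ μ : ℂ, ∃ (w : Set (Module.End.eigenspace (N : H →ₗ[ℂ] H) μ))
      (b : HilbertBasis w ℂ (Module.End.eigenspace (N : H →ₗ[ℂ] H) μ)), True := by
    intro μ
    obtain ⟨w, b, -⟩ := exists_hilbertBasis ℂ (Module.End.eigenspace (N : H →ₗ[ℂ] H) μ)
    exact ⟨w, b, trivial⟩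
  choose w b _ using hb
  -- The index runs over all complex μ, including 0; when μ is not an eigenvalue its eigenspace is
  -- trivial and contributes nothing.
  let v : (Σ μ : ℂ, w μ) → H := fun a =>
    ((b a.1 a.2 : Module.End.eigenspace (N : H →ₗ[ℂ] H) a.1) : H)
  have horth : Orthonormal ℂ v :=
    hs.orthogonalFamily_eigenspaces.orthonormal_sigma_orthonormal (fun μ => (b μ).orthonormal)
  have hbot : (Submodule.span ℂ (Set.range v))ᗮ = ⊥ := by
    rw [eq_bot_iff, ← ContinuousLinearMap.orthogonalComplement_iSup_eigenspaces_eq_bot hN hs,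
      ← Submodule.iInf_orthogonal]
    intro x hx
    simp only [Submodule.mem_iInf]
    intro μ
    rw [Submodule.mem_orthogonal']
    intro y hy
    have h1 := (b μ).hasSum_repr ⟨y, hy⟩
    have h2 := h1.mapL ((innerSL ℂ x).comp (Module.End.eigenspace (N : H →ₗ[ℂ] H) μ).subtypeL)
    have h3 : ∀ i : w μ, ((innerSL ℂ x).comp (Module.End.eigenspace (N : H →ₗ[ℂ] H) μ).subtypeL)
        ((b μ).repr ⟨y, hy⟩ i • b μ i) = 0 := by
      intro i
      have h4 := (Submodule.mem_orthogonal' _ _).1 hx (v ⟨μ, i⟩) (Submodule.subset_span ⟨_, rfl⟩)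
      rw [map_smul]
      simp only [ContinuousLinearMap.comp_apply, Submodule.subtypeL_apply, innerSL_apply_apply]
      rw [h4, smul_zero]
    simp only [h3] at h2
    simpa using h2.unique hasSum_zero
  refine ⟨(Σ μ : ℂ, w μ), HilbertBasis.mkOfOrthogonalEqBot horth hbot, fun a => a.1.re, ?_⟩
  rintro ⟨μ, i⟩
  rw [HilbertBasis.coe_mkOfOrthogonalEqBot]
  have hmem : N (v ⟨μ, i⟩) = μ • v ⟨μ, i⟩ :=
    Module.End.mem_eigenspace_iff.1 (b μ i).2
  have hne : v ⟨μ, i⟩ ≠ 0 := horth.ne_zero ⟨μ, i⟩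
  have hreal : (starRingEnd ℂ) μ = μ :=
    hs.conj_eigenvalue_eq_self (Module.End.hasEigenvalue_of_hasEigenvector
      ⟨(b μ i).2, hne⟩)
  rw [Complex.conj_eq_iff_re.1 hreal]
  exact hmem

-- Otherwise unit eigenvectors for all r in [0, 1] would form an infinite orthonormal family inside
-- the image under `R` of a bounded set. The resolvent relation x = R (y − B x) is kept abstract in
-- order to cover `k D k`, for which `B` is not scalar.
omit [CompleteSpace H] in
lemma exists_real_not_eigenvalue {D : H →ₗ.[ℂ] H} {R B : H →L[ℂ] H} (hR : IsCompactOperator R)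
    (hG : ∀ x y, (x, y) ∈ D.graph ↔ x = R (y - B x))
    (hS : ∀ x y z w, (x, y) ∈ D.graph → (z, w) ∈ D.graph → inner ℂ y z = inner ℂ x w) :
    ∃ r : ℝ, ∀ x, (x, (r : ℂ) • x) ∈ D.graph → x = 0 := by
  by_contra! hcon
  choose x hx hx0 using hcon
  set v : Set.Icc (0 : ℝ) 1 → H := fun r => ((‖x r‖ : ℂ))⁻¹ • x r with hv
  have hvg : ∀ r, (v r, ((r : ℝ) : ℂ) • v r) ∈ D.graph := by
    intro r
    have := D.graph.smul_mem ((‖x r‖ : ℂ))⁻¹ (hx r)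
    rw [Prod.smul_mk, smul_comm] at this
    exact this
  have hn : ∀ r, ‖v r‖ = 1 := by
    intro r
    simp only [hv, norm_smul, norm_inv, Complex.norm_real, norm_norm]
    exact inv_mul_cancel₀ (norm_ne_zero_iff.2 (hx0 r))
  have ho : Orthonormal ℂ v := by
    refine ⟨hn, fun r r' hrr => ?_⟩
    have h1 := hS _ _ _ _ (hvg r) (hvg r')
    rw [inner_smul_left _ (v r'), inner_smul_right (v r) (v r'), Complex.conj_ofReal] at h1
    have h2 : (((r : ℝ) : ℂ) - ((r' : ℝ) : ℂ)) * inner ℂ (v r) (v r') = 0 := by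
      rw [sub_mul, h1, sub_self]
    rcases mul_eq_zero.1 h2 with h3 | h3
    · exact absurd (Subtype.ext (by exact_mod_cast sub_eq_zero.1 h3)) hrr
    · exact h3
  have hfin := finite_of_orthonormal_of_isCompactOperator ho hR
    (w := fun r => ((r : ℝ) : ℂ) • v r - B (v r)) (C := 1 + ‖B‖) (fun r => by
      refine (norm_sub_le _ _).trans (add_le_add ?_ ?_)
      · rw [norm_smul, hn, mul_one, Complex.norm_real, Real.norm_eq_abs, abs_of_nonneg r.2.1]
        exact r.2.2
      · simpa [hn] using B.le_opNorm (v r)) (fun r => (hG _ _).1 (hvg r))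
  exact (Set.Icc_infinite (zero_lt_one (α := ℝ))).not_finite (Set.toFinite _)

/-- For a real r that is not an eigenvalue, Fredholm's alternative inverts 1 − R (r − B), and N = (1
− R (r − B))⁻¹ R is (D − r)⁻¹. It is compact, injective, and symmetric because r is real. An
eigenbasis of N with eigenvalues ν diagonalizes D with eigenvalues r + 1/ν. -/
theorem exists_isDiag {D : H →ₗ.[ℂ] H} {R B : H →L[ℂ] H} (hR : IsCompactOperator R)
    (hG : ∀ x y, (x, y) ∈ D.graph ↔ x = R (y - B x))
    (hS : ∀ x y z w, (x, y) ∈ D.graph → (z, w) ∈ D.graph → inner ℂ y z = inner ℂ x w) :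
    ∃ (ι : Type u) (b : HilbertBasis ι ℂ H) (l : ι → ℝ), IsDiag D b l := by
  obtain ⟨r, hr⟩ := exists_real_not_eigenvalue hR hG hS
  set C : H →L[ℂ] H := R * ((r : ℂ) • 1 - B) with hC
  have hCc : IsCompactOperator C := hR.comp_clm _
  have hCx : ∀ x, C x = R ((r : ℂ) • x - B x) := fun x => rfl
  have hres : (1 : ℂ) ∈ resolventSet ℂ C := by
    refine (hCc.hasEigenvalue_or_mem_resolventSet one_ne_zero).resolve_left fun he => ?_
    obtain ⟨x, hx, hx0⟩ := he.exists_hasEigenvector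
    rw [Module.End.mem_eigenspace_iff, one_smul] at hx
    exact hx0 (hr x ((hG _ _).2 (by rw [← hCx]; exact hx.symm)))
  rw [spectrum.mem_resolventSet_iff, map_one] at hres
  obtain ⟨S, hSu⟩ := hres
  set N : H →L[ℂ] H := (↑S⁻¹ : H →L[ℂ] H) * R with hN
  have hNc : IsCompactOperator N := hR.clm_comp _
  have hinv : ∀ x y, x - C x = y ↔ x = (↑S⁻¹ : H →L[ℂ] H) y := by
    intro x y
    have h1 : ∀ z, (↑S⁻¹ : H →L[ℂ] H) (z - C z) = z := fun z => by
      have := congrArg (fun T : H →L[ℂ] H => T z) (S.inv_mul)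
      rw [hSu] at this
      simpa using this
    have h2 : ∀ z, (↑S⁻¹ : H →L[ℂ] H) z - C ((↑S⁻¹ : H →L[ℂ] H) z) = z := fun z => by
      have := congrArg (fun T : H →L[ℂ] H => T z) (S.mul_inv)
      rw [hSu] at this
      simpa using this
    constructor
    · rintro rfl; rw [h1]
    · rintro rfl; rw [h2]
  have hNG : ∀ x y, (x, y) ∈ D.graph ↔ x = N (y - (r : ℂ) • x) := by
    intro x y
    rw [hG, hN, mul_apply_eq_comp, ← hinv, sub_eq_iff_eq_add, hCx, ← map_add]
    simp
  have hNr : ∀ y, (N y, y + (r : ℂ) • N y) ∈ D.graph := fun y => by rw [hNG]; simp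
  have hNs : (N : H →ₗ[ℂ] H).IsSymmetric := by
    intro y y'
    have h1 := hS _ _ _ _ (hNr y) (hNr y')
    rw [inner_add_left, inner_add_right, inner_smul_left, inner_smul_right, Complex.conj_ofReal]
      at h1
    exact (add_right_cancel h1).symm
  obtain ⟨ι, b, ν, hb⟩ := exists_eigenbasis hNc hNs
  have hNinj : ∀ y, N y = 0 → y = 0 := by
    intro y hy
    have := hNr y
    rw [hy, smul_zero, add_zero] at this
    exact D.graph_fst_eq_zero_snd this rfl
  have hν : ∀ i, (ν i : ℂ) ≠ 0 := fun i h0 => b.orthonormal.ne_zero i (hNinj _ (by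
    rw [hb, h0, zero_smul]))
  have hcoord : ∀ i y, inner ℂ (b i) (N y) = ν i * inner ℂ (b i) y := by
    intro i y
    have h1 := hNs (b i) y
    simp only [ContinuousLinearMap.coe_coe] at h1
    rw [hb, inner_smul_left, Complex.conj_ofReal] at h1
    exact h1.symm
  have hext : ∀ x y, (∀ i, inner ℂ (b i) x = inner ℂ (b i) y) → x = y := by
    intro x y h
    apply b.repr.injective
    ext i
    rw [b.repr_apply_apply, b.repr_apply_apply, h]
  refine ⟨ι, b, fun i => r + (ν i)⁻¹, ?_, ?_⟩
  · rw [tendsto_atTop]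
    intro K
    rw [eventually_cofinite]
    -- If |r + 1/ν| < K then b_i = N (ν⁻¹ b_i) with ‖ν⁻¹ b_i‖ ≤ K + |r|.
    have hfin := finite_of_orthonormal_of_isCompactOperator
      (b.orthonormal.comp (fun i : {i | ¬ K ≤ |r + (ν i)⁻¹|} => (i : ι)) Subtype.val_injective) hNc
      (w := fun i => ((ν i : ℂ))⁻¹ • b i) (C := K + |r|) (fun i => by
        rw [norm_smul, b.orthonormal.1, mul_one, norm_inv, Complex.norm_real, Real.norm_eq_abs,
          ← abs_inv]
        have h1 : |r + (ν i)⁻¹| < K := not_le.1 i.2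
        have h2 : (ν (i : ι))⁻¹ = (r + (ν i)⁻¹) - r := by ring
        rw [h2]
        exact (abs_sub _ _).trans (by linarith)) (fun i => by
        rw [map_smul, hb, smul_smul, inv_mul_cancel₀ (hν i), one_smul]; rfl)
    exact Set.toFinite _
  · intro x y
    rw [hNG]
    have key : ∀ i, inner ℂ (b i) (N (y - (r : ℂ) • x)) =
        ν i * (inner ℂ (b i) y - r * inner ℂ (b i) x) := by
      intro i
      rw [hcoord, inner_sub_right, inner_smul_right]
    constructor
    · intro h i
      have h1 := key i
      rw [← h] at h1
      push_cast
      rw [add_mul]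
      nth_rewrite 2 [h1]
      rw [← mul_assoc, inv_mul_cancel₀ (hν i)]
      ring
    · intro h
      apply hext
      intro i
      rw [key, h i]
      push_cast
      rw [add_mul, add_sub_cancel_left, ← mul_assoc, mul_inv_cancel₀ (hν i), one_mul]

/-! ### The operators of a spectral triple -/

omit [CompleteSpace H] in
lemma mem_graph_sandwich {D : H →ₗ.[ℂ] H} {k k' : H →L[ℂ] H} (h1 : k * k' = 1) (h2 : k' * k = 1)
    (x y : H) : (x, y) ∈ (sandwich D k).graph ↔ (k x, k' y) ∈ D.graph := by
  have e1 : ∀ z, k (k' z) = z := fun z => by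
    simpa using congrArg (fun T : H →L[ℂ] H => T z) h1
  have e2 : ∀ z, k' (k z) = z := fun z => by
    simpa using congrArg (fun T : H →L[ℂ] H => T z) h2
  simp only [LinearPMap.mem_graph_iff]
  constructor
  · rintro ⟨a, rfl, h⟩
    refine ⟨⟨k a, a.2⟩, rfl, ?_⟩
    rw [← e2 (D ⟨k a, a.2⟩)]
    exact congrArg k' h
  · rintro ⟨a, ha, h⟩
    refine ⟨⟨x, show k x ∈ D.domain from ha ▸ a.2⟩, rfl, ?_⟩
    have : (⟨k x, ha ▸ a.2⟩ : D.domain) = a := Subtype.ext ha.symm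
    change k (D ⟨k x, ha ▸ a.2⟩) = y
    rw [this, h, e1]

lemma inner_eq_of_isSelfAdjoint {D : H →ₗ.[ℂ] H} (hD : IsSelfAdjoint D) (x y z w : H)
    (hx : (x, y) ∈ D.graph) (hz : (z, w) ∈ D.graph) : inner ℂ y z = inner ℂ x w := by
  rw [LinearPMap.mem_graph_iff] at hx hz
  obtain ⟨a, rfl, rfl⟩ := hx
  obtain ⟨c, rfl, rfl⟩ := hz
  have h := LinearPMap.adjoint_isFormalAdjoint hD.dense_domain
  rw [LinearPMap.isSelfAdjoint_def.1 hD] at h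
  exact h a c

omit [CompleteSpace H] in
lemma HasCompactResolvent.exists_graph {D : H →ₗ.[ℂ] H} (h : HasCompactResolvent D) :
    ∃ R : H →L[ℂ] H, IsCompactOperator R ∧
      ∀ x y, (x, y) ∈ D.graph ↔ x = R (y - (Complex.I • (1 : H →L[ℂ] H)) x) := by
  obtain ⟨R, hR, h1, h2⟩ := h
  refine ⟨R, hR, fun x y => ⟨fun hx => ?_, fun hx => ?_⟩⟩
  · rw [LinearPMap.mem_graph_iff] at hx
    obtain ⟨a, rfl, rfl⟩ := hx
    exact (h2 a).symm
  · obtain ⟨hm, he⟩ := h1 (y - (Complex.I • (1 : H →L[ℂ] H)) x)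
    rw [LinearPMap.mem_graph_iff]
    refine ⟨⟨_, hm⟩, hx.symm, ?_⟩
    have : Complex.I • R (y - (Complex.I • (1 : H →L[ℂ] H)) x)
        = (Complex.I • (1 : H →L[ℂ] H)) x := by
      rw [← hx]; rfl
    rw [this] at he
    exact sub_left_injective he

/-- An operator `k D k`, with `D` self-adjoint with compact resolvent and `k` positive and
invertible, is diagonalizable. -/
theorem exists_isDiag_sandwich {D : H →ₗ.[ℂ] H} (hD : IsSelfAdjoint D) (hc : HasCompactResolvent D)
    {k k' : H →L[ℂ] H} (h1 : k * k' = 1) (h2 : k' * k = 1) (hk : IsSelfAdjoint k) :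
    ∃ (ι : Type u) (b : HilbertBasis ι ℂ H) (l : ι → ℝ), IsDiag (sandwich D k) b l := by
  have e1 : ∀ z, k (k' z) = z := fun z => by
    simpa using congrArg (fun T : H →L[ℂ] H => T z) h1
  have e2 : ∀ z, k' (k z) = z := fun z => by
    simpa using congrArg (fun T : H →L[ℂ] H => T z) h2
  obtain ⟨R, hR, hG⟩ := hc.exists_graph
  have hks : ∀ x y, inner ℂ (k x) y = inner ℂ x (k y) := fun x y => by
    have := ContinuousLinearMap.isSelfAdjoint_iff_isSymmetric.1 hk x y
    exact this
  -- The equation y = k D k x means k x = R (k' y − i k x), that is, x = k' R k' (y − i k² x).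
  refine exists_isDiag (R := k' * R * k') (B := Complex.I • (k * k))
    ((hR.comp_clm k').clm_comp k') ?_ ?_
  · intro x y
    rw [mem_graph_sandwich h1 h2, hG]
    simp only [mul_apply_eq_comp, smul_apply,
      one_apply_eq_self, map_sub, map_smul, e2]
    constructor
    · intro h
      have h3 := congrArg k' h
      rwa [e2, map_sub, map_smul] at h3
    · intro h
      nth_rewrite 1 [h]
      rw [map_sub, map_smul, e1, e1]
  · intro x y z w hx hz
    rw [mem_graph_sandwich h1 h2] at hx hz
    have h := inner_eq_of_isSelfAdjoint hD _ _ _ _ hx hz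
    rw [← hks, e1, hks, e1] at h
    exact h

/-! ### Diagonal operators -/

/-- The bounded operator `T` is diagonal in the Hilbert basis `b`, with diagonal entries `c i`. -/
def IsDiagOp {ι : Type*} (b : HilbertBasis ι ℂ H) (c : ι → ℂ) (T : H →L[ℂ] H) : Prop :=
  ∀ x i, inner ℂ (b i) (T x) = c i * inner ℂ (b i) x

section Basis

variable {ι : Type*} (b : HilbertBasis ι ℂ H)

omit [CompleteSpace H] in
lemma basis_ext {x y : H} (h : ∀ i, inner ℂ (b i) x = inner ℂ (b i) y) : x = y := by
  apply b.repr.injective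
  ext i
  rw [b.repr_apply_apply, b.repr_apply_apply, h]

omit [CompleteSpace H] in
lemma hasSum_norm_inner_sq (x : H) : HasSum (fun i => ‖inner ℂ (b i) x‖ ^ 2) (‖x‖ ^ 2) := by
  have h := Complex.hasSum_re (b.hasSum_inner_mul_inner x x)
  have h2 : (inner ℂ x x : ℂ).re = ‖x‖ ^ 2 := by
    rw [inner_self_eq_norm_sq_to_K]; norm_cast
  rw [h2] at h
  convert h using 2 with i
  rw [← inner_conj_symm x (b i), Complex.conj_mul']
  norm_cast

omit [CompleteSpace H] in
lemma inner_basis [DecidableEq ι] (i j : ι) : inner ℂ (b i) (b j) = if i = j then (1 : ℂ) else 0 :=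
  orthonormal_iff_ite.1 b.orthonormal i j

end Basis

section DiagOp

variable {ι : Type*} {b : HilbertBasis ι ℂ H} {c d : ι → ℂ} {T S : H →L[ℂ] H}

omit [CompleteSpace H]

lemma IsDiagOp.apply_basis (hT : IsDiagOp b c T) (i : ι) : T (b i) = c i • b i := by
  classical
  apply basis_ext b
  intro j
  rw [hT, inner_smul_right, inner_basis]
  split_ifs with h
  · rw [h]
  · simp

lemma IsDiagOp.unique (hT : IsDiagOp b c T) (hS : IsDiagOp b c S) : T = S := by
  ext x
  exact basis_ext b fun i => by rw [hT, hS]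

lemma IsDiagOp.sub (hT : IsDiagOp b c T) (hS : IsDiagOp b d S) :
    IsDiagOp b (fun i => c i - d i) (T - S) := fun x i => by
  rw [sub_apply, inner_sub_right, hT, hS, sub_mul]

lemma IsDiagOp.smul (hT : IsDiagOp b c T) (a : ℂ) :
    IsDiagOp b (fun i => a * c i) (a • T) := fun x i => by
  rw [smul_apply, inner_smul_right, hT, mul_assoc]

lemma IsDiagOp.sum {κ : Type*} {s : Finset κ} {c : κ → ι → ℂ} {T : κ → H →L[ℂ] H}
    (hT : ∀ k ∈ s, IsDiagOp b (c k) (T k)) :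
    IsDiagOp b (fun i => ∑ k ∈ s, c k i) (∑ k ∈ s, T k) := fun x i => by
  rw [sum_apply, inner_sum, Finset.sum_mul]
  exact Finset.sum_congr rfl fun k hk => hT k hk x i

lemma IsDiagOp.mul (hT : IsDiagOp b c T) (hS : IsDiagOp b d S) :
    IsDiagOp b (fun i => c i * d i) (T * S) := fun x i => by
  rw [mul_apply_eq_comp, hT, hS, mul_assoc]

lemma IsDiagOp.norm_apply_le (hT : IsDiagOp b c T) {C : ℝ} (hC : ∀ i, ‖c i‖ ≤ C) (hC0 : 0 ≤ C)
    (x : H) : ‖T x‖ ≤ C * ‖x‖ := by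
  refine abs_le_of_sq_le_sq' ?_ (by positivity) |>.2
  have h1 := hasSum_norm_inner_sq b (T x)
  have h2 := (hasSum_norm_inner_sq b x).mul_left (C ^ 2)
  rw [mul_pow]
  refine hasSum_le (fun i => ?_) h1 h2
  rw [hT, norm_mul, mul_pow]
  gcongr
  exact hC i

lemma IsDiagOp.norm_le (hT : IsDiagOp b c T) {C : ℝ} (hC : ∀ i, ‖c i‖ ≤ C) (hC0 : 0 ≤ C) :
    ‖T‖ ≤ C :=
  T.opNorm_le_bound hC0 (hT.norm_apply_le hC hC0)

lemma exists_isDiagOp (b : HilbertBasis ι ℂ H) {c : ι → ℂ} {C : ℝ} (hC : ∀ i, ‖c i‖ ≤ C) :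
    ∃ T : H →L[ℂ] H, IsDiagOp b c T := by
  have hmem : ∀ x : H, Memℓp (fun i => c i * b.repr x i) 2 := by
    intro x
    apply memℓp_gen
    have h1 := (hasSum_norm_inner_sq b x).summable.mul_left (C ^ 2)
    refine Summable.of_nonneg_of_le (fun i => by positivity) (fun i => ?_) h1
    rw [ENNReal.toReal_ofNat, Real.rpow_ofNat, norm_mul, mul_pow, b.repr_apply_apply]
    gcongr
    exact hC i
  let L : H →ₗ[ℂ] H :=
    { toFun := fun x => b.repr.symm ⟨_, hmem x⟩
      map_add' := fun x y => by
        rw [← map_add]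
        congr 1
        ext i
        simp only [map_add, lp.coeFn_add, Pi.add_apply, mul_add]
      map_smul' := fun a x => by
        rw [RingHom.id_apply, ← map_smul]
        congr 1
        ext i
        simp [mul_left_comm] }
  have hL : ∀ x i, inner ℂ (b i) (L x) = c i * inner ℂ (b i) x := by
    intro x i
    rw [← b.repr_apply_apply, ← b.repr_apply_apply]
    simp [L]
  refine ⟨L.mkContinuous |C| fun x => ?_, hL⟩
  refine abs_le_of_sq_le_sq' ?_ (by positivity) |>.2
  have h1 := hasSum_norm_inner_sq b (L x)
  have h2 := (hasSum_norm_inner_sq b x).mul_left (|C| ^ 2)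
  rw [mul_pow]
  refine hasSum_le (fun i => ?_) h1 h2
  rw [hL, norm_mul, mul_pow]
  gcongr
  exact (hC i).trans (le_abs_self C)

lemma IsDiagOp.hasSum_inner (hT : IsDiagOp b c T) (x y : H) :
    HasSum (fun i => c i * (inner ℂ x (b i) * inner ℂ (b i) y)) (inner ℂ x (T y)) := by
  have h := b.hasSum_inner_mul_inner x (T y)
  have he : (fun i => inner ℂ x (b i) * inner ℂ (b i) (T y)) =
      fun i => c i * (inner ℂ x (b i) * inner ℂ (b i) y) := by
    ext i
    rw [hT]
    ring
  exact he ▸ h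

lemma IsDiagOp.inner_symm {c : ι → ℝ} (hT : IsDiagOp b (fun i => (c i : ℂ)) T) (x y : H) :
    inner ℂ (T x) y = inner ℂ x (T y) := by
  have h1 := hT.hasSum_inner x y
  have h2 := b.hasSum_inner_mul_inner (T x) y
  have he : (fun i => inner ℂ (T x) (b i) * inner ℂ (b i) y) =
      fun i => (c i : ℂ) * (inner ℂ x (b i) * inner ℂ (b i) y) := by
    ext i
    rw [← inner_conj_symm, hT, map_mul, Complex.conj_ofReal, inner_conj_symm]
    ring
  rw [he] at h2
  exact h2.unique h1

lemma IsDiagOp.hasSum_re_inner_self {c : ι → ℝ} (hT : IsDiagOp b (fun i => (c i : ℂ)) T) (x : H) :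
    HasSum (fun i => c i * ‖inner ℂ (b i) x‖ ^ 2) (inner ℂ x (T x)).re := by
  have h := Complex.hasSum_re (hT.hasSum_inner x x)
  convert h using 2 with i
  rw [← inner_conj_symm x (b i), Complex.conj_mul']
  norm_cast

end DiagOp

section Abs

variable {ι : Type*} {b : HilbertBasis ι ℂ H}

omit [CompleteSpace H] in
lemma IsDiagOp.nonneg {c : ι → ℝ} {T : H →L[ℂ] H} (hT : IsDiagOp b (fun i => (c i : ℂ)) T)
    (hc : ∀ i, 0 ≤ c i) : 0 ≤ T := by
  rw [ContinuousLinearMap.nonneg_iff_isPositive]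
  refine ⟨fun x y => hT.inner_symm x y, fun x => ?_⟩
  have h := hT.hasSum_re_inner_self x
  have h2 : inner ℂ (T x) x = inner ℂ x (T x) := hT.inner_symm x x
  change 0 ≤ (inner ℂ (T x) x : ℂ).re
  rw [h2]
  exact h.nonneg fun i => mul_nonneg (hc i) (sq_nonneg _)

lemma IsDiagOp.star {c : ι → ℂ} {T : H →L[ℂ] H} (hT : IsDiagOp b c T) :
    IsDiagOp b (fun i => (starRingEnd ℂ) (c i)) (star T) := fun x i => by
  rw [ContinuousLinearMap.star_eq_adjoint, ContinuousLinearMap.adjoint_inner_right, hT.apply_basis,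
    inner_smul_left]

lemma IsDiagOp.abs {c : ι → ℂ} {T : H →L[ℂ] H} (hT : IsDiagOp b c T) :
    IsDiagOp b (fun i => ((‖c i‖ : ℝ) : ℂ)) (CFC.abs T) := by
  have hb : ∀ i, ‖((‖c i‖ : ℝ) : ℂ)‖ ≤ ‖T‖ := by
    intro i
    have h1 := T.le_opNorm (b i)
    rw [hT.apply_basis, norm_smul, b.orthonormal.1, mul_one, mul_one] at h1
    simpa using h1
  obtain ⟨S, hS⟩ := exists_isDiagOp b hb
  have h1 : S * S = Star.star T * T := by
    refine (hS.mul hS).unique ?_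
    convert hT.star.mul hT using 2 with i
    rw [Complex.conj_mul']
    ring
  have h2 : CFC.abs T = S := CFC.sqrt_unique h1 (hS.nonneg fun i => norm_nonneg _)
  rw [h2]
  exact hS

end Abs

/-! ### The trace of a diagonal operator -/

section Trace

variable {ι κ : Type*} (e : HilbertBasis ι ℂ H) {f : HilbertBasis κ ℂ H} {T : H →L[ℂ] H}

/-- The trace of `A T B`, with `T` diagonal with summable entries, can be computed in every
Hilbert basis. -/
lemma hasSum_trace {c : κ → ℂ} (hT : IsDiagOp f c T) (hc : Summable fun j => ‖c j‖)
    (A B : H →L[ℂ] H) :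
    HasSum (fun i => inner ℂ (e i) (A (T (B (e i)))))
      (∑' j, c j * inner ℂ (f j) (B (A (f j)))) := by
  set Aa := ContinuousLinearMap.adjoint A with hAa
  set Ba := ContinuousLinearMap.adjoint B with hBa
  -- Parseval and 2uv ≤ u² + v² make the double series absolutely summable; summing over `ι` first
  -- gives the right side, summing over `κ` first gives the diagonal entries.
  set F : κ × ι → ℂ := fun p => c p.1 * (inner ℂ (Ba (f p.1)) (e p.2) *
    inner ℂ (e p.2) (A (f p.1))) with hF
  have hn : ∀ j, ‖f j‖ = 1 := f.orthonormal.1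
  have hrow : ∀ j, HasSum (fun i => F (j, i)) (c j * inner ℂ (f j) (B (A (f j)))) := by
    intro j
    have h := (e.hasSum_inner_mul_inner (Ba (f j)) (A (f j))).mul_left (c j)
    rwa [hBa, ContinuousLinearMap.adjoint_inner_left] at h
  have hFs : Summable F := by
    apply Summable.of_norm
    have hb1 : ∀ j, ‖Ba (f j)‖ ^ 2 ≤ ‖Ba‖ ^ 2 := fun j => by
      have := Ba.le_opNorm (f j)
      rw [hn, mul_one] at this
      gcongr
    have hb2 : ∀ j, ‖A (f j)‖ ^ 2 ≤ ‖A‖ ^ 2 := fun j => by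
      have := A.le_opNorm (f j)
      rw [hn, mul_one] at this
      gcongr
    have hle : ∀ j i, ‖F (j, i)‖ ≤ ‖c j‖ * (‖inner ℂ (e i) (Ba (f j))‖ ^ 2 +
        ‖inner ℂ (e i) (A (f j))‖ ^ 2) := by
      intro j i
      simp only [hF, norm_mul]
      gcongr
      rw [norm_inner_symm]
      nlinarith [sq_nonneg (‖inner ℂ (e i) (Ba (f j))‖ - ‖inner ℂ (e i) (A (f j))‖),
        sq_nonneg (‖inner ℂ (e i) (Ba (f j))‖), sq_nonneg (‖inner ℂ (e i) (A (f j))‖)]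
    have hS : ∀ j, HasSum (fun i => ‖c j‖ * (‖inner ℂ (e i) (Ba (f j))‖ ^ 2 +
        ‖inner ℂ (e i) (A (f j))‖ ^ 2)) (‖c j‖ * (‖Ba (f j)‖ ^ 2 + ‖A (f j)‖ ^ 2)) := fun j =>
      ((hasSum_norm_inner_sq e _).add (hasSum_norm_inner_sq e _)).mul_left _
    rw [summable_prod_of_nonneg (fun _ => norm_nonneg _)]
    have hs1 : ∀ j, Summable fun i => ‖F (j, i)‖ := fun j =>
      Summable.of_nonneg_of_le (fun _ => norm_nonneg _) (hle j) (hS j).summable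
    refine ⟨hs1, Summable.of_nonneg_of_le (fun j => tsum_nonneg fun _ => norm_nonneg _)
      (fun j => ?_) (hc.mul_right (‖Ba‖ ^ 2 + ‖A‖ ^ 2))⟩
    refine (hasSum_le (hle j) (hs1 j).hasSum (hS j)).trans ?_
    exact mul_le_mul_of_nonneg_left (add_le_add (hb1 j) (hb2 j)) (norm_nonneg _)
  have htot := hFs.hasSum
  have h1 := htot.prod_fiberwise hrow
  rw [h1.tsum_eq]
  have h2 : HasSum (F ∘ (Equiv.prodComm ι κ)) (∑' p, F p) := (Equiv.hasSum_iff _).2 htot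
  refine h2.prod_fiberwise fun i => ?_
  have h3 := hT.hasSum_inner (Aa (e i)) (B (e i))
  rw [hAa, ContinuousLinearMap.adjoint_inner_left] at h3
  convert h3 using 2 with j
  simp only [hF, Function.comp_apply, Equiv.prodComm_apply, Prod.swap, hBa,
    ContinuousLinearMap.adjoint_inner_left]
  ring

lemma trace_mul_eq {c : κ → ℂ} (hT : IsDiagOp f c T) (hc : Summable fun j => ‖c j‖)
    (A : H →L[ℂ] H) : trace (A * T) = ∑' j, c j * inner ℂ (f j) (A (f j)) := by
  have h := hasSum_trace (exists_hilbertBasis ℂ H).choose_spec.choose hT hc A 1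
  exact h.tsum_eq

omit [CompleteSpace H] in
lemma summable_coeff_mul_inner {c : κ → ℂ} (hc : Summable fun j => ‖c j‖) (A : H →L[ℂ] H) :
    Summable fun j => c j * inner ℂ (f j) (A (f j)) := by
  refine Summable.of_norm_bounded (hc.mul_right ‖A‖) fun j => ?_
  rw [norm_mul]
  gcongr
  refine (norm_inner_le_norm _ _).trans ?_
  have := A.le_opNorm (f j)
  rw [f.orthonormal.1, mul_one] at this
  rwa [f.orthonormal.1, one_mul]

lemma IsDiagOp.isTraceClass {c : κ → ℂ} (hT : IsDiagOp f c T) (hc : Summable fun j => ‖c j‖) :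
    IsTraceClass T := by
  obtain ⟨w, b, -⟩ := exists_hilbertBasis ℂ H
  refine ⟨w, b, ?_⟩
  have h := hasSum_trace b hT.abs (by simpa using hc) 1 1
  exact (Complex.hasSum_re h).summable

/-- The basis in which |T| has a finite trace is unrelated to `f`; Tonelli for ‖c_j‖ |⟨f_j, b_i⟩|²
and Parseval transfer the sum to `f`. -/
lemma IsDiagOp.summable_of_isTraceClass {c : κ → ℂ} (hT : IsDiagOp f c T) (h : IsTraceClass T) :
    Summable fun j => ‖c j‖ := by
  obtain ⟨w, b, hb⟩ := h
  have h1 : ∀ i, HasSum (fun j => ‖c j‖ * ‖inner ℂ (f j) (b i)‖ ^ 2)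
      (inner ℂ (b i) (CFC.abs T (b i))).re := fun i => hT.abs.hasSum_re_inner_self (b i)
  have h2 : Summable fun p : w × κ => ‖c p.2‖ * ‖inner ℂ (f p.2) (b p.1)‖ ^ 2 := by
    rw [summable_prod_of_nonneg (fun _ => by positivity)]
    exact ⟨fun i => (h1 i).summable, by simpa only [(h1 _).tsum_eq] using hb⟩
  have h3 := (Equiv.prodComm κ w).summable_iff.2 h2
  rw [summable_prod_of_nonneg (fun _ => by simp only [Function.comp_apply]; positivity)] at h3
  refine h3.2.congr fun j => ?_
  have h4 := (hasSum_norm_inner_sq b (f j)).mul_left ‖c j‖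
  rw [f.orthonormal.1, one_pow, mul_one] at h4
  rw [← h4.tsum_eq]
  refine tsum_congr fun i => ?_
  simp only [Function.comp_apply, Equiv.prodComm_apply, Prod.swap]
  rw [norm_inner_symm]

end Trace

/-! ### The functional calculus of a diagonalized operator -/

section FuncCalc

variable {ι : Type*} {b : HilbertBasis ι ℂ H} {D : H →ₗ.[ℂ] H} {l : ι → ℝ}

omit [CompleteSpace H] in
lemma mem_eigenspace_iff (D : H →ₗ.[ℂ] H) (r : ℝ) (x : H) :
    x ∈ eigenspace D r ↔ (x, (r : ℂ) • x) ∈ D.graph := by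
  rw [eigenspace, Submodule.mem_map, LinearPMap.mem_graph_iff]
  constructor
  · rintro ⟨a, ha, rfl⟩
    refine ⟨a, rfl, ?_⟩
    rw [LinearMap.mem_ker, LinearMap.sub_apply, sub_eq_zero] at ha
    exact ha
  · rintro ⟨a, rfl, ha⟩
    refine ⟨a, ?_, rfl⟩
    rw [LinearMap.mem_ker, LinearMap.sub_apply, sub_eq_zero]
    exact ha

omit [CompleteSpace H] in
lemma IsDiag.mem_eigenspace (hD : IsDiag D b l) (r : ℝ) (x : H) :
    x ∈ eigenspace D r ↔ ∀ i, l i ≠ r → inner ℂ (b i) x = 0 := by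
  rw [mem_eigenspace_iff, hD.2]
  refine forall_congr' fun i => ?_
  rw [inner_smul_right]
  constructor
  · intro h hne
    have h2 : ((l i : ℂ) - r) * inner ℂ (b i) x = 0 := by rw [sub_mul, h, sub_self]
    refine (mul_eq_zero.1 h2).resolve_left fun h3 => hne ?_
    exact_mod_cast sub_eq_zero.1 h3
  · intro h
    by_cases hne : l i = r
    · rw [hne]
    · rw [h hne, mul_zero, mul_zero]

lemma IsDiag.isDiagOp_spectralProj (hD : IsDiag D b l) (r : ℝ) :
    IsDiagOp b (fun i => if l i = r then 1 else 0) (spectralProj D r) := by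
  obtain ⟨P, hP⟩ := exists_isDiagOp b (c := fun i => if l i = r then (1 : ℂ) else 0) (C := 1)
    (fun i => by split_ifs <;> simp)
  have hmem : ∀ x, P x ∈ eigenspace D r := fun x => by
    rw [hD.mem_eigenspace]
    intro i hi
    rw [hP]
    simp [hi]
  have horth : ∀ x, x - P x ∈ (eigenspace D r)ᗮ := fun x => by
    rw [Submodule.mem_orthogonal]
    intro y hy
    rw [hD.mem_eigenspace] at hy
    have h := b.hasSum_inner_mul_inner y (x - P x)
    refine h.unique ?_
    convert hasSum_zero using 2 with i
    rw [inner_sub_right, hP]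
    by_cases hi : l i = r
    · simp [hi]
    · rw [← inner_conj_symm, hy i hi]
      simp
  have heq : spectralProj D r = P := by
    ext x
    refine Submodule.eq_starProjection_of_mem_orthogonal
      (Submodule.le_topologicalClosure _ (hmem x)) ?_
    rw [Submodule.orthogonal_closure]
    exact horth x
  rw [heq]
  exact hP

lemma IsDiag.isDiagOp_funcCalc (hD : IsDiag D b l) {g : ℝ → ℂ}
    (hg : Tendsto (fun i => g (l i)) cofinite (𝓝 0)) :
    IsDiagOp b (fun i => g (l i)) (funcCalc D g) := by
  classical
  have hfin : ∀ ε > 0, {i | ε ≤ ‖g (l i)‖}.Finite := by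
    intro ε hε
    have h1 := hg.eventually (Metric.ball_mem_nhds 0 hε)
    rw [eventually_cofinite] at h1
    refine h1.subset fun i hi => ?_
    simpa using hi
  have hbd : ∃ C, ∀ i, ‖g (l i)‖ ≤ C := by
    obtain ⟨C, hC⟩ := ((hfin 1 one_pos).image fun i => ‖g (l i)‖).bddAbove
    refine ⟨max C 1, fun i => ?_⟩
    rcases le_or_gt 1 ‖g (l i)‖ with h | h
    · exact (hC ⟨i, h, rfl⟩).trans (le_max_left _ _)
    · exact h.le.trans (le_max_right _ _)
  obtain ⟨C, hC⟩ := hbd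
  obtain ⟨T, hT⟩ := exists_isDiagOp b hC
  -- A partial sum differs from `T` by a diagonal operator whose entries are the g(l i) with l i not
  -- yet included, and its norm is bounded by their supremum.
  have hsum : HasSum (fun r => g r • spectralProj D r) T := by
    rw [HasSum, SummationFilter.unconditional_filter, Metric.tendsto_atTop]
    intro ε hε
    refine ⟨((hfin (ε / 2) (half_pos hε)).image l).toFinset, fun s hs => ?_⟩
    rw [dist_eq_norm]
    have h1 := (IsDiagOp.sum (s := s) fun r _ => (hD.isDiagOp_spectralProj r).smul (g r)).sub hT
    refine (h1.norm_le (C := ε / 2) (fun i => ?_) (half_pos hε).le).trans_lt (half_lt_self hε)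
    simp only [mul_ite, mul_one, mul_zero, Finset.sum_ite_eq]
    split_ifs with h
    · simpa using (half_pos hε).le
    · rw [zero_sub, norm_neg]
      by_contra! hlt
      exact h (hs (by simpa using ⟨i, hlt.le, rfl⟩))
  rw [funcCalc, hsum.tsum_eq]
  exact hT

end FuncCalc

lemma hasSum_of_forall_eq {ι E : Type*} [AddCommMonoid E] [TopologicalSpace E] {f g : ι → E} {a : E}
    (h : HasSum f a) (e : ∀ i, g i = f i) : HasSum g a :=
  (funext e : g = f) ▸ h

/-! ### Summability of the eigenvalues -/

section Summability

variable {ι : Type*} {b : HilbertBasis ι ℂ H} {D : H →ₗ.[ℂ] H} {l : ι → ℝ}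

omit [CompleteSpace H] in
lemma IsDiag.tendsto_sq (hD : IsDiag D b l) : Tendsto (fun i => l i ^ 2) cofinite atTop := by
  have h := (tendsto_pow_atTop (α := ℝ) two_ne_zero).comp hD.1
  refine h.congr fun i => ?_
  simp

omit [CompleteSpace H] in
lemma IsDiag.eventually_one_le (hD : IsDiag D b l) : ∀ᶠ i in cofinite, 1 ≤ |l i| :=
  hD.1.eventually (eventually_ge_atTop 1)

/-- The eigenvalues of `|D|^{-z}`. -/
def absPowFun (z : ℂ) (r : ℝ) : ℂ := if r = 0 then 0 else ((|r| : ℝ) : ℂ) ^ (-z)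

lemma norm_absPowFun (z : ℂ) (r : ℝ) :
    ‖absPowFun z r‖ = if r = 0 then 0 else |r| ^ (-z.re) := by
  rw [absPowFun]
  split_ifs with h
  · simp
  · rw [Complex.norm_cpow_eq_rpow_re_of_pos (abs_pos.2 h), Complex.neg_re]

lemma IsDiag.isDiagOp_absPow (hD : IsDiag D b l) {z : ℂ} (hz : 0 < z.re) :
    IsDiagOp b (fun i => absPowFun z (l i)) (absPow D z) := by
  refine hD.isDiagOp_funcCalc ?_
  rw [tendsto_zero_iff_norm_tendsto_zero]
  refine ((tendsto_rpow_neg_atTop hz).comp hD.1).congr' ?_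
  filter_upwards [hD.eventually_one_le] with i hi
  have h0 : l i ≠ 0 := fun h => by rw [h] at hi; norm_num at hi
  have := norm_absPowFun z (l i)
  rw [if_neg h0] at this
  exact this.symm

-- The weight (1 + l²)^{-Re z/2} is insensitive to zero eigenvalues and is a convex decreasing
-- function of l², as the comparison under conjugation requires.
omit [CompleteSpace H] in
lemma IsDiag.summable_absPowFun_iff (hD : IsDiag D b l) {z : ℂ} (hz : 0 < z.re) :
    (Summable fun i => ‖absPowFun z (l i)‖) ↔ Summable fun i => (1 + l i ^ 2) ^ (-(z.re / 2)) := by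
  have hn : ∀ i, 1 ≤ |l i| → ‖absPowFun z (l i)‖ = (l i ^ 2) ^ (-(z.re / 2)) := by
    intro i hi
    have h0 : l i ≠ 0 := fun h => by rw [h] at hi; norm_num at hi
    rw [norm_absPowFun, if_neg h0, ← sq_abs, ← Real.rpow_natCast, ← Real.rpow_mul (abs_nonneg _)]
    congr 1
    push_cast
    ring
  have h1 : ∀ᶠ i in cofinite, (1 + l i ^ 2) ^ (-(z.re / 2)) ≤ ‖absPowFun z (l i)‖ := by
    filter_upwards [hD.eventually_one_le] with i hi
    rw [hn i hi]
    have : 0 < l i ^ 2 := by rw [← sq_abs]; positivity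
    exact Real.rpow_le_rpow_of_nonpos this (by linarith) (by linarith)
  have h2 : ∀ᶠ i in cofinite,
      ‖absPowFun z (l i)‖ ≤ (1 / 2 : ℝ) ^ (-(z.re / 2)) * (1 + l i ^ 2) ^ (-(z.re / 2)) := by
    filter_upwards [hD.eventually_one_le] with i hi
    rw [hn i hi, ← Real.mul_rpow (by norm_num) (by positivity)]
    have : 1 ≤ l i ^ 2 := by rw [← sq_abs]; nlinarith
    exact Real.rpow_le_rpow_of_nonpos (by linarith) (by linarith) (by linarith)
  constructor
  · intro h
    refine summable_of_isBigO h (IsBigO.of_bound 1 ?_)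
    filter_upwards [h1] with i hi
    rw [Real.norm_of_nonneg (by positivity), norm_norm, one_mul]
    exact hi
  · intro h
    refine summable_of_isBigO h (IsBigO.of_bound ((1 / 2 : ℝ) ^ (-(z.re / 2))) ?_)
    filter_upwards [h2] with i hi
    rw [norm_norm, Real.norm_of_nonneg (by positivity : 0 ≤ (1 + l i ^ 2) ^ (-(z.re / 2)))]
    exact hi

lemma IsDiag.isTraceClass_absPow_iff (hD : IsDiag D b l) {z : ℂ} (hz : 0 < z.re) :
    IsTraceClass (absPow D z) ↔ Summable fun i => (1 + l i ^ 2) ^ (-(z.re / 2)) := by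
  rw [← hD.summable_absPowFun_iff hz]
  exact ⟨(hD.isDiagOp_absPow hz).summable_of_isTraceClass, (hD.isDiagOp_absPow hz).isTraceClass⟩

lemma IsDiag.trace_absPow (hD : IsDiag D b l) {z : ℂ} (hz : 0 < z.re)
    (hs : Summable fun i => (1 + l i ^ 2) ^ (-(z.re / 2))) :
    trace (absPow D z) = ∑' i, absPowFun z (l i) := by
  rw [← hD.summable_absPowFun_iff hz] at hs
  have h := trace_mul_eq (hD.isDiagOp_absPow hz) hs 1
  rw [one_mul] at h
  rw [h]
  refine tsum_congr fun i => ?_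
  rw [one_apply_eq_self, inner_self_eq_norm_sq_to_K, b.orthonormal.1]
  simp

omit [CompleteSpace H] in
lemma IsDiag.summable_exp (hD : IsDiag D b l) {q : ℝ}
    (hs : Summable fun i => (1 + l i ^ 2) ^ (-q)) {t : ℝ} (ht : 0 < t) :
    Summable fun i => Real.exp (-(t * l i ^ 2)) := by
  have h1 := (isLittleO_exp_neg_mul_rpow_atTop ht (-q)).isBigO
  have h2 : Tendsto (fun i => 1 + l i ^ 2) cofinite atTop :=
    tendsto_atTop_add_const_left _ _ hD.tendsto_sq
  have h3 := summable_of_isBigO hs (h1.comp_tendsto h2)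
  refine (h3.mul_left (Real.exp t)).congr fun i => ?_
  rw [Function.comp_apply, ← Real.exp_add]
  ring_nf

end Summability

/-! ### Elementary bounds absorbing powers into exponentials -/

lemma sq_mul_exp_le {t : ℝ} (ht : 0 < t) (x : ℝ) :
    x * Real.exp (-(t * x)) ≤ 2 / t * Real.exp (-(t / 2 * x)) := by
  have h1 : t / 2 * x ≤ Real.exp (t / 2 * x) := by
    linarith [Real.add_one_le_exp (t / 2 * x)]
  have h2 : Real.exp (-(t / 2 * x)) = Real.exp (t / 2 * x) * Real.exp (-(t * x)) := by
    rw [← Real.exp_add]; ring_nf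
  rw [h2, ← mul_assoc]
  gcongr
  calc x = 2 / t * (t / 2 * x) := by field_simp
    _ ≤ _ := by gcongr

lemma pow_four_mul_exp_le {t : ℝ} (ht : 0 < t) {x : ℝ} (hx : 0 ≤ x) :
    x ^ 2 * Real.exp (-(t * x)) ≤ 8 / t ^ 2 * Real.exp (-(t / 2 * x)) := by
  have h1 : (t / 2 * x) ^ 2 / 2 ≤ Real.exp (t / 2 * x) := by
    have := Real.pow_div_factorial_le_exp (t / 2 * x) (by positivity) 2
    simpa using this
  have h2 : Real.exp (-(t / 2 * x)) = Real.exp (t / 2 * x) * Real.exp (-(t * x)) := by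
    rw [← Real.exp_add]; ring_nf
  rw [h2, ← mul_assoc]
  gcongr
  calc x ^ 2 = 8 / t ^ 2 * ((t / 2 * x) ^ 2 / 2) := by field_simp; ring
    _ ≤ _ := by gcongr

/-! ### Heat traces in terms of the eigenvalues -/

/-- The operator `D² e^{-t D²}`, for `t > 0`. -/
def heatSq (D : H →ₗ.[ℂ] H) (t : ℝ) : H →L[ℂ] H :=
  funcCalc D fun r => ((r ^ 2 * Real.exp (-(t * r ^ 2)) : ℝ) : ℂ)

/-- The real part of `Tr (B e^{-t D²})`. -/
def heatRe (D : H →ₗ.[ℂ] H) (B : H →L[ℂ] H) (t : ℝ) : ℝ := (trace (B * heat D t)).re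

/-- The real part of `Tr (B D² e^{-t D²})`. -/
def heatSqRe (D : H →ₗ.[ℂ] H) (B : H →L[ℂ] H) (t : ℝ) : ℝ := (trace (B * heatSq D t)).re

/-- The operator `D` is diagonalized by `b`, and its heat operators are of trace class. -/
structure IsHeatDiag {ι : Type*} (D : H →ₗ.[ℂ] H) (b : HilbertBasis ι ℂ H) (l : ι → ℝ) : Prop where
  diag : IsDiag D b l
  summable : ∀ t > 0, Summable fun i => Real.exp (-(t * l i ^ 2))

section Heat

variable {ι : Type*} {b : HilbertBasis ι ℂ H} {D : H →ₗ.[ℂ] H} {l : ι → ℝ}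

omit [CompleteSpace H] in
lemma IsHeatDiag.summable_sq (hD : IsHeatDiag D b l) {t : ℝ} (ht : 0 < t) :
    Summable fun i => l i ^ 2 * Real.exp (-(t * l i ^ 2)) :=
  Summable.of_nonneg_of_le (fun i => by positivity) (fun i => sq_mul_exp_le ht _)
    ((hD.summable (t / 2) (by positivity)).mul_left _)

lemma IsHeatDiag.isDiagOp_heat (hD : IsHeatDiag D b l) {t : ℝ} (ht : 0 < t) :
    IsDiagOp b (fun i => ((Real.exp (-(t * l i ^ 2)) : ℝ) : ℂ)) (heat D t) := by
  refine hD.diag.isDiagOp_funcCalc (g := fun r => ((Real.exp (-(t * r ^ 2)) : ℝ) : ℂ)) ?_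
  have h := (hD.summable t ht).tendsto_cofinite_zero
  exact_mod_cast (Complex.continuous_ofReal.tendsto 0).comp h

lemma IsHeatDiag.isDiagOp_heatSq (hD : IsHeatDiag D b l) {t : ℝ} (ht : 0 < t) :
    IsDiagOp b (fun i => ((l i ^ 2 * Real.exp (-(t * l i ^ 2)) : ℝ) : ℂ)) (heatSq D t) := by
  refine hD.diag.isDiagOp_funcCalc
    (g := fun r => ((r ^ 2 * Real.exp (-(t * r ^ 2)) : ℝ) : ℂ)) ?_
  have h := (hD.summable_sq ht).tendsto_cofinite_zero
  exact_mod_cast (Complex.continuous_ofReal.tendsto 0).comp h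

lemma hasSum_re_trace_mul {c : ι → ℝ} {T : H →L[ℂ] H} (hT : IsDiagOp b (fun i => (c i : ℂ)) T)
    (hc : Summable c) (hc0 : ∀ i, 0 ≤ c i) (B : H →L[ℂ] H) :
    HasSum (fun i => c i * (inner ℂ (b i) (B (b i))).re) (trace (B * T)).re := by
  have hc' : Summable fun i => ‖(c i : ℂ)‖ := by
    refine hc.congr fun i => ?_
    rw [Complex.norm_real, Real.norm_of_nonneg (hc0 i)]
  have h := (summable_coeff_mul_inner (f := b) hc' B).hasSum
  rw [← trace_mul_eq hT hc'] at h
  have h2 := Complex.hasSum_re h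
  simpa only [Complex.re_ofReal_mul] using h2

lemma IsHeatDiag.hasSum_heatRe (hD : IsHeatDiag D b l) (B : H →L[ℂ] H) {t : ℝ} (ht : 0 < t) :
    HasSum (fun i => Real.exp (-(t * l i ^ 2)) * (inner ℂ (b i) (B (b i))).re) (heatRe D B t) :=
  hasSum_re_trace_mul (hD.isDiagOp_heat ht) (hD.summable t ht) (fun _ => by positivity) B

lemma IsHeatDiag.hasSum_heatSqRe (hD : IsHeatDiag D b l) (B : H →L[ℂ] H) {t : ℝ} (ht : 0 < t) :
    HasSum (fun i => l i ^ 2 * Real.exp (-(t * l i ^ 2)) * (inner ℂ (b i) (B (b i))).re)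
      (heatSqRe D B t) :=
  hasSum_re_trace_mul (hD.isDiagOp_heatSq ht) (hD.summable_sq ht) (fun _ => by positivity) B

omit [CompleteSpace H] in
lemma inner_basis_self (b : HilbertBasis ι ℂ H) (i : ι) :
    (inner ℂ (b i) ((1 : H →L[ℂ] H) (b i))).re = 1 := by
  rw [one_apply_eq_self, inner_self_eq_norm_sq_to_K, b.orthonormal.1]
  simp

omit [CompleteSpace H] in
lemma abs_re_inner_basis_le (b : HilbertBasis ι ℂ H) (B : H →L[ℂ] H) (i : ι) :
    |(inner ℂ (b i) (B (b i))).re| ≤ ‖B‖ := by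
  refine (Complex.abs_re_le_norm _).trans ((norm_inner_le_norm _ _).trans ?_)
  have := B.le_opNorm (b i)
  rw [b.orthonormal.1, mul_one] at this
  rwa [b.orthonormal.1, one_mul]

lemma IsHeatDiag.hasSum_heatRe_one (hD : IsHeatDiag D b l) {t : ℝ} (ht : 0 < t) :
    HasSum (fun i => Real.exp (-(t * l i ^ 2))) (heatRe D 1 t) := by
  simpa only [inner_basis_self, mul_one] using hD.hasSum_heatRe 1 ht

lemma IsHeatDiag.hasSum_heatSqRe_one (hD : IsHeatDiag D b l) {t : ℝ} (ht : 0 < t) :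
    HasSum (fun i => l i ^ 2 * Real.exp (-(t * l i ^ 2))) (heatSqRe D 1 t) := by
  simpa only [inner_basis_self, mul_one] using hD.hasSum_heatSqRe 1 ht

lemma IsHeatDiag.heatRe_sub (hD : IsHeatDiag D b l) (B C : H →L[ℂ] H) {t : ℝ} (ht : 0 < t) :
    heatRe D (B - C) t = heatRe D B t - heatRe D C t := by
  refine (hD.hasSum_heatRe (B - C) ht).unique (hasSum_of_forall_eq ((hD.hasSum_heatRe B ht).sub (hD.hasSum_heatRe C ht)) fun i => ?_)
  rw [sub_apply, inner_sub_right, Complex.sub_re]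
  ring

lemma IsHeatDiag.heatRe_smul (hD : IsHeatDiag D b l) (r : ℝ) (B : H →L[ℂ] H) {t : ℝ}
    (ht : 0 < t) : heatRe D ((r : ℂ) • B) t = r * heatRe D B t := by
  refine (hD.hasSum_heatRe _ ht).unique (hasSum_of_forall_eq ((hD.hasSum_heatRe B ht).mul_left r) fun i => ?_)
  rw [smul_apply, inner_smul_right, Complex.re_ofReal_mul]
  ring

lemma IsHeatDiag.heatSqRe_sub (hD : IsHeatDiag D b l) (B C : H →L[ℂ] H) {t : ℝ} (ht : 0 < t) :
    heatSqRe D (B - C) t = heatSqRe D B t - heatSqRe D C t := by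
  refine (hD.hasSum_heatSqRe (B - C) ht).unique (hasSum_of_forall_eq ((hD.hasSum_heatSqRe B ht).sub (hD.hasSum_heatSqRe C ht)) fun i => ?_)
  rw [sub_apply, inner_sub_right, Complex.sub_re]
  ring

lemma IsHeatDiag.heatSqRe_smul (hD : IsHeatDiag D b l) (r : ℝ) (B : H →L[ℂ] H) {t : ℝ}
    (ht : 0 < t) : heatSqRe D ((r : ℂ) • B) t = r * heatSqRe D B t := by
  refine (hD.hasSum_heatSqRe _ ht).unique (hasSum_of_forall_eq ((hD.hasSum_heatSqRe B ht).mul_left r) fun i => ?_)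
  rw [smul_apply, inner_smul_right, Complex.re_ofReal_mul]
  ring

lemma IsHeatDiag.abs_heatRe_le (hD : IsHeatDiag D b l) (B : H →L[ℂ] H) {t : ℝ} (ht : 0 < t) :
    |heatRe D B t| ≤ ‖B‖ * heatRe D 1 t := by
  have h := (hD.hasSum_heatRe_one ht).mul_left ‖B‖
  rw [← h.tsum_eq, ← (hD.hasSum_heatRe B ht).tsum_eq, ← Real.norm_eq_abs]
  refine tsum_of_norm_bounded h.summable.hasSum fun i => ?_
  rw [norm_mul, Real.norm_of_nonneg (Real.exp_pos _).le, mul_comm]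
  gcongr
  exact abs_re_inner_basis_le b B i

lemma IsHeatDiag.abs_heatSqRe_le (hD : IsHeatDiag D b l) (B : H →L[ℂ] H) {t : ℝ} (ht : 0 < t) :
    |heatSqRe D B t| ≤ ‖B‖ * heatSqRe D 1 t := by
  have h := (hD.hasSum_heatSqRe_one ht).mul_left ‖B‖
  rw [← h.tsum_eq, ← (hD.hasSum_heatSqRe B ht).tsum_eq, ← Real.norm_eq_abs]
  refine tsum_of_norm_bounded h.summable.hasSum fun i => ?_
  rw [norm_mul, Real.norm_of_nonneg (by positivity), mul_comm]
  gcongr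
  exact abs_re_inner_basis_le b B i

lemma IsHeatDiag.heatRe_one_nonneg (hD : IsHeatDiag D b l) {t : ℝ} (ht : 0 < t) :
    0 ≤ heatRe D 1 t :=
  (hD.hasSum_heatRe_one ht).nonneg fun _ => (Real.exp_pos _).le

lemma IsHeatDiag.heatSqRe_one_nonneg (hD : IsHeatDiag D b l) {t : ℝ} (ht : 0 < t) :
    0 ≤ heatSqRe D 1 t :=
  (hD.hasSum_heatSqRe_one ht).nonneg fun _ => by positivity

lemma IsHeatDiag.heatSqRe_one_le (hD : IsHeatDiag D b l) {t : ℝ} (ht : 0 < t) :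
    heatSqRe D 1 t ≤ 2 / t * heatRe D 1 (t / 2) :=
  hasSum_le (fun i => sq_mul_exp_le ht (l i ^ 2)) (hD.hasSum_heatSqRe_one ht)
    ((hD.hasSum_heatRe_one (half_pos ht)).mul_left _)

lemma IsHeatDiag.heatRe_one_anti (hD : IsHeatDiag D b l) {t t' : ℝ} (ht : 0 < t) (h : t ≤ t') :
    heatRe D 1 t' ≤ heatRe D 1 t :=
  hasSum_le (fun i => by gcongr) (hD.hasSum_heatRe_one (ht.trans_le h)) (hD.hasSum_heatRe_one ht)

/-- `d/dt Tr (B e^{-t D²}) = - Tr (B D² e^{-t D²})`. -/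
lemma IsHeatDiag.hasDerivAt_heatRe (hD : IsHeatDiag D b l) (B : H →L[ℂ] H) {t : ℝ} (ht : 0 < t) :
    HasDerivAt (heatRe D B) (-heatSqRe D B t) t := by
  have h2 : 0 < t / 2 := half_pos ht
  have hd : ∀ i, ∀ y ∈ Set.Ioi (t / 2), HasDerivAt
      (fun y => Real.exp (-(y * l i ^ 2)) * (inner ℂ (b i) (B (b i))).re)
      (-(l i ^ 2 * Real.exp (-(y * l i ^ 2)) * (inner ℂ (b i) (B (b i))).re)) y := by
    intro i y _
    have h := (((hasDerivAt_id y).mul_const (l i ^ 2)).neg.exp).mul_const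
      (inner ℂ (b i) (B (b i))).re
    refine HasDerivAt.congr_deriv (f := fun y => Real.exp (-(y * l i ^ 2)) *
      (inner ℂ (b i) (B (b i))).re) h ?_
    simp only [Pi.neg_apply, id]
    ring
  have h := hasDerivAt_tsum_of_isPreconnected (((hD.summable_sq h2).mul_right ‖B‖)) isOpen_Ioi
    isPreconnected_Ioi hd (fun i y hy => by
      rw [norm_neg, norm_mul, Real.norm_of_nonneg (by positivity)]
      have hy' : t / 2 < y := hy
      gcongr
      exact abs_re_inner_basis_le b B i) (y₀ := t) (half_lt_self ht)
    (hD.hasSum_heatRe B ht).summable (half_lt_self ht : t / 2 < t)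
  rw [tsum_neg, (hD.hasSum_heatSqRe B ht).tsum_eq] at h
  refine h.congr_of_eventuallyEq ?_
  filter_upwards [lt_mem_nhds ht] with y hy
  exact (hD.hasSum_heatRe B hy).tsum_eq.symm

/-- The difference quotient of `Tr (B e^{-t D²})` approximates the derivative uniformly. -/
lemma IsHeatDiag.abs_heatSqRe_sub_le (hD : IsHeatDiag D b l) (B : H →L[ℂ] H) {t η : ℝ}
    (ht : 0 < t) (hη : 0 < η) :
    |heatSqRe D B t - (heatRe D B t - heatRe D B (t + η)) / η| ≤
      η * (‖B‖ * (4 / t ^ 2) * heatRe D 1 (t / 2)) := by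
  have h1 := (hD.hasSum_heatSqRe B ht).sub
    (((hD.hasSum_heatRe B ht).sub (hD.hasSum_heatRe B (add_pos ht hη))).div_const η)
  have h2 := ((hD.hasSum_heatRe_one (half_pos ht)).mul_left (‖B‖ * (4 / t ^ 2))).mul_left η
  rw [← h2.tsum_eq, ← h1.tsum_eq, ← Real.norm_eq_abs]
  refine tsum_of_norm_bounded h2.summable.hasSum fun i => ?_
  set x := l i ^ 2 with hx
  have hx0 : 0 ≤ x := sq_nonneg _
  set w := (inner ℂ (b i) (B (b i))).re with hw
  have hwB : |w| ≤ ‖B‖ := abs_re_inner_basis_le b B i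
  have he : Real.exp (-((t + η) * x)) = Real.exp (-(t * x)) * Real.exp (-(η * x)) := by
    rw [← Real.exp_add]; ring_nf
  have e1 : x * Real.exp (-(t * x)) * w -
      (Real.exp (-(t * x)) * w - Real.exp (-((t + η) * x)) * w) / η =
      w * (Real.exp (-(t * x)) * ((η * x - 1 + Real.exp (-(η * x))) / η)) := by
    rw [he]; field_simp; ring
  have e2 : 0 ≤ η * x - 1 + Real.exp (-(η * x)) := by
    linarith [Real.add_one_le_exp (-(η * x))]
  have e3 : η * x - 1 + Real.exp (-(η * x)) ≤ (η * x) ^ 2 / 2 := by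
    have := Real.quadratic_le_exp_of_nonneg (mul_nonneg hη.le hx0)
    have h4 : Real.exp (-(η * x)) * Real.exp (η * x) = 1 := by rw [← Real.exp_add]; simp
    -- With u = ηx this gives e^{-u} ≤ 1/(1 + u + u²/2) ≤ 1 − u + u²/2.
    have h5 : (1 - η * x + (η * x) ^ 2 / 2) * (1 + η * x + (η * x) ^ 2 / 2) ≥ 1 := by
      have : (1 - η * x + (η * x) ^ 2 / 2) * (1 + η * x + (η * x) ^ 2 / 2) =
        1 + (η * x) ^ 4 / 4 := by ring
      nlinarith [sq_nonneg ((η * x) ^ 2)]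
    nlinarith [Real.exp_pos (-(η * x)), Real.exp_pos (η * x), sq_nonneg (1 - η * x)]
  rw [e1, norm_mul, Real.norm_eq_abs, Real.norm_of_nonneg (by positivity)]
  calc |w| * (Real.exp (-(t * x)) * ((η * x - 1 + Real.exp (-(η * x))) / η))
      ≤ ‖B‖ * (Real.exp (-(t * x)) * ((η * x) ^ 2 / 2 / η)) := by gcongr
    _ = η * (‖B‖ * (x ^ 2 * Real.exp (-(t * x)) / 2)) := by field_simp
    _ ≤ η * (‖B‖ * (8 / t ^ 2 * Real.exp (-(t / 2 * x)) / 2)) := by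
        have := pow_four_mul_exp_le ht hx0
        gcongr
    _ = _ := by ring

end Heat

/-! ### Comparison of `P` and `Q = V P V` -/

/-- The operator `Q` is `V P V`, with `V` self-adjoint and invertible with inverse `V'`. -/
structure IsConj (P Q : H →ₗ.[ℂ] H) (V V' : H →L[ℂ] H) : Prop where
  mul_inv : V * V' = 1
  inv_mul : V' * V = 1
  symm_left : ∀ x y, inner ℂ (V x) y = inner ℂ x (V y)
  symm_right : ∀ x y, inner ℂ (V' x) y = inner ℂ x (V' y)
  graph_iff : ∀ x y, (x, y) ∈ P.graph ↔ (V' x, V y) ∈ Q.graph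

section Conj

variable {P Q : H →ₗ.[ℂ] H} {V V' : H →L[ℂ] H}

omit [CompleteSpace H] in
lemma IsConj.apply_inv (hC : IsConj P Q V V') (x : H) : V (V' x) = x := by
  simpa using congrArg (fun T : H →L[ℂ] H => T x) hC.mul_inv

omit [CompleteSpace H] in
lemma IsConj.inv_apply (hC : IsConj P Q V V') (x : H) : V' (V x) = x := by
  simpa using congrArg (fun T : H →L[ℂ] H => T x) hC.inv_mul

omit [CompleteSpace H] in
lemma IsConj.symm (hC : IsConj P Q V V') : IsConj Q P V' V where
  mul_inv := hC.inv_mul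
  inv_mul := hC.mul_inv
  symm_left := hC.symm_right
  symm_right := hC.symm_left
  graph_iff x y := by rw [hC.graph_iff, hC.inv_apply, hC.apply_inv]

variable {ι κ : Type*} {e : HilbertBasis ι ℂ H} {f : HilbertBasis κ ℂ H} {l : ι → ℝ} {m : κ → ℝ}

-- This is Q V' e_i = V P e_i = l_i V e_i in the coordinate f_j. Squared and summed over j it
-- evaluates the quadratic form of Q² at V' e_i as l_i² ‖V e_i‖², which is all that the convexity
-- argument needs about Q.
omit [CompleteSpace H] in
lemma IsConj.eigenvalue_mul (hC : IsConj P Q V V') (hP : IsDiag P e l) (hQ : IsDiag Q f m)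
    (i : ι) (j : κ) :
    (l i : ℂ) * inner ℂ (f j) (V (e i)) = m j * inner ℂ (f j) (V' (e i)) := by
  classical
  have h1 : (e i, (l i : ℂ) • e i) ∈ P.graph := by
    rw [hP.2]
    intro k
    rw [inner_smul_right, inner_basis]
    split_ifs with hk
    · rw [hk]
    · simp
  have h2 := (hQ.2 _ _).1 ((hC.graph_iff _ _).1 h1) j
  rwa [map_smul, inner_smul_right] at h2

omit [CompleteSpace H] in
/-- The variational lower bound for `V' φ(Q²) V'` in the eigenbasis of `P`. -/
lemma IsConj.le_inner (hC : IsConj P Q V V') (hP : IsDiag P e l) (hQ : IsDiag Q f m)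
    {φ : κ → ℝ} {T : H →L[ℂ] H} (hT : IsDiagOp f (fun j => (φ j : ℂ)) T) {α β : ℝ}
    (h : ∀ j, α - β * m j ^ 2 ≤ φ j) (i : ι) :
    α * ‖V' (e i)‖ ^ 2 - β * (l i ^ 2 * ‖V (e i)‖ ^ 2) ≤
      (inner ℂ (V' (e i)) (T (V' (e i)))).re := by
  have h1 := hT.hasSum_re_inner_self (V' (e i))
  have h2 := ((hasSum_norm_inner_sq f (V' (e i))).mul_left α).sub
    (((hasSum_norm_inner_sq f (V (e i))).mul_left (l i ^ 2)).mul_left β)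
  refine hasSum_le (fun j => ?_) h2 h1
  have h3 : l i ^ 2 * ‖inner ℂ (f j) (V (e i))‖ ^ 2 = m j ^ 2 * ‖inner ℂ (f j) (V' (e i))‖ ^ 2 := by
    have := congrArg norm (hC.eigenvalue_mul hP hQ i j)
    rw [norm_mul, norm_mul, Complex.norm_real, Complex.norm_real] at this
    have := congrArg (· ^ 2) this
    simpa only [mul_pow, Real.norm_eq_abs, sq_abs] using this
  rw [h3]
  nlinarith [h j, sq_nonneg ‖inner ℂ (f j) (V' (e i))‖]

omit [CompleteSpace H] in
lemma norm_apply_le_of_norm_eq_one {T : H →L[ℂ] H} (x : H) {L : ℝ} (hT : ‖T‖ ≤ L) (hx : ‖x‖ = 1) :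
    ‖T x‖ ≤ L := by
  have := T.le_opNorm x
  rw [hx, mul_one] at this
  exact this.trans hT

/-- Comparison of `Tr φ(L⁴ P²)` and `Tr φ(Q²)` for convex decreasing functions `φ`. -/
lemma IsConj.summable_compare (hC : IsConj P Q V V') (hP : IsDiag P e l) (hQ : IsDiag Q f m)
    {L : ℝ} (hV : ‖V‖ ≤ L) (hV' : ‖V'‖ ≤ L) {φ : ℝ → ℝ} (h0 : ∀ y, 0 ≤ y → 0 ≤ φ y)
    (htan : ∀ x, 0 ≤ x → ∃ β, 0 ≤ β ∧ ∀ y, 0 ≤ y → φ x - β * (y - x) ≤ φ y)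
    (hs : Summable fun j => φ (m j ^ 2)) :
    (Summable fun i => φ (L ^ 4 * l i ^ 2)) ∧
      ∑' i, φ (L ^ 4 * l i ^ 2) ≤ L ^ 4 * ∑' j, φ (m j ^ 2) := by
  have hL0 : 0 ≤ L := (norm_nonneg _).trans hV
  have hφ0 : ∀ j, 0 ≤ φ (m j ^ 2) := fun j => h0 _ (sq_nonneg _)
  have hbd : ∀ j, ‖((φ (m j ^ 2) : ℝ) : ℂ)‖ ≤ ∑' j, φ (m j ^ 2) := fun j => by
    rw [Complex.norm_real, Real.norm_of_nonneg (hφ0 j)]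
    exact hs.le_tsum j fun k _ => hφ0 k
  obtain ⟨T, hT⟩ := exists_isDiagOp f hbd
  have hc : Summable fun j => ‖((φ (m j ^ 2) : ℝ) : ℂ)‖ := hs.congr fun j => by
    rw [Complex.norm_real, Real.norm_of_nonneg (hφ0 j)]
  have h1 := (Complex.hasSum_re (hasSum_trace e hT hc V' V')).mul_left (L ^ 2)
  have hn : ∀ i, ‖e i‖ = 1 := e.orthonormal.1
  have hle : ∀ i, φ (L ^ 4 * l i ^ 2) ≤ L ^ 2 * (inner ℂ (e i) (V' (T (V' (e i))))).re := by
    intro i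
    -- The tangent is taken at L⁴ l_i², not at l_i²: ‖V e_i‖ ≤ L and ‖V' e_i‖ ≥ 1/L give ‖V e_i‖² ≤
    -- L⁴ ‖V' e_i‖², so the linear term has the favourable sign. The factor L² compensates ‖V' e_i‖²
    -- ≥ L⁻²; a second one comes later from ‖V'²‖.
    have hx0 : 0 ≤ L ^ 4 * l i ^ 2 := by positivity
    obtain ⟨β, hβ, hβy⟩ := htan _ hx0
    have h2 := hC.le_inner hP hQ hT (α := φ (L ^ 4 * l i ^ 2) + β * (L ^ 4 * l i ^ 2)) (β := β)
      (fun j => by linarith [hβy (m j ^ 2) (sq_nonneg _)]) i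
    rw [hC.symm_right] at h2
    have h3 : ‖V (e i)‖ ≤ L := norm_apply_le_of_norm_eq_one _ hV (hn i)
    have h4 : 1 ≤ L * ‖V' (e i)‖ := by
      rw [← hn i]
      nth_rewrite 1 [← hC.apply_inv (e i)]
      exact (V.le_opNorm _).trans (by gcongr)
    have h5 : ‖V (e i)‖ ^ 2 ≤ L ^ 4 * ‖V' (e i)‖ ^ 2 := by
      calc ‖V (e i)‖ ^ 2 ≤ (L * (L * ‖V' (e i)‖)) ^ 2 := by
            gcongr
            exact h3.trans (le_mul_of_one_le_right hL0 h4)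
        _ = _ := by ring
    have h6 : 0 ≤ β * l i ^ 2 * (L ^ 4 * ‖V' (e i)‖ ^ 2 - ‖V (e i)‖ ^ 2) :=
      mul_nonneg (by positivity) (sub_nonneg.2 h5)
    have h7 : φ (L ^ 4 * l i ^ 2) ≤ L ^ 2 * (φ (L ^ 4 * l i ^ 2) * ‖V' (e i)‖ ^ 2) := by
      have : 1 ≤ (L * ‖V' (e i)‖) ^ 2 := one_le_pow₀ h4
      calc φ (L ^ 4 * l i ^ 2) ≤ φ (L ^ 4 * l i ^ 2) * (L * ‖V' (e i)‖) ^ 2 :=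
            le_mul_of_one_le_right (h0 _ hx0) this
        _ = _ := by ring
    refine h7.trans ?_
    gcongr
    linarith
  have hsum : Summable fun i => φ (L ^ 4 * l i ^ 2) :=
    Summable.of_nonneg_of_le (fun i => h0 _ (by positivity)) hle h1.summable
  refine ⟨hsum, (hasSum_le hle hsum.hasSum h1).trans ?_⟩
  have h8 : (∑' j, ((φ (m j ^ 2) : ℝ) : ℂ) * inner ℂ (f j) (V' (V' (f j)))).re ≤
      L ^ 2 * ∑' j, φ (m j ^ 2) := by
    have h9 := Complex.hasSum_re (summable_coeff_mul_inner (f := f) hc (V' * V')).hasSum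
    refine hasSum_le (fun j => ?_) h9 (hs.hasSum.mul_left (L ^ 2))
    rw [Complex.re_ofReal_mul, mul_comm]
    gcongr
    · exact hφ0 j
    · refine (le_abs_self _).trans ((abs_re_inner_basis_le f _ j).trans ?_)
      refine (norm_mul_le _ _).trans ?_
      rw [sq]
      gcongr
  calc L ^ 2 * _ ≤ L ^ 2 * (L ^ 2 * ∑' j, φ (m j ^ 2)) := by gcongr
    _ = _ := by ring

omit [CompleteSpace H] in
lemma re_inner_mul_self (hV : ∀ x y, inner ℂ (V x) y = inner ℂ x (V y)) (x : H) :
    (inner ℂ x ((V * V) x)).re = ‖V x‖ ^ 2 := by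
  rw [mul_apply_eq_comp, ← hV, inner_self_eq_norm_sq_to_K]
  norm_cast

/-- The tangent line at x of the convex function y ↦ e^{-ty}, from e^u ≥ 1 + u with u = t (x − y).
-/
lemma exp_tangent (t x y : ℝ) :
    Real.exp (-(t * x)) * (1 + t * x) - t * Real.exp (-(t * x)) * y ≤ Real.exp (-(t * y)) := by
  have h1 : Real.exp (-(t * y)) = Real.exp (-(t * x)) * Real.exp (t * x - t * y) := by
    rw [← Real.exp_add]; ring_nf
  rw [h1]
  nlinarith [Real.exp_pos (-(t * x)), Real.add_one_le_exp (t * x - t * y)]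

lemma IsConj.le_inner_heat (hC : IsConj P Q V V') (hP : IsHeatDiag P e l) (hQ : IsHeatDiag Q f m)
    {t : ℝ} (ht : 0 < t) (i : ι) :
    Real.exp (-(t * l i ^ 2)) * (‖V' (e i)‖ ^ 2 - t * l i ^ 2 *
      (‖V (e i)‖ ^ 2 - ‖V' (e i)‖ ^ 2)) ≤ (inner ℂ (V' (e i)) (heat Q t (V' (e i)))).re := by
  refine le_trans (le_of_eq ?_) (hC.le_inner hP.diag hQ.diag (hQ.isDiagOp_heat ht)
    (fun j => exp_tangent t (l i ^ 2) (m j ^ 2)) i)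
  ring

omit [CompleteSpace H] in
lemma IsHeatDiag.summable_norm (hQ : IsHeatDiag Q f m) {t : ℝ} (ht : 0 < t) :
    Summable fun j => ‖((Real.exp (-(t * m j ^ 2)) : ℝ) : ℂ)‖ :=
  (hQ.summable t ht).congr fun j => by
    rw [Complex.norm_real, Real.norm_of_nonneg (Real.exp_pos _).le]

/-- The convexity inequality for heat traces. -/
lemma IsConj.heatRe_le (hC : IsConj P Q V V') (hP : IsHeatDiag P e l) (hQ : IsHeatDiag Q f m)
    {t : ℝ} (ht : 0 < t) :
    heatRe P (V' * V') t - t * heatSqRe P (V * V - V' * V') t ≤ heatRe Q (V' * V') t := by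
  have h1 := Complex.hasSum_re (hasSum_trace e (hQ.isDiagOp_heat ht) (hQ.summable_norm ht) V' V')
  have h2 : (∑' j, ((Real.exp (-(t * m j ^ 2)) : ℝ) : ℂ) * inner ℂ (f j) (V' (V' (f j)))).re =
      heatRe Q (V' * V') t := by
    rw [heatRe, trace_mul_eq (hQ.isDiagOp_heat ht) (hQ.summable_norm ht)]
    rfl
  rw [h2] at h1
  refine hasSum_le (fun i => ?_) ((hP.hasSum_heatRe _ ht).sub
    ((hP.hasSum_heatSqRe _ ht).mul_left t)) h1
  have h3 := hC.le_inner_heat hP hQ ht i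
  rw [hC.symm_right] at h3
  refine le_trans (le_of_eq ?_) h3
  rw [sub_apply, inner_sub_right, Complex.sub_re, re_inner_mul_self hC.symm_left,
    re_inner_mul_self hC.symm_right]
  ring

end Conj

/-! ### Continuity of heat traces under conjugation -/

section Continuity

variable {P Q : H →ₗ.[ℂ] H} {V V' : H →L[ℂ] H}
variable {ι κ : Type*} {e : HilbertBasis ι ℂ H} {f : HilbertBasis κ ℂ H} {l : ι → ℝ} {m : κ → ℝ}

lemma norm_mul_self_sub_one_le {V : H →L[ℂ] H} {δ : ℝ} (hδ1 : δ ≤ 1) (h : ‖V - 1‖ ≤ δ) :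
    ‖V * V - 1‖ ≤ 3 * δ := by
  have h1 : V * V - 1 = (V - 1) * (V - 1) + 2 • (V - 1) := by noncomm_ring
  have h0 : 0 ≤ ‖V - 1‖ := norm_nonneg _
  rw [h1]
  refine (norm_add_le _ _).trans ?_
  have h2 : ‖(V - 1) * (V - 1)‖ ≤ ‖V - 1‖ * ‖V - 1‖ := norm_mul_le _ _
  have h3 : ‖2 • (V - 1)‖ ≤ 2 * ‖V - 1‖ := by
    rw [two_nsmul, two_mul]; exact norm_add_le _ _
  nlinarith

lemma abs_norm_sq_sub_one_le (hV : ∀ x y, inner ℂ (V x) y = inner ℂ x (V y)) {δ : ℝ}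
    (hδ1 : δ ≤ 1) (h : ‖V - 1‖ ≤ δ) (i : ι) : |‖V (e i)‖ ^ 2 - 1| ≤ 3 * δ := by
  have h1 := abs_re_inner_basis_le e (V * V - 1) i
  rw [sub_apply, inner_sub_right, Complex.sub_re, re_inner_mul_self hV, inner_basis_self] at h1
  exact h1.trans (norm_mul_self_sub_one_le hδ1 h)

/-- The convexity inequality with P and Q exchanged; replacing V² and V'² by 1 costs 3δ in norm
each. The terms in Q on the right are harmless, as they are bounded uniformly along the family. -/
lemma IsConj.heatRe_one_le (hC : IsConj P Q V V') (hP : IsHeatDiag P e l) (hQ : IsHeatDiag Q f m)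
    {t δ : ℝ} (ht : 0 < t) (hδ1 : δ ≤ 1) (hV : ‖V - 1‖ ≤ δ) (hV' : ‖V' - 1‖ ≤ δ) :
    heatRe Q 1 t ≤ heatRe P 1 t +
      δ * (3 * heatRe P 1 t + 3 * heatRe Q 1 t + 6 * t * heatSqRe Q 1 t) := by
  have h := hC.symm.heatRe_le hQ hP ht
  have e1 : heatRe P (V * V) t = heatRe P (V * V - 1) t + heatRe P 1 t := by
    rw [hP.heatRe_sub _ _ ht]; ring
  have e2 : heatRe Q (V * V) t = heatRe Q (V * V - 1) t + heatRe Q 1 t := by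
    rw [hQ.heatRe_sub _ _ ht]; ring
  have e3 : heatSqRe Q (V' * V' - V * V) t =
      heatSqRe Q (V' * V' - 1) t - heatSqRe Q (V * V - 1) t := by
    rw [← hQ.heatSqRe_sub _ _ ht]; congr 1; abel
  rw [e1, e2, e3] at h
  have n1 := norm_mul_self_sub_one_le hδ1 hV
  have n2 := norm_mul_self_sub_one_le hδ1 hV'
  have b1 := (abs_le.1 (hP.abs_heatRe_le (V * V - 1) ht)).2
  have b2 := (abs_le.1 (hQ.abs_heatRe_le (V * V - 1) ht)).1
  have b3 := (abs_le.1 (hQ.abs_heatSqRe_le (V' * V' - 1) ht)).2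
  have b4 := (abs_le.1 (hQ.abs_heatSqRe_le (V * V - 1) ht)).1
  have p1 := hP.heatRe_one_nonneg ht
  have p2 := hQ.heatRe_one_nonneg ht
  have p3 := hQ.heatSqRe_one_nonneg ht
  have c1 := mul_le_mul_of_nonneg_right n1 p1
  have c2 := mul_le_mul_of_nonneg_right n1 p2
  have c3 := mul_le_mul_of_nonneg_right n2 p3
  have c4 := mul_le_mul_of_nonneg_right n1 p3
  have c5 : t * (heatSqRe Q (V' * V' - 1) t - heatSqRe Q (V * V - 1) t) ≤
      t * (6 * δ * heatSqRe Q 1 t) := by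
    gcongr
    linarith
  linarith

lemma IsHeatDiag.norm_heat_le (hD : IsHeatDiag P e l) {t : ℝ} (ht : 0 < t) : ‖heat P t‖ ≤ 1 := by
  refine (hD.isDiagOp_heat ht).norm_le (fun i => ?_) zero_le_one
  rw [Complex.norm_real, Real.norm_of_nonneg (Real.exp_pos _).le, Real.exp_le_one_iff]
  have : 0 ≤ t * l i ^ 2 := by positivity
  linarith

/-- The convexity bound concerns V' e_i; passing to e_i costs 3δ because ‖e^{-tQ²}‖ ≤ 1. This last
error carries no decay in i, so the bound is summed only after multiplication by a heat weight. -/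
lemma IsConj.le_inner_heat_basis (hC : IsConj P Q V V') (hP : IsHeatDiag P e l)
    (hQ : IsHeatDiag Q f m) {t δ : ℝ} (ht : 0 < t) (hδ0 : 0 ≤ δ) (hδ1 : δ ≤ 1)
    (hV : ‖V - 1‖ ≤ δ) (hV' : ‖V' - 1‖ ≤ δ) (i : ι) :
    Real.exp (-(t * l i ^ 2)) * (1 - 3 * δ - 6 * δ * (t * l i ^ 2)) - 3 * δ ≤
      (inner ℂ (e i) (heat Q t (e i))).re := by
  have h1 := hC.le_inner_heat hP hQ ht i
  have n1 := abs_le.1 (abs_norm_sq_sub_one_le (e := e) hC.symm_left hδ1 hV i)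
  have n2 := abs_le.1 (abs_norm_sq_sub_one_le (e := e) hC.symm_right hδ1 hV' i)
  have h2 : Real.exp (-(t * l i ^ 2)) * (1 - 3 * δ - 6 * δ * (t * l i ^ 2)) ≤
      (inner ℂ (V' (e i)) (heat Q t (V' (e i)))).re := by
    refine le_trans ?_ h1
    have hx : 0 ≤ t * l i ^ 2 := by positivity
    have : t * l i ^ 2 * (‖V (e i)‖ ^ 2 - ‖V' (e i)‖ ^ 2) ≤ t * l i ^ 2 * (6 * δ) := by
      gcongr
      linarith
    refine mul_le_mul_of_nonneg_left ?_ (Real.exp_pos _).le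
    linarith
  set K := heat Q t with hK
  have hK1 : ‖K‖ ≤ 1 := hQ.norm_heat_le ht
  have hei : ‖e i‖ = 1 := e.orthonormal.1 i
  have h3 : (inner ℂ (V' (e i)) (K (V' (e i)))).re - (inner ℂ (e i) (K (e i))).re =
      (inner ℂ ((V' - 1) (e i)) (K (e i))).re + (inner ℂ (V' (e i)) (K ((V' - 1) (e i)))).re := by
    simp only [sub_apply, one_apply_eq_self, map_sub, inner_sub_left, inner_sub_right,
      Complex.sub_re]
    ring
  have hd : ‖(V' - 1) (e i)‖ ≤ δ := norm_apply_le_of_norm_eq_one _ hV' hei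
  have hv : ‖V' (e i)‖ ≤ 1 + δ := by
    have : V' (e i) = e i + (V' - 1) (e i) := by simp
    rw [this]
    exact (norm_add_le _ _).trans (by rw [hei]; gcongr)
  have hk : ∀ x, ‖K x‖ ≤ ‖x‖ := fun x => by
    simpa using (K.le_opNorm x).trans (mul_le_mul_of_nonneg_right hK1 (norm_nonneg x))
  have h4 : (inner ℂ ((V' - 1) (e i)) (K (e i))).re ≤ δ := by
    refine (Complex.re_le_norm _).trans ((norm_inner_le_norm _ _).trans ?_)
    calc _ ≤ δ * 1 := mul_le_mul hd ((hk _).trans hei.le) (norm_nonneg _) hδ0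
      _ = δ := mul_one δ
  have h5 : (inner ℂ (V' (e i)) (K ((V' - 1) (e i)))).re ≤ 2 * δ := by
    refine (Complex.re_le_norm _).trans ((norm_inner_le_norm _ _).trans ?_)
    calc _ ≤ (1 + δ) * δ := mul_le_mul hv ((hk _).trans hd) (norm_nonneg _) (by linarith)
      _ ≤ 2 * δ := by nlinarith
  linarith

lemma IsHeatDiag.heat_half_mul (hD : IsHeatDiag Q f m) {t : ℝ} (ht : 0 < t) (j : κ) :
    heat Q (t / 2) (f j) = ((Real.exp (-(t / 2 * m j ^ 2)) : ℝ) : ℂ) • f j :=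
  (hD.isDiagOp_heat (half_pos ht)).apply_basis j

lemma exp_half_sq (t x : ℝ) : Real.exp (-(t / 2 * x)) ^ 2 = Real.exp (-(t * x)) := by
  rw [sq, ← Real.exp_add]; ring_nf

/-- The heat trace as a Hilbert-Schmidt pairing, in an arbitrary basis. -/
lemma IsHeatDiag.hasSum_inner_heat_half (hQ : IsHeatDiag Q f m) (e : HilbertBasis ι ℂ H)
    (B : H →L[ℂ] H) {t : ℝ} (ht : 0 < t) :
    HasSum (fun i => (inner ℂ (heat Q (t / 2) (e i)) (B (heat Q (t / 2) (e i)))).re)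
      (heatRe Q B t) := by
  have h2 := half_pos ht
  have hT := hQ.isDiagOp_heat h2
  have h := Complex.hasSum_re (hasSum_trace e hT (hQ.summable_norm h2)
    (heat Q (t / 2) * B) 1)
  have h3 : (∑' j, ((Real.exp (-(t / 2 * m j ^ 2)) : ℝ) : ℂ) *
      inner ℂ (f j) ((1 : H →L[ℂ] H) ((heat Q (t / 2) * B) (f j)))).re = heatRe Q B t := by
    rw [heatRe, trace_mul_eq (hQ.isDiagOp_heat ht) (hQ.summable_norm ht)]
    congr 1
    refine tsum_congr fun j => ?_
    rw [one_apply_eq_self, mul_apply_eq_comp, ← hT.inner_symm, hQ.heat_half_mul ht,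
      inner_smul_left, Complex.conj_ofReal, ← mul_assoc, ← Complex.ofReal_mul, ← sq, exp_half_sq]
  rw [h3] at h
  refine hasSum_of_forall_eq h fun i => ?_
  rw [one_apply_eq_self, mul_apply_eq_comp, ← hT.inner_symm]

/-- Quantitative continuity of heat traces under conjugation. -/
lemma IsConj.abs_heatRe_sub_le (hC : IsConj P Q V V') (hP : IsHeatDiag P e l)
    (hQ : IsHeatDiag Q f m) (B : H →L[ℂ] H) {t δ η M : ℝ} (ht : 0 < t) (hδ0 : 0 ≤ δ) (hδ1 : δ ≤ 1)
    (hV : ‖V - 1‖ ≤ δ) (hV' : ‖V' - 1‖ ≤ δ) (hη : 0 < η)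
    (hM1 : heatRe P 1 (t / 2) ≤ M) (hM2 : heatRe Q 1 (t / 2) ≤ M)
    (hM3 : heatSqRe P 1 t ≤ M) (hM4 : heatSqRe Q 1 t ≤ M) :
    |heatRe Q B t - heatRe P B t| ≤
      ‖B‖ * (δ * ((18 + 12 * t) * M) * (1 + 1 / η) + η * M) := by
  have h2 := half_pos ht
  have hM5 : heatRe P 1 t ≤ M := (hP.heatRe_one_anti h2 (by linarith)).trans hM1
  have hM6 : heatRe Q 1 t ≤ M := (hQ.heatRe_one_anti h2 (by linarith)).trans hM2
  set K := heat Q (t / 2) with hK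
  set χ : ι → ℝ := fun i => Real.exp (-(t / 2 * l i ^ 2)) with hχ
  have hχ0 : ∀ i, 0 < χ i := fun i => Real.exp_pos _
  have hχ2 : ∀ i, χ i ^ 2 = Real.exp (-(t * l i ^ 2)) := fun i => exp_half_sq _ _
  have hn : ∀ i, ‖e i‖ = 1 := e.orthonormal.1
  -- The sum of ‖d_i‖² is the squared Hilbert-Schmidt norm of e^{-tQ²/2} − e^{-tP²/2}, that is, Tr
  -- e^{-tQ²} + Tr e^{-tP²} minus twice the cross term. It is O(δ) once the cross term is bounded
  -- below and Tr e^{-tQ²} above.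
  set d : ι → H := fun i => K (e i) - (χ i : ℂ) • e i with hd
  have sP := hP.hasSum_heatRe_one ht
  have sP2 := hP.hasSum_heatRe_one h2
  have sPQ := hP.hasSum_heatSqRe_one ht
  have sQ := hQ.hasSum_inner_heat_half e 1 ht
  -- the cross term
  have hcross : Summable fun i => χ i * (inner ℂ (e i) (K (e i))).re := by
    refine Summable.of_norm_bounded sP2.summable fun i => ?_
    rw [norm_mul, Real.norm_of_nonneg (hχ0 i).le]
    refine mul_le_of_le_one_right (hχ0 i).le ?_
    exact (abs_re_inner_basis_le e K i).trans (hQ.norm_heat_le h2)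
  have hcl : heatRe P 1 t - δ * (3 * heatRe P 1 t + 3 * t * heatSqRe P 1 t +
      3 * heatRe P 1 (t / 2)) ≤ ∑' i, χ i * (inner ℂ (e i) (K (e i))).re := by
    have hs := sP.sub ((((sP.mul_left 3).add (sPQ.mul_left (3 * t))).add
      (sP2.mul_left 3)).mul_left δ)
    refine hasSum_le (fun i => ?_) hs hcross.hasSum
    have h3 := mul_le_mul_of_nonneg_left
      (hC.le_inner_heat_basis hP hQ h2 hδ0 hδ1 hV hV' i) (hχ0 i).le
    refine le_trans (le_of_eq ?_) h3
    change _ = χ i * (χ i * _ - _)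
    rw [← hχ2]
    ring
  have hdn : ∀ i, ‖d i‖ ^ 2 = (inner ℂ (K (e i)) ((1 : H →L[ℂ] H) (K (e i)))).re +
      Real.exp (-(t * l i ^ 2)) - 2 * (χ i * (inner ℂ (e i) (K (e i))).re) := by
    intro i
    rw [hd, @norm_sub_sq ℂ, one_apply_eq_self, inner_self_eq_norm_sq_to_K, norm_smul, hn, mul_one,
      Complex.norm_real, Real.norm_of_nonneg (hχ0 i).le, hχ2, inner_smul_right,
      ← inner_conj_symm]
    simp only [RCLike.re_to_complex, Complex.re_ofReal_mul, Complex.conj_re]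
    have h3 : (((‖K (e i)‖ : ℂ)) ^ 2).re = ‖K (e i)‖ ^ 2 := by norm_cast
    refine Eq.trans ?_ (congrArg (fun r => r + Real.exp (-(t * l i ^ 2)) -
      2 * (χ i * (inner ℂ (e i) (K (e i))).re)) h3.symm)
    ring
  have hE := (sQ.add sP).sub (hcross.hasSum.mul_left 2)
  have hE' := hasSum_of_forall_eq hE hdn
  -- The upper bound of Tr e^{-tQ²} contributes (6 + 6t) M and twice the cross term 2 (6 + 3t) M.
  have hEle : heatRe Q 1 t + heatRe P 1 t -
      2 * ∑' i, χ i * (inner ℂ (e i) (K (e i))).re ≤ δ * ((18 + 12 * t) * M) := by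
    have h3 := hC.heatRe_one_le hP hQ ht hδ1 hV hV'
    have h4 : δ * (3 * heatRe P 1 t + 3 * heatRe Q 1 t + 6 * t * heatSqRe Q 1 t) ≤
        δ * (3 * M + 3 * M + 6 * t * M) := by gcongr
    have h5 : δ * (3 * heatRe P 1 t + 3 * t * heatSqRe P 1 t + 3 * heatRe P 1 (t / 2)) ≤
        δ * (3 * M + 3 * t * M + 3 * M) := by gcongr
    linarith
  -- Expand with K e_i = χ_i e_i + d_i and use 2 χ ‖d‖ ≤ η χ² + ‖d‖²/η; the free η trades the
  -- first-order terms for the small quantity ‖d‖².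
  have hterm : ∀ i, |(inner ℂ (K (e i)) (B (K (e i)))).re -
      Real.exp (-(t * l i ^ 2)) * (inner ℂ (e i) (B (e i))).re| ≤
      ‖B‖ * (‖d i‖ ^ 2 * (1 + 1 / η) + η * Real.exp (-(t * l i ^ 2))) := by
    intro i
    have hk : K (e i) = (χ i : ℂ) • e i + d i := by simp [hd]
    have h3 : (inner ℂ (K (e i)) (B (K (e i)))).re -
        Real.exp (-(t * l i ^ 2)) * (inner ℂ (e i) (B (e i))).re =
        χ i * (inner ℂ (e i) (B (d i))).re + χ i * (inner ℂ (d i) (B (e i))).re +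
          (inner ℂ (d i) (B (d i))).re := by
      rw [hk, ← hχ2]
      simp only [map_add, map_smul, inner_add_left, inner_add_right, inner_smul_left,
        inner_smul_right, Complex.conj_ofReal, Complex.add_re, Complex.re_ofReal_mul]
      ring
    have hin : ∀ x y, |(inner ℂ x (B y)).re| ≤ ‖B‖ * (‖x‖ * ‖y‖) := fun x y => by
      refine (Complex.abs_re_le_norm _).trans ((norm_inner_le_norm _ _).trans ?_)
      calc ‖x‖ * ‖B y‖ ≤ ‖x‖ * (‖B‖ * ‖y‖) := by gcongr; exact B.le_opNorm y
        _ = _ := by ring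
    rw [h3]
    have b1 := hin (e i) (d i)
    have b2 := hin (d i) (e i)
    have b3 := hin (d i) (d i)
    rw [hn, one_mul] at b1
    rw [hn, mul_one] at b2
    calc _ ≤ χ i * (‖B‖ * ‖d i‖) + χ i * (‖B‖ * ‖d i‖) + ‖B‖ * (‖d i‖ * ‖d i‖) := by
          refine (abs_add_le _ _).trans (add_le_add ((abs_add_le _ _).trans
            (add_le_add ?_ ?_)) b3)
          · rw [abs_mul, abs_of_pos (hχ0 i)]; gcongr
          · rw [abs_mul, abs_of_pos (hχ0 i)]; gcongr
      _ = ‖B‖ * (2 * χ i * ‖d i‖ + ‖d i‖ ^ 2) := by ring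
      _ ≤ _ := by
          rw [← hχ2]
          refine mul_le_mul_of_nonneg_left ?_ (norm_nonneg _)
          have h6 : 0 ≤ (η * χ i - ‖d i‖) ^ 2 / η := by positivity
          have h7 : (η * χ i - ‖d i‖) ^ 2 / η =
              η * χ i ^ 2 - 2 * χ i * ‖d i‖ + ‖d i‖ ^ 2 * (1 / η) := by
            field_simp; ring
          linarith
  have hs := ((hE'.mul_right (1 + 1 / η)).add (sP.mul_left η)).mul_left ‖B‖
  have hdiff := (hQ.hasSum_inner_heat_half e B ht).sub (hP.hasSum_heatRe B ht)
  rw [← hdiff.tsum_eq, ← Real.norm_eq_abs]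
  refine (tsum_of_norm_bounded hs hterm).trans ?_
  gcongr

end Continuity

/-! ### Summability under conjugation -/

section

variable {P Q : H →ₗ.[ℂ] H} {V V' : H →L[ℂ] H}
variable {ι κ : Type*} {e : HilbertBasis ι ℂ H} {f : HilbertBasis κ ℂ H} {l : ι → ℝ} {m : κ → ℝ}

/-- Scaling by 1 + x reduces to r^{-a} ≥ 1 − a (r − 1), which follows from log r ≤ r − 1 and e^u ≥ 1
+ u. -/
lemma rpow_neg_tangent {a x y : ℝ} (ha : 0 ≤ a) (hx : 0 ≤ x) (hy : 0 ≤ y) :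
    (1 + x) ^ (-a) - a * (1 + x) ^ (-a) / (1 + x) * (y - x) ≤ (1 + y) ^ (-a) := by
  have hx1 : 0 < 1 + x := by linarith
  have hy1 : 0 < 1 + y := by linarith
  set r := (1 + y) / (1 + x) with hr
  have hr0 : 0 < r := by positivity
  have h1 : (1 + y) ^ (-a) = (1 + x) ^ (-a) * r ^ (-a) := by
    rw [← Real.mul_rpow hx1.le hr0.le, hr, mul_div_cancel₀ _ hx1.ne']
  have h2 : 1 - a * (r - 1) ≤ r ^ (-a) := by
    rw [Real.rpow_def_of_pos hr0]
    have h3 := Real.add_one_le_exp (Real.log r * -a)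
    have h4 := mul_le_mul_of_nonneg_left (Real.log_le_sub_one_of_pos hr0) ha
    linarith
  have h5 : (1 + x) ^ (-a) - a * (1 + x) ^ (-a) / (1 + x) * (y - x) =
      (1 + x) ^ (-a) * (1 - a * (r - 1)) := by
    rw [hr]; field_simp; ring
  rw [h1, h5]
  gcongr

lemma IsConj.summable_rpow (hC : IsConj P Q V V') (hP : IsDiag P e l) (hQ : IsDiag Q f m) {a : ℝ}
    (ha : 0 ≤ a) (hs : Summable fun j => (1 + m j ^ 2) ^ (-a)) :
    Summable fun i => (1 + l i ^ 2) ^ (-a) := by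
  set L := max 1 (max ‖V‖ ‖V'‖) with hL
  have hL1 : 1 ≤ L := le_max_left _ _
  have h := (hC.summable_compare hP hQ (L := L) ((le_max_left _ _).trans (le_max_right _ _))
    ((le_max_right _ _).trans (le_max_right _ _)) (φ := fun y => (1 + y) ^ (-a))
    (fun y hy => by positivity) (fun x hx => ⟨a * (1 + x) ^ (-a) / (1 + x), by positivity,
      fun y hy => rpow_neg_tangent ha hx hy⟩) hs).1
  refine Summable.of_nonneg_of_le (fun i => by positivity) (fun i => ?_)
    (h.mul_left ((1 / L ^ 4) ^ (-a)))
  have hL4 : 1 ≤ L ^ 4 := one_le_pow₀ hL1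
  rw [← Real.mul_rpow (by positivity) (by positivity)]
  refine Real.rpow_le_rpow_of_nonpos (by positivity) ?_ (by linarith)
  have : 1 / L ^ 4 ≤ 1 := by rw [div_le_one (by positivity)]; exact hL4
  have h2 : 1 / L ^ 4 * (1 + L ^ 4 * l i ^ 2) = 1 / L ^ 4 + l i ^ 2 := by field_simp
  rw [h2]
  linarith

lemma IsConj.heatRe_one_mul_le (hC : IsConj P Q V V') (hP : IsHeatDiag P e l)
    (hQ : IsHeatDiag Q f m) {L t : ℝ} (hL : 0 < L) (hV : ‖V‖ ≤ L) (hV' : ‖V'‖ ≤ L) (ht : 0 < t) :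
    heatRe P 1 (L ^ 4 * t) ≤ L ^ 4 * heatRe Q 1 t := by
  have h := (hC.summable_compare hP.diag hQ.diag hV hV' (φ := fun y => Real.exp (-(t * y)))
    (fun y hy => by positivity) (fun x hx => ⟨t * Real.exp (-(t * x)), by positivity,
      fun y hy => by linarith [exp_tangent t x y]⟩) (hQ.summable t ht)).2
  rw [(hQ.hasSum_heatRe_one ht).tsum_eq] at h
  rw [← (hP.hasSum_heatRe_one (by positivity : 0 < L ^ 4 * t)).tsum_eq]
  refine le_trans (le_of_eq (tsum_congr fun i => ?_)) h
  ring_nf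

/-- First order lower bound for the variation of the heat trace. -/
lemma IsConj.heatRe_one_sub_ge (hC : IsConj P Q V V') (hP : IsHeatDiag P e l)
    (hQ : IsHeatDiag Q f m) {a R R' : H →L[ℂ] H} {ε t M : ℝ} (ht : 0 < t)
    (hR : V * V = 1 + (ε : ℂ) • a + R) (hR' : V' * V' = 1 - (ε : ℂ) • a + R')
    (hM1 : heatRe P 1 t ≤ M) (hM2 : heatRe Q 1 t ≤ M) (hM3 : heatSqRe P 1 t ≤ M) :
    ε * (heatRe Q a t - heatRe P a t) - 2 * t * ε * heatSqRe P a t -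
      (2 + t) * M * (‖R‖ + ‖R'‖) ≤ heatRe Q 1 t - heatRe P 1 t := by
  have h := hC.heatRe_le hP hQ ht
  have e1 : V' * V' = R' - ((ε : ℂ) • a - 1) := by rw [hR']; abel
  have e2 : V * V - V' * V' = R - (R' - ((2 * ε : ℝ) : ℂ) • a) := by
    rw [hR, hR', Complex.ofReal_mul, mul_smul, Complex.ofReal_ofNat, two_smul]
    abel
  rw [e2, e1, hP.heatRe_sub _ _ ht, hP.heatRe_sub _ _ ht, hP.heatRe_smul _ _ ht,
    hQ.heatRe_sub _ _ ht, hQ.heatRe_sub _ _ ht, hQ.heatRe_smul _ _ ht, hP.heatSqRe_sub _ _ ht,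
    hP.heatSqRe_sub _ _ ht, hP.heatSqRe_smul _ _ ht] at h
  have b1 := (abs_le.1 (hP.abs_heatRe_le R' ht)).1
  have b2 := (abs_le.1 (hQ.abs_heatRe_le R' ht)).2
  have b3 := (abs_le.1 (hP.abs_heatSqRe_le R ht)).2
  have b4 := (abs_le.1 (hP.abs_heatSqRe_le R' ht)).1
  have c1 := mul_le_mul_of_nonneg_left hM1 (norm_nonneg R')
  have c2 := mul_le_mul_of_nonneg_left hM2 (norm_nonneg R')
  have c3 := mul_le_mul_of_nonneg_left hM3 (norm_nonneg R)
  have c4 := mul_le_mul_of_nonneg_left hM3 (norm_nonneg R')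
  have hM0 : 0 ≤ M := (hP.heatRe_one_nonneg ht).trans hM1
  have c5 : t * (heatSqRe P R t - heatSqRe P R' t) ≤ t * (‖R‖ * M + ‖R'‖ * M) := by
    gcongr
    linarith
  have c6 : 0 ≤ ‖R‖ * M := by positivity
  linarith

end

/-! ### The family of conformal deformations -/

/-- The bounded operator `e^{r a / 2}`. -/
def confExp (a : H →L[ℂ] H) (r : ℝ) : H →L[ℂ] H := NormedSpace.exp ((r / 2 : ℂ) • a)

lemma confExp_add (a : H →L[ℂ] H) (r s : ℝ) : confExp a (r + s) = confExp a r * confExp a s := by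
  let _ : NormedAlgebra ℚ (H →L[ℂ] H) := NormedAlgebra.restrictScalars ℚ ℂ (H →L[ℂ] H)
  have h : ((r + s : ℝ) / 2 : ℂ) • a = (r / 2 : ℂ) • a + (s / 2 : ℂ) • a := by
    rw [← add_smul]; congr 1; push_cast; ring
  rw [confExp, h, NormedSpace.exp_add_of_commute]
  · rfl
  · exact ((Commute.refl a).smul_left _).smul_right _

lemma confExp_zero (a : H →L[ℂ] H) : confExp a 0 = 1 := by
  rw [confExp, Complex.ofReal_zero, zero_div, zero_smul, NormedSpace.exp_zero]

lemma confExp_mul_neg (a : H →L[ℂ] H) (r : ℝ) : confExp a r * confExp a (-r) = 1 := by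
  rw [← confExp_add, add_neg_cancel, confExp_zero]

lemma confExp_neg_mul (a : H →L[ℂ] H) (r : ℝ) : confExp a (-r) * confExp a r = 1 := by
  rw [← confExp_add, neg_add_cancel, confExp_zero]

lemma isSelfAdjoint_confExp {a : H →L[ℂ] H} (ha : IsSelfAdjoint a) (r : ℝ) :
    IsSelfAdjoint (confExp a r) := by
  refine IsSelfAdjoint.exp ?_
  rw [isSelfAdjoint_iff, star_smul, ha.star_eq]
  congr 1
  rw [RCLike.star_def, map_div₀, Complex.conj_ofReal, map_ofNat]

/-- The factor 2 makes the function r ↦ e^{ra}, the square V² of V = e^{ra/2}, which is what enters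
the convexity inequality. -/
lemma hasDerivAt_confExp (a : H →L[ℂ] H) :
    HasDerivAt (fun r : ℝ => confExp a (2 * r)) a 0 := by
  have h := hasDerivAt_exp_smul_const (𝕂 := ℝ) a 0
  rw [zero_smul, NormedSpace.exp_zero, one_mul] at h
  refine h.congr_of_eventuallyEq (Eventually.of_forall fun r => ?_)
  have h2 : ((2 * r : ℝ) / 2 : ℂ) = (r : ℂ) := by push_cast; ring
  change confExp a (2 * r) = _
  rw [confExp, h2, Complex.coe_smul]

lemma continuous_confExp (a : H →L[ℂ] H) : Continuous (confExp a) := by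
  let _ : NormedAlgebra ℚ (H →L[ℂ] H) := NormedAlgebra.restrictScalars ℚ ℂ (H →L[ℂ] H)
  refine NormedSpace.exp_continuous.comp ?_
  fun_prop

lemma inner_of_isSelfAdjoint {a : H →L[ℂ] H} (ha : IsSelfAdjoint a) (x y : H) :
    inner ℂ (a x) y = inner ℂ x (a y) :=
  ContinuousLinearMap.isSelfAdjoint_iff_isSymmetric.1 ha x y

/-- By the group law any two members of the family are conjugate in the sense of `IsConj`, so
estimates hold between arbitrary parameters and not only from s = 0. -/
lemma isConj_sandwich (D : H →ₗ.[ℂ] H) {a : H →L[ℂ] H} (ha : IsSelfAdjoint a) (s u : ℝ) :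
    IsConj (sandwich D (confExp a s)) (sandwich D (confExp a u)) (confExp a (u - s))
      (confExp a (s - u)) where
  mul_inv := by rw [← confExp_add, sub_add_sub_cancel, sub_self, confExp_zero]
  inv_mul := by rw [← confExp_add, sub_add_sub_cancel, sub_self, confExp_zero]
  symm_left := inner_of_isSelfAdjoint (isSelfAdjoint_confExp ha _)
  symm_right := inner_of_isSelfAdjoint (isSelfAdjoint_confExp ha _)
  graph_iff x y := by
    rw [mem_graph_sandwich (confExp_mul_neg a s) (confExp_neg_mul a s),
      mem_graph_sandwich (confExp_mul_neg a u) (confExp_neg_mul a u), ← mul_apply_eq_comp,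
      ← mul_apply_eq_comp, ← confExp_add, ← confExp_add, add_sub_cancel]
    congr! 4
    ring

omit [CompleteSpace H] in
lemma sandwich_one (D : H →ₗ.[ℂ] H) : sandwich D 1 = D := by
  apply LinearPMap.eq_of_eq_graph
  ext ⟨x, y⟩
  rw [mem_graph_sandwich (mul_one 1) (mul_one 1)]
  rfl

/-- The conjugated operators `e^{s a / 2} D e^{s a / 2}` are diagonalizable, with the same summability
of the eigenvalues. -/
lemma exists_isDiag_confExp {D : H →ₗ.[ℂ] H} (hD : IsSelfAdjoint D) (hc : HasCompactResolvent D)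
    {p : ℕ} (hp : ∀ q : ℝ, (p : ℝ) < q → IsTraceClass (absPow D (q : ℂ)))
    {a : H →L[ℂ] H} (ha : IsSelfAdjoint a) (s : ℝ) :
    ∃ (ι : Type u) (e : HilbertBasis ι ℂ H) (l : ι → ℝ),
      IsHeatDiag (sandwich D (confExp a s)) e l ∧
        ∀ q : ℝ, (p : ℝ) < q → Summable fun i => (1 + l i ^ 2) ^ (-(q / 2)) := by
  obtain ⟨κ, f, m, hQ⟩ := exists_isDiag_sandwich hD hc (confExp_mul_neg a 0) (confExp_neg_mul a 0)
    (isSelfAdjoint_confExp ha 0)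
  obtain ⟨ι, e, l, hP⟩ := exists_isDiag_sandwich hD hc (confExp_mul_neg a s) (confExp_neg_mul a s)
    (isSelfAdjoint_confExp ha s)
  have hs : ∀ q : ℝ, (p : ℝ) < q → Summable fun i => (1 + l i ^ 2) ^ (-(q / 2)) := by
    intro q hq
    have hq0 : 0 < q := (Nat.cast_nonneg p).trans_lt hq
    refine (isConj_sandwich D ha s 0).summable_rpow hP hQ (by positivity) ?_
    have h1 := hp q hq
    have h2 : sandwich D (confExp a 0) = D := by rw [confExp_zero, sandwich_one]
    rw [h2] at hQ
    simpa using (hQ.isTraceClass_absPow_iff (z := (q : ℂ)) (by simpa using hq0)).1 h1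
  exact ⟨ι, e, l, ⟨hP, fun t ht => hP.summable_exp (hs (p + 1) (by linarith)) ht⟩, hs⟩

section Family

variable {D : H →ₗ.[ℂ] H} {a : H →L[ℂ] H}

/-- All the deformations of `D` by `a` are diagonalizable with heat operators of trace class. -/
def HasHeatDiags (D : H →ₗ.[ℂ] H) (a : H →L[ℂ] H) : Prop :=
  ∀ s : ℝ, ∃ (ι : Type u) (e : HilbertBasis ι ℂ H) (l : ι → ℝ),
      IsHeatDiag (sandwich D (confExp a s)) e l

/-- With L bounding ‖e^{sa/2}‖ on [-1, 1], the heat trace at time t is at most L⁴ times that of the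
undeformed operator at time t/L⁴. -/
lemma HasHeatDiags.exists_bound (hF : HasHeatDiags D a) (ha : IsSelfAdjoint a) {t : ℝ}
    (ht : 0 < t) :
    ∃ M, ∀ s ∈ Set.Icc (-1 : ℝ) 1, heatRe (sandwich D (confExp a s)) 1 t ≤ M := by
  have hb := (isCompact_Icc (a := (-1 : ℝ)) (b := 1)).exists_bound_of_continuousOn
    (continuous_confExp a).continuousOn
  obtain ⟨L₀, hL₀⟩ := hb
  set L := max 1 L₀ with hL
  have hL0 : 0 < L := lt_max_of_lt_left one_pos
  have hL4 : 0 < L ^ 4 := by positivity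
  obtain ⟨κ, f, m, hQ⟩ := hF 0
  refine ⟨L ^ 4 * heatRe (sandwich D (confExp a 0)) 1 (t / L ^ 4), fun s hs => ?_⟩
  obtain ⟨ι, e, l, hP⟩ := hF s
  have hs' : -s ∈ Set.Icc (-1 : ℝ) 1 := by constructor <;> linarith [hs.1, hs.2]
  have h := (isConj_sandwich D ha s 0).heatRe_one_mul_le hP hQ (L := L) (t := t / L ^ 4) hL0
    (by rw [zero_sub]; exact (hL₀ _ hs').trans (le_max_right _ _))
    (by rw [sub_zero]; exact (hL₀ _ hs).trans (le_max_right _ _)) (by positivity)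
  rwa [mul_div_cancel₀ _ hL4.ne'] at h

lemma HasHeatDiags.exists_bound_both (hF : HasHeatDiags D a) (ha : IsSelfAdjoint a) {t : ℝ}
    (ht : 0 < t) :
    ∃ M, 0 ≤ M ∧ ∀ s ∈ Set.Icc (-1 : ℝ) 1, heatRe (sandwich D (confExp a s)) 1 t ≤ M ∧
      heatRe (sandwich D (confExp a s)) 1 (t / 2) ≤ M ∧
      heatSqRe (sandwich D (confExp a s)) 1 t ≤ M := by
  obtain ⟨M, hM⟩ := hF.exists_bound ha (half_pos ht)
  refine ⟨max (|M|) (2 / t * |M|), (abs_nonneg _).trans (le_max_left _ _), fun s hs => ?_⟩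
  obtain ⟨ι, e, l, hP⟩ := hF s
  have h1 := (hM s hs).trans (le_abs_self M)
  refine ⟨((hP.heatRe_one_anti (half_pos ht) (by linarith)).trans h1).trans (le_max_left _ _),
    h1.trans (le_max_left _ _), (hP.heatSqRe_one_le ht).trans (le_trans ?_ (le_max_right _ _))⟩
  gcongr

lemma HasHeatDiags.continuousOn_heatRe (hF : HasHeatDiags D a) (ha : IsSelfAdjoint a)
    (B : H →L[ℂ] H) {t : ℝ} (ht : 0 < t) :
    ContinuousOn (fun s => heatRe (sandwich D (confExp a s)) B t) (Set.Icc (-1) 1) := by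
  obtain ⟨M, hM0, hM⟩ := hF.exists_bound_both ha ht
  intro s hs
  obtain ⟨ι, e, l, hP⟩ := hF s
  rw [ContinuousWithinAt, Metric.tendsto_nhds]
  intro ε hε
  -- First η makes the term η M ‖B‖ smaller than ε; then u → s makes the remaining terms,
  -- proportional to δ, disappear.
  set η := ε / (2 * (‖B‖ * M + 1)) with hη
  have hBM : 0 ≤ ‖B‖ * M := by positivity
  have hη0 : 0 < η := by positivity
  set δ : ℝ → ℝ := fun u => max ‖confExp a (u - s) - 1‖ ‖confExp a (s - u) - 1‖ with hδ
  have hδc : Continuous δ := by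
    have := continuous_confExp a
    fun_prop
  have hδs : δ s = 0 := by simp [hδ, confExp_zero]
  have hlim : Tendsto (fun u => ‖B‖ * (δ u * ((18 + 12 * t) * M) * (1 + 1 / η) + η * M))
      (𝓝[Set.Icc (-1) 1] s) (𝓝 (‖B‖ * (η * M))) := by
    have h1 : Continuous fun u => ‖B‖ * (δ u * ((18 + 12 * t) * M) * (1 + 1 / η) + η * M) := by
      fun_prop
    have h2 := h1.continuousWithinAt (s := Set.Icc (-1 : ℝ) 1) (x := s)
    have h3 := h2.tendsto
    simp only [hδs, zero_mul, zero_add] at h3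
    exact h3
  have hlt : ‖B‖ * (η * M) < ε := by
    have h1 : ‖B‖ * (η * M) = η * (‖B‖ * M) := by ring
    have h2 : η * (2 * (‖B‖ * M + 1)) = ε := div_mul_cancel₀ _ (by positivity)
    nlinarith
  have hδ1 : ∀ᶠ u in 𝓝[Set.Icc (-1) 1] s, δ u < 1 :=
    (hδc.continuousWithinAt.tendsto).eventually (gt_mem_nhds (by rw [hδs]; norm_num))
  filter_upwards [hlim.eventually (gt_mem_nhds hlt), hδ1, self_mem_nhdsWithin] with u h1 h2 hu
  obtain ⟨κ, f, m, hQ⟩ := hF u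
  rw [Real.dist_eq]
  refine lt_of_le_of_lt ?_ h1
  exact (isConj_sandwich D ha s u).abs_heatRe_sub_le hP hQ B ht
    ((norm_nonneg _).trans (le_max_left _ _)) h2.le (le_max_left _ _) (le_max_right _ _) hη0
    (hM s hs).2.1 (hM u hu).2.1 (hM s hs).2.2 (hM u hu).2.2

/-- The function is a limit, uniform in s, of difference quotients in t of heat traces, which are
continuous in s. -/
lemma HasHeatDiags.continuousOn_heatSqRe (hF : HasHeatDiags D a) (ha : IsSelfAdjoint a)
    (B : H →L[ℂ] H) {t : ℝ} (ht : 0 < t) :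
    ContinuousOn (fun s => heatSqRe (sandwich D (confExp a s)) B t) (Set.Icc (-1) 1) := by
  obtain ⟨M, hM0, hM⟩ := hF.exists_bound_both ha ht
  apply continuousOn_of_uniform_approx_of_continuousOn
  intro u hu
  obtain ⟨ε, hε, hεu⟩ := Metric.mem_uniformity_dist.1 hu
  set C := ‖B‖ * (4 / t ^ 2) * M with hC
  have hC0 : 0 ≤ C := by positivity
  set η := ε / (C + 1) with hη
  have hη0 : 0 < η := by positivity
  refine ⟨fun s => (heatRe (sandwich D (confExp a s)) B t -
    heatRe (sandwich D (confExp a s)) B (t + η)) / η,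
    ((hF.continuousOn_heatRe ha B ht).sub
      (hF.continuousOn_heatRe ha B (add_pos ht hη0))).div_const η, fun s hs => hεu ?_⟩
  obtain ⟨ι, e, l, hP⟩ := hF s
  rw [Real.dist_eq]
  refine (hP.abs_heatSqRe_sub_le B ht hη0).trans_lt ?_
  calc _ ≤ η * C := by
        rw [hC]
        gcongr
        exact (hM s hs).2.1
    _ < ε := by
        have : η * (C + 1) = ε := div_mul_cancel₀ _ (by positivity)
        linarith

/-- The variation of the heat trace under conformal deformations. -/
theorem HasHeatDiags.hasDerivWithinAt_heatRe_one (hF : HasHeatDiags D a) (ha : IsSelfAdjoint a)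
    {t : ℝ} (ht : 0 < t) {s : ℝ} (hs : s ∈ Set.Icc (-1 : ℝ) 1) :
    HasDerivWithinAt (fun u => heatRe (sandwich D (confExp a u)) 1 t)
      (-(2 * t * heatSqRe (sandwich D (confExp a s)) a t)) (Set.Icc (-1) 1) s := by
  obtain ⟨M, hM0, hM⟩ := hF.exists_bound_both ha ht
  set Θ := fun u => heatRe (sandwich D (confExp a u)) 1 t with hΘ
  set F := fun u => heatRe (sandwich D (confExp a u)) a t with hFd
  set G := fun u => heatSqRe (sandwich D (confExp a u)) a t with hG
  set R : ℝ → H →L[ℂ] H := fun r => confExp a (2 * r) - 1 - (r : ℂ) • a with hR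
  have hRo : (fun r => ‖R r‖) =o[𝓝 0] fun r : ℝ => r := by
    have h := (hasDerivAt_iff_isLittleO.1 (hasDerivAt_confExp a)).norm_left
    refine h.congr (fun r => ?_) fun r => sub_zero r
    simp only [hR, mul_zero, confExp_zero, sub_zero, Complex.coe_smul]
  have hVV : ∀ r, confExp a r * confExp a r = 1 + (r : ℂ) • a + R r := fun r => by
    rw [← confExp_add, ← two_mul]; simp only [hR]; abel
  have hVV' : ∀ r, confExp a (-r) * confExp a (-r) = 1 - (r : ℂ) • a + R (-r) := fun r => by
    rw [hVV, Complex.ofReal_neg, neg_smul]; abel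
  -- The estimate is valid for either sign of v − u. The pair (s, v) bounds Θ(v) − Θ(s) from below
  -- and the pair (v, s) from above; the two bounds differ by the increments of F and G, times v −
  -- s, and by the remainders R, all of which are o(v − s).
  have hlow : ∀ u ∈ Set.Icc (-1 : ℝ) 1, ∀ v ∈ Set.Icc (-1 : ℝ) 1,
      (v - u) * (F v - F u) - 2 * t * (v - u) * G u -
        (2 + t) * M * (‖R (v - u)‖ + ‖R (u - v)‖) ≤ Θ v - Θ u := by
    intro u hu v hv
    obtain ⟨ι, e, l, hP⟩ := hF u
    obtain ⟨κ, f, m, hQ⟩ := hF v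
    have h := hVV' (v - u)
    rw [neg_sub] at h
    exact (isConj_sandwich D ha u v).heatRe_one_sub_ge hP hQ ht (hVV (v - u)) h
      (hM u hu).1 (hM v hv).1 (hM u hu).2.2
  rw [hasDerivWithinAt_iff_isLittleO]
  have hsub : Tendsto (fun v => v - s) (𝓝[Set.Icc (-1) 1] s) (𝓝 0) := by
    have h : Continuous fun v : ℝ => v - s := by fun_prop
    have := h.continuousWithinAt (s := Set.Icc (-1 : ℝ) 1) (x := s)
    simpa using this.tendsto
  have hsub' : Tendsto (fun v => s - v) (𝓝[Set.Icc (-1) 1] s) (𝓝 0) := by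
    simpa using hsub.neg
  have o1 : (fun v => ‖R (v - s)‖) =o[𝓝[Set.Icc (-1) 1] s] fun v => v - s := hRo.comp_tendsto hsub
  have o2 : (fun v => ‖R (s - v)‖) =o[𝓝[Set.Icc (-1) 1] s] fun v => v - s := by
    have h := (hRo.comp_tendsto hsub').neg_right
    refine h.congr_right fun v => ?_
    simp
  have hFc : Tendsto (fun v => F v - F s) (𝓝[Set.Icc (-1) 1] s) (𝓝 0) := by
    have h := (hF.continuousOn_heatRe ha a ht s hs).tendsto.sub_const (F s)
    rwa [sub_self] at h
  have hGc : Tendsto (fun v => G v - G s) (𝓝[Set.Icc (-1) 1] s) (𝓝 0) := by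
    have h := (hF.continuousOn_heatSqRe ha a ht s hs).tendsto.sub_const (G s)
    rwa [sub_self] at h
  have o3 : (fun v => |v - s| * (|F v - F s| + 2 * t * |G v - G s|)) =o[𝓝[Set.Icc (-1) 1] s]
      fun v => v - s := by
    have h1 : Tendsto (fun v => |F v - F s| + 2 * t * |G v - G s|) (𝓝[Set.Icc (-1) 1] s)
        (𝓝 0) := by
      simpa using hFc.abs.add (hGc.abs.const_mul (2 * t))
    have h2 := (isBigO_refl (fun v => |v - s|) (𝓝[Set.Icc (-1) 1] s)).mul_isLittleO
      ((isLittleO_one_iff ℝ).2 h1)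
    have h3 : (fun v => |v - s| * (1 : ℝ)) =O[𝓝[Set.Icc (-1) 1] s] fun v => v - s := by
      simpa using (isBigO_refl (fun v => v - s) (𝓝[Set.Icc (-1) 1] s)).norm_left
    exact h2.trans_isBigO h3
  have o4 := o3.add ((o1.add o2).const_mul_left ((2 + t) * M))
  refine IsBigO.trans_isLittleO (IsBigO.of_bound 1 ?_) o4
  filter_upwards [self_mem_nhdsWithin] with v hv
  have l1 := hlow s hs v hv
  have l2 := hlow v hv s hs
  rw [one_mul, Real.norm_eq_abs, Real.norm_eq_abs, smul_eq_mul]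
  refine le_trans ?_ (le_abs_self _)
  have x1 : -(|v - s| * |F v - F s|) ≤ (v - s) * (F v - F s) := by
    rw [← abs_mul]; exact neg_abs_le _
  have x2 : |(v - s) * (G v - G s)| = |v - s| * |G v - G s| := abs_mul _ _
  have x3 := mul_le_mul_of_nonneg_left (neg_abs_le ((v - s) * (G v - G s))) ht.le
  have x4 := mul_le_mul_of_nonneg_left (le_abs_self ((v - s) * (G v - G s))) ht.le
  rw [x2] at x3 x4
  have x5 : 0 ≤ t * (|v - s| * |G v - G s|) := by positivity
  have x6 : (s - v) * (F s - F v) = (v - s) * (F v - F s) := by ring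
  rw [abs_le]
  constructor
  · linarith
  · linarith

end Family

/-! ### Asymptotic expansions as `t ↘ 0` -/

section Expansion

open Polynomial

/-- The singular and constant part of the expansion `∑ a_j t^{(j - p)/2}`, as a polynomial in
`t^{-1/2}`. -/
def expPoly (p : ℕ) (a : ℕ → ℂ) : ℂ[X] := ∑ j ∈ Finset.range (p + 1), C (a j) * X ^ (p - j)

lemma coeff_zero_expPoly (p : ℕ) (a : ℕ → ℂ) : (expPoly p a).coeff 0 = a p := by
  rw [expPoly, finsetSum_coeff, Finset.sum_eq_single p]
  · simp
  · intro j hj hjp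
    have : p - j ≠ 0 := by have := Finset.mem_range.1 hj; omega
    rw [coeff_C_mul_X_pow, if_neg this.symm]
  · simp

lemma tendsto_exp_neg_nhdsGT : Tendsto (fun x : ℝ => Real.exp (-x)) atTop (𝓝[>] 0) :=
  tendsto_nhdsWithin_iff.2
    ⟨Real.tendsto_exp_neg_atTop_nhds_zero, Eventually.of_forall fun _ => Real.exp_pos _⟩

lemma tendsto_exp_half : Tendsto (fun x : ℝ => Real.exp (x / 2)) atTop atTop :=
  Real.tendsto_exp_atTop.comp (tendsto_id.atTop_div_const two_pos)

lemma HasExpansion.tendsto_sub_eval {p : ℕ} {F : ℝ → ℂ} {a : ℕ → ℂ} (h : HasExpansion p F a) :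
    Tendsto (fun x : ℝ => F (Real.exp (-x)) - (expPoly p a).eval ((Real.exp (x / 2) : ℝ) : ℂ))
      atTop (𝓝 0) := by
  have h1 := h p
  simp only [sub_self, zero_div, Real.rpow_zero] at h1
  refine (((isLittleO_one_iff ℝ).1 h1).comp tendsto_exp_neg_nhdsGT).congr fun x => ?_
  simp only [Function.comp_apply, expPoly, eval_finsetSum, eval_mul, eval_C, eval_pow, eval_X]
  congr 1
  refine Finset.sum_congr rfl fun j hj => ?_
  have hj' : j ≤ p := Nat.lt_succ_iff.1 (Finset.mem_range.1 hj)
  rw [← Complex.ofReal_pow, ← Real.exp_mul, ← Real.exp_nat_mul, Nat.cast_sub hj']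
  congr 3
  ring

/-- With u = e^{x/2} → ∞, the quotient (P(u) − P(0))/u is a polynomial in u tending to 0, hence it
is zero. -/
lemma eq_C_of_isLittleO {P : ℂ[X]}
    (h : (fun x : ℝ => P.eval ((Real.exp (x / 2) : ℝ) : ℂ)) =o[atTop]
      fun x : ℝ => Real.exp (x / 2)) : P = C (P.coeff 0) := by
  have hu : Tendsto (fun x : ℝ => ‖((Real.exp (x / 2) : ℝ) : ℂ)‖) atTop atTop := by
    refine tendsto_exp_half.congr fun x => ?_
    rw [Complex.norm_real, Real.norm_of_nonneg (Real.exp_pos _).le]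
  have h1 : (fun _ : ℝ => P.coeff 0) =o[atTop] fun x : ℝ => Real.exp (x / 2) :=
    isLittleO_const_left.2 (Or.inr (by simpa [Function.comp_def] using tendsto_exp_half))
  have h2 := (h.sub h1).norm_norm
  have h3 : Tendsto (fun x : ℝ => ‖(P.divX).eval ((Real.exp (x / 2) : ℝ) : ℂ)‖) atTop (𝓝 0) := by
    refine h2.tendsto_div_nhds_zero.congr fun x => ?_
    have e : P.eval ((Real.exp (x / 2) : ℝ) : ℂ) - P.coeff 0 =
        (P.divX).eval ((Real.exp (x / 2) : ℝ) : ℂ) * ((Real.exp (x / 2) : ℝ) : ℂ) := by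
      conv_lhs => rw [← divX_mul_X_add P]
      simp
    have : ‖Real.exp (x / 2)‖ ≠ 0 := norm_ne_zero_iff.2 (Real.exp_pos _).ne'
    rw [e, norm_mul, Complex.norm_real, mul_div_cancel_right₀ _ this]
  have hdeg : ¬ 0 < P.divX.degree := fun hd =>
    not_tendsto_atTop_of_tendsto_nhds h3 (P.divX.tendsto_norm_atTop hd hu)
  have h4 := eq_C_of_degree_le_zero (not_lt.1 hdeg)
  rw [h4] at h3
  simp only [eval_C] at h3
  have h5 := tendsto_nhds_unique h3 tendsto_const_nhds
  rw [norm_eq_zero.1 h5.symm, C_0] at h4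
  conv_lhs => rw [← divX_mul_X_add P, h4, zero_mul, zero_add]

/-- The difference of the two singular-plus-constant parts is a polynomial in t^{-1/2} that tends to
0, so it vanishes. This identifies the constant terms supplied by expansions for different h. -/
lemma HasExpansion.coeff_unique {p : ℕ} {F : ℝ → ℂ} {a a' : ℕ → ℂ} (h : HasExpansion p F a)
    (h' : HasExpansion p F a') : a p = a' p := by
  have h1 : Tendsto (fun x : ℝ => (expPoly p a - expPoly p a').eval ((Real.exp (x / 2) : ℝ) : ℂ))
      atTop (𝓝 0) := by
    have := h'.tendsto_sub_eval.sub h.tendsto_sub_eval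
    rw [sub_zero] at this
    refine this.congr fun x => ?_
    rw [eval_sub]
    ring
  have h2 := eq_C_of_isLittleO (((isLittleO_one_iff ℝ).2 h1).trans_isBigO
    (isLittleO_const_left.2 (Or.inr (by simpa [Function.comp_def] using tendsto_exp_half))).isBigO)
  rw [h2] at h1
  simp only [eval_C] at h1
  have h3 := tendsto_nhds_unique h1 tendsto_const_nhds
  rw [coeff_sub, coeff_zero_expPoly, coeff_zero_expPoly] at h3
  exact sub_eq_zero.1 h3.symm

lemma HasExpansion.congr {p : ℕ} {F F' : ℝ → ℂ} {a : ℕ → ℂ} (h : HasExpansion p F a)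
    (e : ∀ t > 0, F t = F' t) : HasExpansion p F' a := fun N => by
  refine (h N).congr' ?_ EventuallyEq.rfl
  filter_upwards [self_mem_nhdsWithin] with t ht
  rw [e t ht]

lemma exists_derivative_eq (Q : ℂ[X]) : ∃ R : ℂ[X], derivative R = Q := by
  induction Q using Polynomial.induction_on' with
  | add p q hp hq =>
    obtain ⟨R, rfl⟩ := hp
    obtain ⟨S, rfl⟩ := hq
    exact ⟨R + S, derivative_add⟩
  | monomial n c =>
    refine ⟨monomial (n + 1) (c / (n + 1)), ?_⟩
    rw [derivative_monomial, Nat.add_sub_cancel]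
    have : (n : ℂ) + 1 ≠ 0 := by exact_mod_cast n.succ_ne_zero
    push_cast
    rw [div_mul_cancel₀ _ this]

lemma isLittleO_id_of_tendsto_deriv {ψ ψ' : ℝ → ℂ} (hd : ∀ x, HasDerivAt ψ (ψ' x) x)
    (h : Tendsto ψ' atTop (𝓝 0)) : ψ =o[atTop] fun x : ℝ => x := by
  rw [isLittleO_iff]
  intro ε hε
  obtain ⟨x₀, hx₀⟩ := eventually_atTop.1
    ((tendsto_zero_iff_norm_tendsto_zero.1 h).eventually (gt_mem_nhds (half_pos hε)))
  have hlin : Tendsto (fun x : ℝ => ε / 2 * x) atTop atTop :=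
    tendsto_id.const_mul_atTop (half_pos hε)
  filter_upwards [eventually_ge_atTop (max x₀ 0),
    hlin.eventually_ge_atTop (‖ψ x₀‖ + ε / 2 * |x₀|)] with x hx hx2
  have hx1 : x₀ ≤ x := (le_max_left _ _).trans hx
  have hx0 : 0 ≤ x := (le_max_right _ _).trans hx
  have h1 := (convex_Ici x₀).norm_image_sub_le_of_norm_hasDerivWithin_le
    (f := ψ) (f' := ψ') (C := ε / 2) (fun y _ => (hd y).hasDerivWithinAt)
    (fun y hy => (hx₀ y hy).le) (Set.self_mem_Ici : x₀ ∈ Set.Ici x₀) hx1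
  have h2 : ‖ψ x‖ ≤ ‖ψ x₀‖ + ‖ψ x - ψ x₀‖ := by
    have := norm_add_le (ψ x₀) (ψ x - ψ x₀)
    rwa [add_sub_cancel] at this
  rw [Real.norm_of_nonneg (by linarith : 0 ≤ x - x₀)] at h1
  rw [Real.norm_of_nonneg hx0]
  have h3 := mul_le_mul_of_nonneg_left (neg_abs_le x₀) (half_pos hε).le
  linarith

/-- An expansion of `F` without logarithm forces the constant term in the expansion of
`2 t F'(t)` to vanish. -/
theorem HasExpansion.constant_term_eq_zero {p : ℕ} {F F' : ℝ → ℂ} {a b : ℕ → ℂ}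
    (hF : HasExpansion p F a) (hd : ∀ t > 0, HasDerivAt F (F' t) t)
    (hG : HasExpansion p (fun t => 2 * t * F' t) b) : b p = 0 := by
  -- Put t = e^{-x} and u = e^{x/2}, so that d/dx F(e^{-x}) = −G/2 for G = 2tF'. Since du/dx = u/2,
  -- this R integrates the nonconstant part of −G/2, and the constant term contributes −(b_p/2) x.
  obtain ⟨R, hR⟩ := exists_derivative_eq (-(expPoly p b).divX)
  set e : ℝ → ℂ := fun x => ((Real.exp (x / 2) : ℝ) : ℂ) with he
  have hed : ∀ x, HasDerivAt e (e x / 2) x := fun x => by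
    have h1 : HasDerivAt (fun x : ℝ => Real.exp (x / 2)) (Real.exp (x / 2) * (1 / 2)) x :=
      ((hasDerivAt_id x).div_const 2).exp
    have h2 := h1.ofReal_comp
    refine h2.congr_deriv ?_
    simp only [he]
    push_cast
    ring
  have hψ : ∀ x, HasDerivAt (fun x : ℝ => F (Real.exp (-x)) - R.eval (e x) + b p / 2 * x)
      (-(1 / 2) * (2 * (Real.exp (-x) : ℝ) * F' (Real.exp (-x)) - (expPoly p b).eval (e x))) x := by
    intro x
    have h1 : HasDerivAt (fun x : ℝ => Real.exp (-x)) (Real.exp (-x) * -1) x :=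
      (hasDerivAt_id x).neg.exp
    have h2 := (hd _ (Real.exp_pos (-x))).scomp x h1
    have h3 := (R.hasDerivAt (e x)).comp x (hed x)
    have h4 : HasDerivAt (fun x : ℝ => b p / 2 * (x : ℂ)) (b p / 2 * ((1 : ℝ) : ℂ)) x :=
      (hasDerivAt_id x).ofReal_comp.const_mul _
    refine ((h2.sub h3).add h4).congr_deriv ?_
    have h5 : (expPoly p b).eval (e x) = (expPoly p b).divX.eval (e x) * e x + b p := by
      conv_lhs => rw [← divX_mul_X_add (expPoly p b)]
      simp [coeff_zero_expPoly]
    rw [hR, h5, eval_neg, Complex.real_smul]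
    push_cast
    ring
  have ho := isLittleO_id_of_tendsto_deriv hψ (by
    have := hG.tendsto_sub_eval.const_mul (-(1 / 2) : ℂ)
    rwa [mul_zero] at this)
  have hx : Tendsto (fun x : ℝ => ‖x‖) atTop atTop := tendsto_norm_atTop_atTop
  have ho1 : (fun x : ℝ => F (Real.exp (-x)) - (expPoly p a).eval (e x)) =o[atTop]
      fun x : ℝ => x :=
    ((isLittleO_one_iff ℝ).2 hF.tendsto_sub_eval).trans_isBigO
      (isLittleO_const_left.2 (Or.inr hx)).isBigO
  have ho2 : (fun x : ℝ => (expPoly p a - R).eval (e x) + b p / 2 * x) =o[atTop]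
      fun x : ℝ => x := by
    refine (ho.sub ho1).congr_left fun x => ?_
    rw [eval_sub]
    ring
  have hlin : (fun x : ℝ => b p / 2 * (x : ℂ)) =O[atTop] fun x : ℝ => x := by
    refine IsBigO.of_bound ‖b p / 2‖ (Eventually.of_forall fun x => ?_)
    rw [norm_mul, Complex.norm_real]
  have ho3 : (fun x : ℝ => x) =o[atTop] fun x : ℝ => Real.exp (x / 2) := by
    have h := isLittleO_pow_exp_pos_mul_atTop 1 (one_half_pos : (0 : ℝ) < 1 / 2)
    refine h.congr (fun x => pow_one x) fun x => ?_
    ring_nf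
  -- The linear term is itself o(u), so the polynomials in u must agree up to a constant; only then
  -- is b_p x/2 seen to be o(x), which forces b_p = 0.
  have hPR := eq_C_of_isLittleO (P := expPoly p a - R) (by
    refine ((ho2.isBigO.sub hlin).trans_isLittleO ho3).congr_left fun x => ?_
    ring)
  rw [hPR] at ho2
  simp only [eval_C] at ho2
  have ho4 := ho2.sub (isLittleO_const_left.2 (Or.inr hx) :
    (fun _ : ℝ => (expPoly p a - R).coeff 0) =o[atTop] fun x : ℝ => x)
  have ho5 : Tendsto (fun x : ℝ => ‖b p / 2‖) atTop (𝓝 0) := by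
    refine ho4.norm_norm.tendsto_div_nhds_zero.congr' ?_
    filter_upwards [eventually_gt_atTop 0] with x hx
    rw [add_sub_cancel_left, norm_mul, Complex.norm_real,
      mul_div_cancel_right₀ _ (norm_ne_zero_iff.2 hx.ne')]
  have := tendsto_nhds_unique ho5 tendsto_const_nhds
  simpa using this.symm

end Expansion

/-! ### Mellin transforms of functions with an asymptotic expansion -/

section Mellin

open MeasureTheory

/-- The function `t ↦ t^r` on `(0, 1]`, extended by zero. -/
def cutPow (r : ℝ) : ℝ → ℂ := Set.indicator (Set.Ioc 0 1) fun t => (t : ℂ) ^ (r : ℂ)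

lemma locallyIntegrableOn_cutPow (r : ℝ) : LocallyIntegrableOn (cutPow r) (Set.Ioi 0) := by
  have h : ContinuousOn (fun t : ℝ => (t : ℂ) ^ (r : ℂ)) (Set.Ioi 0) := fun t ht =>
    (Complex.continuousAt_ofReal_cpow_const t r (Or.inr (ne_of_gt ht))).continuousWithinAt
  intro t ht
  obtain ⟨U, hU, hUi⟩ := h.locallyIntegrableOn (μ := volume) measurableSet_Ioi t ht
  exact ⟨U, hU, Integrable.indicator hUi measurableSet_Ioc⟩

lemma cutPow_of_mem (r : ℝ) {t : ℝ} (ht : t ∈ Set.Ioc (0 : ℝ) 1) :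
    cutPow r t = ((t ^ r : ℝ) : ℂ) := by
  rw [cutPow, Set.indicator_of_mem ht, Complex.ofReal_cpow ht.1.le]

/-- The function `f` minus the first `N` terms of its expansion, cut off at `t = 1`. -/
def expRemainder (p : ℕ) (f : ℝ → ℂ) (a : ℕ → ℂ) (N : ℕ) (t : ℝ) : ℂ :=
  f t - ∑ j ∈ Finset.range N, a j * cutPow (((j : ℝ) - p) / 2) t

lemma expRemainder_succ (p : ℕ) (f : ℝ → ℂ) (a : ℕ → ℂ) (N : ℕ) :
    expRemainder p f a (N + 1) =
      fun t => expRemainder p f a N t - a N • cutPow (((N : ℝ) - p) / 2) t := by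
  funext t
  rw [expRemainder, expRemainder, Finset.sum_range_succ, smul_eq_mul]
  ring

/-- The Mellin transform of the remainder plus the Mellin transforms of the first terms of the
expansion; this continues the Mellin transform of `f`. -/
def mellinCont (p : ℕ) (f : ℝ → ℂ) (a : ℕ → ℂ) (N : ℕ) (w : ℂ) : ℂ :=
  mellin (expRemainder p f a N) w +
    ∑ j ∈ Finset.range N, a j * (1 / (w + ((((j : ℝ) - p) / 2 : ℝ) : ℂ)))

variable {p : ℕ} {f : ℝ → ℂ} {a : ℕ → ℂ} {b : ℝ}

lemma locallyIntegrableOn_expRemainder (hf : ContinuousOn f (Set.Ioi 0)) (N : ℕ) :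
    LocallyIntegrableOn (expRemainder p f a N) (Set.Ioi 0) := by
  induction N with
  | zero =>
    have : expRemainder p f a 0 = f := by funext t; simp [expRemainder]
    rw [this]
    exact hf.locallyIntegrableOn measurableSet_Ioi
  | succ N ih =>
    rw [expRemainder_succ]
    exact ih.sub ((locallyIntegrableOn_cutPow _).smul (a N))

lemma expRemainder_isBigO_atTop (hf : f =O[atTop] fun t => Real.exp (-b * t)) (N : ℕ) :
    expRemainder p f a N =O[atTop] fun t => Real.exp (-b * t) := by
  refine hf.congr' ?_ EventuallyEq.rfl
  filter_upwards [eventually_gt_atTop 1] with t ht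
  rw [expRemainder, Finset.sum_eq_zero, sub_zero]
  intro j _
  have : t ∉ Set.Ioc (0 : ℝ) 1 := fun h => absurd h.2 (not_le.2 ht)
  rw [cutPow, Set.indicator_of_notMem this, mul_zero]

lemma HasExpansion.expRemainder_isBigO (hE : HasExpansion p f a) (N : ℕ) :
    expRemainder p f a N =O[𝓝[>] 0] (· ^ (-(((p : ℝ) - N) / 2)) : ℝ → ℝ) := by
  have h1 : (fun t : ℝ => a N * ((t ^ (((N : ℝ) - p) / 2) : ℝ) : ℂ)) =O[𝓝[>] 0]
      fun t : ℝ => t ^ (((N : ℝ) - p) / 2) := by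
    refine IsBigO.of_bound ‖a N‖ (Eventually.of_forall fun t => ?_)
    rw [norm_mul, Complex.norm_real]
  have h2 := (hE N).isBigO.add h1
  have e : -(((p : ℝ) - N) / 2) = ((N : ℝ) - p) / 2 := by ring
  rw [e]
  refine h2.congr' ?_ EventuallyEq.rfl
  filter_upwards [Ioc_mem_nhdsGT (zero_lt_one' ℝ)] with t ht
  rw [expRemainder, Finset.sum_range_succ, ← sub_sub, sub_add_cancel]
  congr 1
  refine Finset.sum_congr rfl fun j _ => ?_
  rw [cutPow_of_mem _ ht]

lemma mellinConvergent_expRemainder (hf : ContinuousOn f (Set.Ioi 0)) (hb : 0 < b)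
    (htop : f =O[atTop] fun t => Real.exp (-b * t)) (hE : HasExpansion p f a) {N : ℕ} {w : ℂ}
    (hw : ((p : ℝ) - N) / 2 < w.re) : MellinConvergent (expRemainder p f a N) w :=
  mellinConvergent_of_isBigO_rpow_exp hb (locallyIntegrableOn_expRemainder hf N)
    (expRemainder_isBigO_atTop htop N) (hE.expRemainder_isBigO N) hw

lemma differentiableAt_mellin_expRemainder (hf : ContinuousOn f (Set.Ioi 0)) (hb : 0 < b)
    (htop : f =O[atTop] fun t => Real.exp (-b * t)) (hE : HasExpansion p f a) {N : ℕ} {w : ℂ}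
    (hw : ((p : ℝ) - N) / 2 < w.re) : DifferentiableAt ℂ (mellin (expRemainder p f a N)) w :=
  mellin_differentiableAt_of_isBigO_rpow_exp hb (locallyIntegrableOn_expRemainder hf N)
    (expRemainder_isBigO_atTop htop N) (hE.expRemainder_isBigO N) hw

lemma analyticAt_mellin_expRemainder (hf : ContinuousOn f (Set.Ioi 0)) (hb : 0 < b)
    (htop : f =O[atTop] fun t => Real.exp (-b * t)) (hE : HasExpansion p f a) {N : ℕ} {w : ℂ}
    (hw : ((p : ℝ) - N) / 2 < w.re) : AnalyticAt ℂ (mellin (expRemainder p f a N)) w := by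
  rw [Complex.analyticAt_iff_eventually_differentiableAt]
  filter_upwards [Complex.continuous_re.continuousAt.eventually (lt_mem_nhds hw)] with z hz
  exact differentiableAt_mellin_expRemainder hf hb htop hE hz

lemma mellinCont_zero (w : ℂ) : mellinCont p f a 0 w = mellin f w := by
  have : expRemainder p f a 0 = f := by funext t; simp [expRemainder]
  rw [mellinCont, this, Finset.sum_range_zero, add_zero]

/-- The Mellin transform of t^r on (0, 1] is 1/(w + r), so moving one term of the expansion out of
the integral changes nothing where both sides converge. -/
lemma mellinCont_succ (hf : ContinuousOn f (Set.Ioi 0)) (hb : 0 < b)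
    (htop : f =O[atTop] fun t => Real.exp (-b * t)) (hE : HasExpansion p f a) {N : ℕ} {w : ℂ}
    (hw : ((p : ℝ) - N) / 2 < w.re) : mellinCont p f a (N + 1) w = mellinCont p f a N w := by
  have hw' : 0 < w.re + ((((N : ℝ) - p) / 2 : ℝ) : ℂ).re := by
    rw [Complex.ofReal_re]
    linarith
  have h1 := hasMellin_cpow_Ioc ((((N : ℝ) - p) / 2 : ℝ) : ℂ) hw'
  have h2 := hasMellin_const_smul h1.1 (a N)
  have h3 := (hasMellin_sub (mellinConvergent_expRemainder hf hb htop hE hw) h2.1).2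
  rw [h2.2, h1.2, smul_eq_mul] at h3
  rw [mellinCont, mellinCont, expRemainder_succ, Finset.sum_range_succ]
  have h4 : mellin (fun t => expRemainder p f a N t - a N • cutPow (((N : ℝ) - p) / 2) t) w = _ :=
    h3
  rw [h4]
  ring

lemma mellinCont_eq_of_le (hf : ContinuousOn f (Set.Ioi 0)) (hb : 0 < b)
    (htop : f =O[atTop] fun t => Real.exp (-b * t)) (hE : HasExpansion p f a) {N M : ℕ} {w : ℂ}
    (hw : ((p : ℝ) - N) / 2 < w.re) (hNM : N ≤ M) :
    mellinCont p f a M w = mellinCont p f a N w := by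
  induction M, hNM using Nat.le_induction with
  | base => rfl
  | succ M hM ih =>
    rw [mellinCont_succ hf hb htop hE, ih]
    have : (N : ℝ) ≤ M := by exact_mod_cast hM
    linarith

lemma mellinCont_eq (hf : ContinuousOn f (Set.Ioi 0)) (hb : 0 < b)
    (htop : f =O[atTop] fun t => Real.exp (-b * t)) (hE : HasExpansion p f a) {N M : ℕ} {w : ℂ}
    (hN : ((p : ℝ) - N) / 2 < w.re) (hM : ((p : ℝ) - M) / 2 < w.re) :
    mellinCont p f a M w = mellinCont p f a N w := by
  rcases le_total N M with h | h
  · exact mellinCont_eq_of_le hf hb htop hE hN h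
  · exact (mellinCont_eq_of_le hf hb htop hE hM h).symm

lemma meromorphicAt_mellinCont (hf : ContinuousOn f (Set.Ioi 0)) (hb : 0 < b)
    (htop : f =O[atTop] fun t => Real.exp (-b * t)) (hE : HasExpansion p f a) {N : ℕ} {w : ℂ}
    (hw : ((p : ℝ) - N) / 2 < w.re) : MeromorphicAt (mellinCont p f a N) w := by
  refine (analyticAt_mellin_expRemainder hf hb htop hE hw).meromorphicAt.add ?_
  refine MeromorphicAt.fun_sum fun j => ?_
  fun_prop

lemma analyticAt_Gamma_inv (w : ℂ) : AnalyticAt ℂ (fun w => (Complex.Gamma w)⁻¹) w :=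
  Complex.differentiable_one_div_Gamma.analyticAt w

lemma analyticAt_comp_half {g : ℂ → ℂ} {z : ℂ} (hg : AnalyticAt ℂ g (z / 2)) :
    AnalyticAt ℂ (fun z => g (z / 2)) z := by
  have h : AnalyticAt ℂ (fun z : ℂ => z / 2) z := analyticAt_id.div_const
  exact AnalyticAt.fun_comp (f := fun z : ℂ => z / 2) hg h

lemma inv_mul_Gamma_inv {w : ℂ} (hw : w ≠ 0) :
    1 / w * (Complex.Gamma w)⁻¹ = (Complex.Gamma (w + 1))⁻¹ := by
  rw [Complex.Gamma_add_one w hw, mul_inv, one_div]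

/-- The quotient of the Mellin transform of `f` by the Gamma function continues meromorphically, and
its value at the origin is the constant term of the expansion of `f`. -/
theorem HasExpansion.exists_meromorphic (hE : HasExpansion p f a)
    (hf : ContinuousOn f (Set.Ioi 0)) (hb : 0 < b)
    (htop : f =O[atTop] fun t => Real.exp (-b * t)) :
    ∃ Z : ℂ → ℂ, Meromorphic Z ∧
      (∀ z : ℂ, (p : ℝ) < z.re → Z z = mellin f (z / 2) * (Complex.Gamma (z / 2))⁻¹) ∧
      AnalyticAt ℂ Z 0 ∧ Z 0 = a p := by
  -- The number of subtracted terms grows with |Re z|, so that the remainder integral converges at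
  -- z/2; by `mellinCont_eq` it may be taken constant near each point.
  set K : ℂ → ℕ := fun z => p + ⌈|z.re|⌉₊ + 1 with hK
  have hKz : ∀ z : ℂ, ((p : ℝ) - K z) / 2 < (z / 2).re := fun z => by
    have h1 := Nat.le_ceil |z.re|
    have h2 := neg_abs_le z.re
    rw [Complex.div_ofNat_re, hK]
    push_cast
    linarith
  set Y : ℂ → ℂ := fun z => mellinCont p f a (K z) (z / 2) * (Complex.Gamma (z / 2))⁻¹ with hY
  have hcont : Continuous fun z : ℂ => (z / 2).re := by fun_prop
  have hloc : ∀ z₀ : ℂ, ∀ᶠ z in 𝓝 z₀,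
      Y z = mellinCont p f a (K z₀) (z / 2) * (Complex.Gamma (z / 2))⁻¹ := fun z₀ => by
    filter_upwards [hcont.continuousAt.eventually (lt_mem_nhds (hKz z₀))] with z hz
    rw [hY]
    simp only
    rw [mellinCont_eq hf hb htop hE hz (hKz z)]
  have hΓ : ∀ z₀ : ℂ, AnalyticAt ℂ (fun z : ℂ => (Complex.Gamma (z / 2))⁻¹) z₀ := fun z₀ =>
    analyticAt_comp_half (analyticAt_Gamma_inv (z₀ / 2))
  have hmer : ∀ z₀, MeromorphicAt Y z₀ := fun z₀ => by
    refine MeromorphicAt.congr ?_ ((hloc z₀).filter_mono nhdsWithin_le_nhds |>.mono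
      fun z hz => hz.symm)
    exact ((meromorphicAt_mellinCont hf hb htop hE (hKz z₀)).comp_analyticAt
      (g := fun z : ℂ => z / 2) (by fun_prop)).mul (hΓ z₀).meromorphicAt
  set N := K 0 with hN
  have hpN : p ∈ Finset.range N := Finset.mem_range.2 (by rw [hN, hK]; simp only; omega)
  -- The zero of 1/Γ(w) at w = 0 kills every term regular there. Only the simple pole a_p/w
  -- survives, through 1/(w Γ(w)) = 1/Γ(w + 1).
  set W : ℂ → ℂ := fun z => (mellin (expRemainder p f a N) (z / 2) +
    ∑ j ∈ (Finset.range N).erase p, a j * (1 / (z / 2 + ((((j : ℝ) - p) / 2 : ℝ) : ℂ)))) *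
      (Complex.Gamma (z / 2))⁻¹ + a p * (Complex.Gamma (z / 2 + 1))⁻¹ with hW
  have hWan : AnalyticAt ℂ W 0 := by
    refine AnalyticAt.add (AnalyticAt.mul (AnalyticAt.add ?_ ?_) (hΓ 0))
      (analyticAt_const.mul ?_)
    · exact analyticAt_comp_half (analyticAt_mellin_expRemainder hf hb htop hE (hKz 0))
    · refine Finset.analyticAt_fun_sum _ fun j hj => ?_
      refine analyticAt_const.mul (AnalyticAt.div analyticAt_const (by fun_prop) ?_)
      have hjp : j ≠ p := (Finset.mem_erase.1 hj).1
      have : ((j : ℝ) - p) / 2 ≠ 0 :=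
        div_ne_zero (sub_ne_zero.2 (Nat.cast_injective.ne hjp)) two_ne_zero
      rw [zero_div, zero_add]
      exact Complex.ofReal_ne_zero.2 this
    · exact analyticAt_comp_half (g := fun w => (Complex.Gamma (w + 1))⁻¹)
        (AnalyticAt.fun_comp (f := fun w : ℂ => w + 1) (analyticAt_Gamma_inv _)
          (analyticAt_id.add analyticAt_const))
  have hW0 : W 0 = a p := by
    simp only [hW, zero_div, Complex.Gamma_zero, inv_zero, mul_zero, zero_add, Complex.Gamma_one,
      inv_one, mul_one]
  -- At 0 itself `Y` takes the default value 0, as `Complex.Gamma 0 = 0`; it is replaced by the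
  -- limit a_p.
  have hZW : Function.update Y 0 (a p) =ᶠ[𝓝 0] W := by
    filter_upwards [hloc 0] with z hz
    rcases eq_or_ne z 0 with rfl | h0
    · rw [Function.update_self, hW0]
    · rw [Function.update_of_ne h0, hz, mellinCont, ← Finset.sum_erase_add _ _ hpN, hW]
      simp only
      rw [sub_self, zero_div, Complex.ofReal_zero, add_zero,
        ← inv_mul_Gamma_inv (div_ne_zero h0 two_ne_zero)]
      ring
  refine ⟨Function.update Y 0 (a p), fun z => ?_, fun z hz => ?_, hWan.congr hZW.symm,
    Function.update_self ..⟩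
  · rcases eq_or_ne z 0 with rfl | h0
    · exact (hWan.congr hZW.symm).meromorphicAt
    · refine (hmer z).congr (Eventually.filter_mono nhdsWithin_le_nhds ?_)
      filter_upwards [isOpen_ne.mem_nhds h0] with y hy
      rw [Function.update_of_ne hy]
  · have h0 : z ≠ 0 := by
      rintro rfl
      have : (0 : ℝ) ≤ p := Nat.cast_nonneg p
      rw [Complex.zero_re] at hz
      linarith
    rw [Function.update_of_ne h0, hY]
    simp only
    rw [mellinCont_eq (N := 0) hf hb htop hE _ (hKz z), mellinCont_zero]
    rw [Complex.div_ofNat_re, Nat.cast_zero, sub_zero]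
    linarith

end Mellin

/-! ### The zeta function in terms of the heat trace -/

lemma HasExpansion.sub_const {p : ℕ} {F : ℝ → ℂ} {a : ℕ → ℂ} (h : HasExpansion p F a) (c : ℂ) :
    HasExpansion p (fun t => F t - c) fun j => a j - if j = p then c else 0 := by
  intro N
  have hs : ∀ t : ℝ, ∑ j ∈ Finset.range (N + 1),
      (if j = p then c else 0) * ((t ^ (((j : ℝ) - p) / 2) : ℝ) : ℂ) = if p ≤ N then c else 0 := by
    intro t
    simp_rw [ite_mul, zero_mul]
    rw [Finset.sum_ite_eq']
    simp
  have h1 : (fun _ : ℝ => (if p ≤ N then c else 0) - c) =o[𝓝[>] (0 : ℝ)]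
      fun t : ℝ => t ^ (((N : ℝ) - p) / 2) := by
    split_ifs with hpN
    · simp only [sub_self]
      exact isLittleO_zero _ _
    · refine isLittleO_const_left.2 (Or.inr ?_)
      have hneg : ((N : ℝ) - p) / 2 < 0 := by
        have : (N : ℝ) < p := by exact_mod_cast not_le.1 hpN
        linarith
      exact tendsto_norm_atTop_atTop.comp (tendsto_rpow_neg_nhdsGT_zero hneg)
  refine ((h N).add h1).congr_left fun t => ?_
  simp_rw [sub_mul]
  rw [Finset.sum_sub_distrib, hs]
  ring

section Spectral

variable {ι : Type*} {b : HilbertBasis ι ℂ H} {D : H →ₗ.[ℂ] H} {l : ι → ℝ}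

omit [CompleteSpace H] in
lemma IsDiag.finite_setOf_eq_zero (hD : IsDiag D b l) : {i | l i = 0}.Finite := by
  refine (eventually_cofinite.1 hD.eventually_one_le).subset fun i hi => ?_
  have : l i = 0 := hi
  simp [this]

omit [CompleteSpace H] in
/-- The nonzero eigenvalues are bounded away from zero. -/
lemma IsDiag.exists_gap (hD : IsDiag D b l) : ∃ r > 0, ∀ i, l i ≠ 0 → r ≤ l i ^ 2 := by
  have hfin : {i | ¬ 1 ≤ |l i|}.Finite := eventually_cofinite.1 hD.eventually_one_le
  have hone : ∀ i, 1 ≤ |l i| → 1 ≤ l i ^ 2 := fun i hi => by rw [← sq_abs]; nlinarith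
  rcases Set.eq_empty_or_nonempty {i | ¬ 1 ≤ |l i| ∧ l i ≠ 0} with he | hne
  · refine ⟨1, one_pos, fun i hi => hone i ?_⟩
    by_contra h
    have : i ∈ {i | ¬ 1 ≤ |l i| ∧ l i ≠ 0} := ⟨h, hi⟩
    rw [he] at this
    exact this
  · obtain ⟨j, hj, hmin⟩ := Set.exists_min_image _ (fun i => l i ^ 2)
      (hfin.subset fun i hi => hi.1) hne
    refine ⟨min 1 (l j ^ 2), lt_min one_pos (by have := hj.2; positivity), fun i hi => ?_⟩
    by_cases h : 1 ≤ |l i|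
    · exact (min_le_left _ _).trans (hone i h)
    · exact (min_le_right _ _).trans (hmin i ⟨h, hi⟩)

omit [CompleteSpace H] in
/-- The dimension of the kernel is the multiplicity of the eigenvalue zero. -/
lemma IsDiag.finrank_eigenspace_zero (hD : IsDiag D b l) :
    Module.finrank ℂ (eigenspace D 0) = {i | l i = 0}.ncard := by
  have hfin := hD.finite_setOf_eq_zero
  have : Fintype {i | l i = 0} := hfin.fintype
  have hspan : eigenspace D 0 = Submodule.span ℂ (Set.range fun i : {i | l i = 0} => b i) := by
    classical
    apply le_antisymm
    · intro x hx
      rw [hD.mem_eigenspace] at hx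
      have : x = ∑ i : {i | l i = 0}, inner ℂ (b i) x • b i := by
        refine basis_ext (b := b) fun j => ?_
        rw [inner_sum]
        simp_rw [inner_smul_right, inner_basis, mul_ite, mul_one, mul_zero]
        by_cases hj : l j = 0
        · rw [Finset.sum_eq_single ⟨j, hj⟩]
          · rw [if_pos rfl]
          · intro i _ hij
            rw [if_neg]
            rintro rfl
            exact hij rfl
          · simp
        · rw [hx j hj, Finset.sum_eq_zero]
          intro i _
          rw [if_neg]
          rintro rfl
          exact hj i.2
      rw [this]
      exact Submodule.sum_mem _ fun i _ =>
        Submodule.smul_mem _ _ (Submodule.subset_span ⟨i, rfl⟩)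
    · rw [Submodule.span_le]
      rintro _ ⟨i, rfl⟩
      refine (hD.mem_eigenspace 0 _).2 fun j hj => ?_
      rw [inner_basis, if_neg]
      rintro rfl
      exact hj i.2
  have hli : LinearIndependent ℂ fun i : {i | l i = 0} => b i :=
    b.orthonormal.linearIndependent.comp _ Subtype.val_injective
  rw [hspan, finrank_span_eq_card hli, Set.ncard_eq_toFinset_card', Set.toFinset_card]

omit [CompleteSpace H] in
lemma IsHeatDiag.countable (hD : IsHeatDiag D b l) : Countable ι := by
  have h := (hD.summable 1 one_pos).countable_support
  have e : (Function.support fun i => Real.exp (-(1 * l i ^ 2))) = Set.univ :=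
    Set.eq_univ_of_forall fun i => (Real.exp_pos _).ne'
  rw [e] at h
  exact Set.countable_univ_iff.1 h

/-- The indicator function of the nonzero eigenvalues. -/
def nonzeroInd (r : ℝ) : ℝ := if r = 0 then 0 else 1

lemma IsHeatDiag.hasSum_heatRe_sub_finrank (hD : IsHeatDiag D b l) {t : ℝ} (ht : 0 < t) :
    HasSum (fun i => nonzeroInd (l i) * Real.exp (-(t * l i ^ 2)))
      (heatRe D 1 t - Module.finrank ℂ (eigenspace D 0)) := by
  classical
  have hfin := hD.diag.finite_setOf_eq_zero
  have h1 : HasSum (fun i => if l i = 0 then (1 : ℝ) else 0)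
      (∑ i ∈ hfin.toFinset, if l i = 0 then (1 : ℝ) else 0) :=
    hasSum_sum_of_ne_finset_zero fun i hi => if_neg fun h => hi (hfin.mem_toFinset.2 h)
  have h2 : (∑ i ∈ hfin.toFinset, if l i = 0 then (1 : ℝ) else 0) =
      Module.finrank ℂ (eigenspace D 0) := by
    rw [hD.diag.finrank_eigenspace_zero, Finset.sum_congr rfl
      fun i hi => if_pos (show l i = 0 from hfin.mem_toFinset.1 hi), Set.ncard_eq_toFinset_card _ hfin]
    simp
  rw [h2] at h1
  refine hasSum_of_forall_eq ((hD.hasSum_heatRe_one ht).sub h1) fun i => ?_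
  rw [nonzeroInd]
  split_ifs with h <;> simp [h]

lemma IsHeatDiag.isBigO_heatRe_sub_finrank (hD : IsHeatDiag D b l) :
    ∃ r > 0, (fun t => ((heatRe D 1 t - Module.finrank ℂ (eigenspace D 0) : ℝ) : ℂ)) =O[atTop]
      fun t => Real.exp (-r * t) := by
  obtain ⟨r, hr, hgap⟩ := hD.diag.exists_gap
  refine ⟨r, hr, IsBigO.of_bound (Real.exp r * heatRe D 1 1) ?_⟩
  filter_upwards [eventually_ge_atTop 1] with t ht
  have ht0 : 0 < t := one_pos.trans_le ht
  have h := hD.hasSum_heatRe_sub_finrank ht0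
  have h0 : ∀ i, 0 ≤ nonzeroInd (l i) := fun i => by rw [nonzeroInd]; split_ifs <;> norm_num
  rw [Complex.norm_real, Real.norm_of_nonneg
    (h.nonneg fun i => mul_nonneg (h0 i) (Real.exp_pos _).le),
    Real.norm_of_nonneg (Real.exp_pos _).le]
  -- For t ≥ 1 and l_i² ≥ r one has e^{-t l_i²} ≤ e^{-r(t-1)} e^{-l_i²}, so time 1 serves as
  -- majorant.
  have h2 := (hD.hasSum_heatRe_one one_pos).mul_left (Real.exp r * Real.exp (-r * t))
  refine (hasSum_le (fun i => ?_) h h2).trans (le_of_eq (by ring))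
  rw [nonzeroInd]
  split_ifs with hi
  · rw [zero_mul]; positivity
  · rw [one_mul, ← Real.exp_add, ← Real.exp_add, Real.exp_le_exp]
    nlinarith [hgap i hi]

lemma nonzeroInd_div_cpow (z : ℂ) (r : ℝ) :
    (nonzeroInd r : ℂ) / ((r ^ 2 : ℝ) : ℂ) ^ (z / 2) = absPowFun z r := by
  rw [nonzeroInd, absPowFun]
  split_ifs with h
  · simp
  · have h1 : ((|r| : ℝ) : ℂ) ≠ 0 := Complex.ofReal_ne_zero.2 (abs_ne_zero.2 h)
    rw [← sq_abs, sq, Complex.ofReal_mul, Complex.mul_cpow_ofReal_nonneg (abs_nonneg _)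
      (abs_nonneg _), ← Complex.cpow_add _ _ h1, add_halves, Complex.cpow_neg, Complex.ofReal_one,
      one_div]

/-- Termwise integration of Euler's integral for Γ(z/2) |l|^{-z}; the kernel is subtracted because
its constant contribution would make the integral diverge at infinity. -/
lemma IsHeatDiag.mellin_heat (hD : IsHeatDiag D b l) {z : ℂ} (hz : 0 < z.re)
    (hs : Summable fun i => (1 + l i ^ 2) ^ (-(z.re / 2))) :
    mellin (fun t => ((heatRe D 1 t - Module.finrank ℂ (eigenspace D 0) : ℝ) : ℂ)) (z / 2) =
      Complex.Gamma (z / 2) * trace (absPow D z) := by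
  have := hD.countable
  have hz2 : 0 < (z / 2).re := by rw [Complex.div_ofNat_re]; linarith
  have hnorm : ∀ i, ‖(nonzeroInd (l i) : ℂ)‖ / (l i ^ 2) ^ (z / 2).re = ‖absPowFun z (l i)‖ := by
    intro i
    rw [← nonzeroInd_div_cpow, norm_div]
    rcases eq_or_ne (l i) 0 with h | h
    · simp [nonzeroInd, h]
    · rw [Complex.norm_cpow_eq_rpow_re_of_pos (by positivity)]
  have h := hasSum_mellin (a := fun i => (nonzeroInd (l i) : ℂ)) (p := fun i => l i ^ 2)
    (F := fun t => ((heatRe D 1 t - Module.finrank ℂ (eigenspace D 0) : ℝ) : ℂ)) (s := z / 2)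
    (fun i => ?_) hz2 (fun t ht => ?_) ?_
  · rw [← h.tsum_eq, hD.diag.trace_absPow hz hs, ← tsum_mul_left]
    refine tsum_congr fun i => ?_
    rw [mul_div_assoc, nonzeroInd_div_cpow]
  · rcases eq_or_ne (l i) 0 with h | h
    · left; simp [nonzeroInd, h]
    · right; positivity
  · refine hasSum_of_forall_eq (Complex.hasSum_ofReal.2 (hD.hasSum_heatRe_sub_finrank ht)) fun i => ?_
    push_cast
    ring_nf
  · exact ((hD.diag.summable_absPowFun_iff hz).2 hs).congr fun i => (hnorm i).symm

/-- The value of the zeta function at the origin is the constant term of the heat expansion minus the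
dimension of the kernel. -/
theorem IsHeatDiag.hasZetaAtZero (hD : IsHeatDiag D b l) {p : ℕ}
    (hs : ∀ q : ℝ, (p : ℝ) < q → Summable fun i => (1 + l i ^ 2) ^ (-(q / 2))) {a : ℕ → ℂ}
    (ha : HasExpansion p (fun t => ((heatRe D 1 t : ℝ) : ℂ)) a) :
    HasZetaAtZero D p (a p - Module.finrank ℂ (eigenspace D 0)) := by
  obtain ⟨r, hr, hO⟩ := hD.isBigO_heatRe_sub_finrank
  have hE := (ha.sub_const (Module.finrank ℂ (eigenspace D 0) : ℂ)).congr
    (F' := fun t => ((heatRe D 1 t - Module.finrank ℂ (eigenspace D 0) : ℝ) : ℂ))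
    fun t _ => by push_cast; rfl
  have hcont : ContinuousOn
      (fun t => ((heatRe D 1 t - Module.finrank ℂ (eigenspace D 0) : ℝ) : ℂ)) (Set.Ioi 0) := by
    refine Complex.continuous_ofReal.comp_continuousOn (ContinuousOn.sub (fun t ht => ?_)
      continuousOn_const)
    exact (hD.hasDerivAt_heatRe 1 ht).continuousAt.continuousWithinAt
  obtain ⟨Z, hZ, hZeq, hZan, hZ0⟩ := hE.exists_meromorphic hcont hr hO
  refine ⟨Z, hZ, fun z hz => ?_, hZan, by rw [hZ0, if_pos rfl]⟩
  have hz0 : 0 < z.re := (Nat.cast_nonneg p).trans_lt hz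
  refine ⟨(hD.diag.isTraceClass_absPow_iff hz0).2 (hs _ hz), ?_⟩
  have hz2 : 0 < (z / 2).re := by rw [Complex.div_ofNat_re]; linarith
  rw [hZeq z hz, hD.mellin_heat hz0 (hs _ hz), mul_right_comm,
    mul_inv_cancel₀ (Complex.Gamma_ne_zero_of_re_pos hz2), one_mul]

end Spectral

/-! ### Conformal invariance -/

-- Since k is invertible, k D k x = 0 exactly when D (k x) = 0, so k maps one kernel onto the other.
omit [CompleteSpace H] in
lemma finrank_eigenspace_sandwich (D : H →ₗ.[ℂ] H) {k k' : H →L[ℂ] H} (h1 : k * k' = 1)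
    (h2 : k' * k = 1) :
    Module.finrank ℂ (eigenspace (sandwich D k) 0) = Module.finrank ℂ (eigenspace D 0) := by
  let e : H ≃ₗ[ℂ] H := LinearEquiv.ofLinearMap k.toLinearMap k'.toLinearMap
    (LinearMap.ext fun x => congrArg (fun T : H →L[ℂ] H => T x) h1)
    (LinearMap.ext fun x => congrArg (fun T : H →L[ℂ] H => T x) h2)
  have h : (eigenspace (sandwich D k) 0).map (e : H →ₗ[ℂ] H) = eigenspace D 0 := by
    ext y
    rw [Submodule.mem_map_equiv, mem_eigenspace_iff, mem_graph_sandwich h1 h2,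
      mem_eigenspace_iff, Complex.ofReal_zero, zero_smul, zero_smul, map_zero]
    have : k (e.symm y) = y := e.apply_symm_apply y
    rw [this]
  rw [← h, LinearEquiv.finrank_map_eq]

lemma IsHeatDiag.trace_eq_heatRe {ι : Type*} {b : HilbertBasis ι ℂ H} {D : H →ₗ.[ℂ] H}
    {l : ι → ℝ} (hD : IsHeatDiag D b l) {B : H →L[ℂ] H} (hB : IsSelfAdjoint B) {t : ℝ}
    (ht : 0 < t) : trace (B * heat D t) = ((heatRe D B t : ℝ) : ℂ) := by
  rw [trace_mul_eq (hD.isDiagOp_heat ht) (hD.summable_norm ht)]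
  refine (hasSum_of_forall_eq (Complex.hasSum_ofReal.2 (hD.hasSum_heatRe B ht)) fun i => ?_).tsum_eq
  have h : ((inner ℂ (b i) (B (b i))).re : ℂ) = inner ℂ (b i) (B (b i)) := by
    rw [← Complex.conj_eq_iff_re, inner_conj_symm, inner_of_isSelfAdjoint hB]
  rw [Complex.ofReal_mul, h]

section Triple

variable {A : Type*} [Ring A] [StarRing A] [Algebra ℂ A] [StarModule ℂ A]

lemma SpectralTriple.deform_zero (X : SpectralTriple A H) (h : A) : X.deform h 0 = X.D := by
  change sandwich X.D (confExp (X.rep h) 0) = X.D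
  rw [confExp_zero, sandwich_one]

lemma SpectralTriple.deform_smul (X : SpectralTriple A H) (h : A) (s : ℝ) :
    X.deform ((s : ℂ) • h) 1 = X.deform h s := by
  rw [deform, deform, map_smul, smul_smul]
  congr 3
  push_cast
  ring

variable {X : SpectralTriple A H} {p : ℕ} {h : A}

/-- The constant term in the expansion of the heat trace does not change under the deformation. -/
theorem SpectralTriple.IsSummable.exists_hasExpansion (hp : X.IsSummable p) (hh : IsSelfAdjoint h)
    (hE : X.HasHeatExpansions p h) :
    ∃ a : ℕ → ℝ → ℂ, (∀ s ∈ Set.Icc (-1 : ℝ) 1,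
        HasExpansion p (fun t => ((heatRe (X.deform h s) 1 t : ℝ) : ℂ)) fun j => a j s) ∧
      ∀ s ∈ Set.Icc (-1 : ℝ) 1, a p s = a p 0 := by
  have hr : IsSelfAdjoint (X.rep h) := hh.map X.rep
  have hF : HasHeatDiags X.D (X.rep h) := fun s => by
    obtain ⟨ι, e, l, hl, -⟩ := exists_isDiag_confExp X.selfAdjoint X.compactResolvent hp hr s
    exact ⟨ι, e, l, hl⟩
  have htr : ∀ f : A, IsSelfAdjoint (X.rep f) → ∀ s, ∀ t > 0,
      X.heatTrace h f s t = ((heatRe (X.deform h s) (X.rep f) t : ℝ) : ℂ) := fun f hf s t ht => by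
    obtain ⟨ι, e, l, hl⟩ := hF s
    exact hl.trace_eq_heatRe hf ht
  have htr1 : ∀ s, ∀ t > 0, X.heatTrace h 1 s t = ((heatRe (X.deform h s) 1 t : ℝ) : ℂ) :=
    fun s t ht => by
      rw [htr 1 (by rw [map_one]; exact .one _) s t ht, map_one]
  -- The choice f = 1 gives the coefficients and their s-derivatives; f = h gives the logarithm-free
  -- expansion that forces the derivative of a_p to vanish.
  obtain ⟨a, ha, had, ha'⟩ := hE 1
  obtain ⟨c, hc, -, -⟩ := hE h
  refine ⟨a, fun s hs => (ha s hs).congr (htr1 s), ?_⟩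
  have hzero : ∀ s ∈ Set.Icc (-1 : ℝ) 1, derivWithin (a p) (Set.Icc (-1) 1) s = 0 := by
    intro s hs
    obtain ⟨ι, e, l, hl⟩ := hF s
    refine HasExpansion.constant_term_eq_zero
      (F := fun t => ((heatRe (X.deform h s) (X.rep h) t : ℝ) : ℂ))
      (F' := fun t => ((-heatSqRe (X.deform h s) (X.rep h) t : ℝ) : ℂ))
      (b := fun j => derivWithin (a j) (Set.Icc (-1) 1) s)
      ((hc s hs).congr (htr h hr s)) (fun t ht => (hl.hasDerivAt_heatRe _ ht).ofReal_comp)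
      ((ha' s hs).congr fun t ht => ?_)
    have h1 : (fun u => X.heatTrace h 1 u t) =
        fun u => ((heatRe (X.deform h u) 1 t : ℝ) : ℂ) := funext fun u => htr1 u t ht
    have h2 := (hF.hasDerivWithinAt_heatRe_one hr ht hs).ofReal_comp
    rw [h1]
    refine (h2.derivWithin (uniqueDiffOn_Icc (by norm_num) s hs)).trans ?_
    change _ = 2 * (t : ℂ) *
      ((-heatSqRe (sandwich X.D (confExp (X.rep h) s)) (X.rep h) t : ℝ) : ℂ)
    push_cast
    ring
  have hconst := constant_of_derivWithin_zero (had p) fun s hs => hzero s ⟨hs.1, hs.2.le⟩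
  intro s hs
  rw [hconst s hs, hconst 0 (by norm_num)]

/-- The value is expressed by an expansion for `X.D` alone, and this expansion is returned so that
different h can be compared by uniqueness of the constant term. -/
theorem SpectralTriple.IsSummable.exists_hasZetaAtZero (hp : X.IsSummable p)
    (hh : IsSelfAdjoint h) (hE : X.HasHeatExpansions p h) :
    ∃ a : ℕ → ℂ, HasExpansion p (fun t => ((heatRe X.D 1 t : ℝ) : ℂ)) a ∧
      ∀ s ∈ Set.Icc (-1 : ℝ) 1, HasZetaAtZero (X.deform h s) p
        (a p - Module.finrank ℂ (eigenspace X.D 0)) := by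
  obtain ⟨a, ha, hconst⟩ := hp.exists_hasExpansion hh hE
  have h0 := ha 0 (by norm_num)
  rw [X.deform_zero] at h0
  refine ⟨_, h0, fun s hs => ?_⟩
  obtain ⟨ι, e, l, hl, hsum⟩ := exists_isDiag_confExp X.selfAdjoint X.compactResolvent hp
    (hh.map X.rep) s
  have hz := hl.hasZetaAtZero hsum (ha s hs)
  rw [finrank_eigenspace_sandwich X.D (confExp_mul_neg _ s) (confExp_neg_mul _ s),
    hconst s hs] at hz
  exact hz

end Triple

end ConformalIndex

end

/-! ### The main theorem -/

theorem mainTheorem7 {A H : Type*} [Ring A] [StarRing A] [Algebra ℂ A] [StarModule ℂ A]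
    [NormedAddCommGroup H] [InnerProductSpace ℂ H] [CompleteSpace H]
    (X : ConformalIndex.SpectralTriple A H) (p : ℕ) (hp : X.IsSummable p)
    (hd : X.HasDiscreteDimensionSpectrum p) :
    (∀ h : A, IsSelfAdjoint h → X.HasHeatExpansions p h →
      ∃ v : ℂ, ConformalIndex.HasZetaAtZero X.D p v ∧
        ∀ s ∈ Set.Icc (-1 : ℝ) 1, ConformalIndex.HasZetaAtZero (X.deform h s) p v) ∧
    ((∀ h : A, IsSelfAdjoint h → X.HasHeatExpansions p h) →
      ∃ v : ℂ, ConformalIndex.HasZetaAtZero X.D p v ∧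
        ∀ h : A, IsSelfAdjoint h → ∀ s : ℝ,
          ConformalIndex.HasZetaAtZero (X.deform h s) p v) := by
  constructor
  · intro h hh hE
    obtain ⟨a, -, hz⟩ := hp.exists_hasZetaAtZero hh hE
    have h0 := hz 0 (by norm_num)
    rw [X.deform_zero] at h0
    exact ⟨_, h0, hz⟩
  · intro hE
    -- The choice h = 0 supplies an expansion for D, fixing one value v before any other h is given.
    obtain ⟨a, ha, hz⟩ := hp.exists_hasZetaAtZero (IsSelfAdjoint.zero A) (hE 0 (.zero A))
    have h0 := hz 0 (by norm_num)
    rw [X.deform_zero] at h0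
    refine ⟨_, h0, fun h hh s => ?_⟩
    -- D_{sh} is the deformation by the self-adjoint element s h at parameter 1, which lies in [-1,
    -- 1]; this reaches every real s.
    have hsh : IsSelfAdjoint ((s : ℂ) • h) := by
      rw [isSelfAdjoint_iff, star_smul, hh.star_eq, RCLike.star_def, Complex.conj_ofReal]
    obtain ⟨c, hc, hzc⟩ := hp.exists_hasZetaAtZero hsh (hE _ hsh)
    have h1 := hzc 1 (by norm_num)
    rwa [X.deform_smul, hc.coeff_unique ha] at h1
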